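/- Let $(a_k)_{k\ge 1}$ and $(b_k)_{k\ge 1}$ be two independent stationary Gaussian processes on a probability space, consisting of centered random variables of unit variance, with the same covariance function $\rho(k-\ell)=\mathbb E[a_ka_\ell]=\mathbb E[b_kb_\ell]$, $k,\ell\ge1$. Let $\mu_\rho$ be the associated spectral measure, i.e. a symmetric probability measure on $[-\pi,\pi]$ such that $\rho(k)=\int_{-\pi}^{\pi}e^{-ikx}\,\mu_\rho(dx)$ for all $k\in\mathbb Z$. For $n\ge 1$ let $$f_n(x)=\frac1{\sqrt n}\sum_{k=1}^n\bigl(a_k\cos(kx)+b_k\sin(kx)\bigr),$$ and let $\mathcal N(f_n,[0,2\pi])=\#\{t\in[0,2\pi]: f_n(t)=0\}$ be its number of zeros in $[0,2\pi]$. Suppose that $$\mu_\rho(dx)=\mu_\rho^s(dx)+\psi_\rho(x)\,dx \quad\text{on } [-\pi,\pi],$$ where $\mu_\rho^s$ is an arbitrary measure singular with respect to Lebesgue measure and $\psi_\rho\ge 0$ is the density of the absolutely continuous part, extended $2\pi$-periodically to $\mathbb R$. Assume that there exists $\eta\in(0,1)$ such that $\log\psi_\rho\in L^{1+\eta}([0,2\pi])$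 (in particular $\psi_\rho>0$ almost everywhere). Then $$\lim_{n\to+\infty}\mathbb E\left[\frac{\mathcal N(f_n,[0,2\pi])}{n}\right]=\frac{2}{\sqrt3}.$$ -/

import Mathlib

open MeasureTheory ProbabilityTheory Filter Topology
open scoped ENNReal

/-- `a = (a_k)_{k ≥ 1}` is a Gaussian process, centred, of unit variance and stationary, with
covariance function `ρ`: `E[a_k a_l] = ρ (k - l)`. (Applied to `k - l` and `l - k`, the last
condition makes `ρ` even, so `ρ (k - l) = ρ |k - l|`.) -/
structure IsStationaryGaussian {Ω : Type*} [MeasurableSpace Ω] (P : Measure Ω)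
    (ρ : ℤ → ℝ) (a : ℕ+ → Ω → ℝ) : Prop where
  gaussian : IsGaussianProcess a P
  centered : ∀ k, ∫ ω, a k ω ∂P = 0
  unit_variance : ∀ k, ∫ ω, a k ω ^ 2 ∂P = 1
  covariance : ∀ k l : ℕ+, ∫ ω, a k ω * a l ω ∂P = ρ ((k : ℤ) - (l : ℤ))

/-- `μ` is a spectral measure of the covariance function `ρ`: a symmetric probability measure
carried by `[-π, π]` such that `ρ(k) = ∫_{-π}^{π} e^{-ikx} μ(dx)` for every integer `k`. -/
structure IsSpectralMeasure (ρ : ℤ → ℝ) (μ : Measure ℝ) : Prop where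
  isProbabilityMeasure : IsProbabilityMeasure μ
  carried : μ (Set.Icc (-Real.pi) Real.pi)ᶜ = 0
  symmetric : μ.map (fun x => -x) = μ
  fourier : ∀ k : ℤ, (ρ k : ℂ) =
    ∫ x in Set.Icc (-Real.pi) Real.pi, Complex.exp (-Complex.I * k * x) ∂μ

/-- The decomposition `μ = μs + ψ(x) dx` on `[-π, π]`, where `μs` is singular with respect to
Lebesgue measure and the nonnegative density `ψ` is extended to `ℝ` as a `2π`-periodic function. -/
structure IsLebesgueDecomposition (μ μs : Measure ℝ) (ψ : ℝ → ℝ) : Prop where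
  singular : μs ⟂ₘ (volume : Measure ℝ)
  measurable : Measurable ψ
  nonneg : ∀ x, 0 ≤ ψ x
  periodic : Function.Periodic ψ (2 * Real.pi)
  eq_add : μ = μs + (volume.restrict (Set.Icc (-Real.pi) Real.pi)).withDensity
    (fun x => ENNReal.ofReal (ψ x))

/-- `log ψ ∈ L^p([0, 2π])`. Since `log 0 = -∞` in the mathematical convention (but
`Real.log 0 = 0`), membership includes the positivity of `ψ` almost everywhere. -/
def LogMemLp (ψ : ℝ → ℝ) (p : ℝ) : Prop :=
  (∀ᵐ x ∂(volume.restrict (Set.Icc 0 (2 * Real.pi))), 0 < ψ x) ∧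
    MemLp (fun x => Real.log (ψ x)) (ENNReal.ofReal p)
      (volume.restrict (Set.Icc 0 (2 * Real.pi)))

/-- The random trigonometric polynomial
`f_n(x) = n^{-1/2} ∑_{k=1}^n (a_k cos(kx) + b_k sin(kx))`
(the summation index `j` runs over `0, …, n-1` and `k = j + 1`). -/
noncomputable def trigPoly {Ω : Type*} (a b : ℕ+ → Ω → ℝ) (n : ℕ) (ω : Ω) (x : ℝ) : ℝ :=
  1 / Real.sqrt n * ∑ j ∈ Finset.range n,
    (a j.succPNat ω * Real.cos ((j + 1 : ℕ) * x) + b j.succPNat ω * Real.sin ((j + 1 : ℕ) * x))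

/-- `N(f, [s, t])`, the number (possibly infinite) of zeros of `f` in `[s, t]`. -/
noncomputable def numZeros (f : ℝ → ℝ) (s t : ℝ) : ℕ∞ :=
  {x ∈ Set.Icc s t | f x = 0}.encard

/-!
The expected number of zeros is squeezed between two bounds at the scale `ε / n`, which both tend to
`2 / √3` as `n → ∞` and then `ε → 0`. No Kac-Rice formula is used, so the derivative of the
polynomial never enters.

Upper bound. By Jensen's formula the mean of `log |f_n|` over a period of a horizontal line is an
even convex function of the height, with a kink at `0` for each real zero
(`numZeros_mul_le_logMean`). Hence the expected number of zeros is at most `2 n / ε` times the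
expected increase of that mean up to height `ε / n`. At a complex point, `f_n` is a Gaussian vector
`U + iV`, and `E log |U + iV|` is at most the logarithm of the sum of the standard deviations, up to
an additive constant that is exact on the real axis (`IsGaussianPair.integral_log_norm_le`). There
remains the integral over `x` of the logarithm of a ratio of standard deviations.

Lower bound. A sign change between `x` and `x + ε / n` produces a zero in between, so the expected
number of zeros is at least `n / ε` times the integral over `x` of the probability of such a sign
change, up to a boundary term (`volume_sign_change_le`). For a Gaussian pair of correlation `r` this
probability is at least `√(2 (1 - r)) / π` (`IsGaussianPair.le_measure_mul_neg`).

Both bounds involve variances of linear forms with weights `g(k/n) e^{ikx}`. These variances are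
integrals against the spectral measure of kernels that concentrate at `x`, and divided by `n` they
converge to `2π ψ(x) ∫₀¹ |g|²` for almost every `x`: the singular part has derivative zero there and
`x` is a Lebesgue point of `ψ` (`IsLebesgueDecomposition.ae_tendsto_specVar`). The factor `ψ(x)`
cancels in both bounds. In the lower one Fatou's lemma concludes. In the upper one the integral of
the logarithm of the ratio is controlled separately for the numerator, by Fatou's lemma and a bound
in `L²`, and for the denominator, by Jensen's inequality against the Fejér kernel
(`IsLebesgueDecomposition.eventually_integral_log_sub_le`); this is where the integrability of
`log ψ` is used.
-/

/-! ### Real zeros and the growth of the mean of `log |f|` -/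

/-- The trigonometric polynomial `∑_{k=1}^n (A_k cos(kz) + B_k sin(kz))` at a complex argument. -/
noncomputable def complexTrigSum (A B : ℕ → ℝ) (n : ℕ) (z : ℂ) : ℂ :=
  ∑ j ∈ Finset.range n, ((A j : ℂ) * Complex.cos ((j + 1 : ℕ) * z)
    + (B j : ℂ) * Complex.sin ((j + 1 : ℕ) * z))

/-- The polynomial `Q` of degree at most `2n` with `Q(e^{iz}) = e^{inz} f(z)`, where `f` is the
trigonometric polynomial with coefficients `A`, `B`. -/
noncomputable def trigNumerator (A B : ℕ → ℝ) (n : ℕ) : Polynomial ℂ :=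
  ∑ j ∈ Finset.range n,
    (Polynomial.C (((A j : ℂ) - Complex.I * B j) / 2) * Polynomial.X ^ (n + (j + 1))
      + Polynomial.C (((A j : ℂ) + Complex.I * B j) / 2) * Polynomial.X ^ (n - (j + 1)))

lemma eval_trigNumerator (A B : ℕ → ℝ) (n : ℕ) (z : ℂ) :
    (trigNumerator A B n).eval (Complex.exp (z * Complex.I))
      = Complex.exp (n * (z * Complex.I)) * complexTrigSum A B n z := by
  rw [trigNumerator, complexTrigSum, Polynomial.eval_finsetSum, Finset.mul_sum]
  refine Finset.sum_congr rfl fun j hj => ?_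
  have hj' : j + 1 ≤ n := Finset.mem_range.1 hj
  have h1 : Complex.exp (z * Complex.I) ^ (n + (j + 1))
      = Complex.exp (n * (z * Complex.I)) * Complex.exp (((j + 1 : ℕ) * z) * Complex.I) := by
    rw [← Complex.exp_nat_mul, ← Complex.exp_add]; congr 1; push_cast; ring
  have h2 : Complex.exp (z * Complex.I) ^ (n - (j + 1))
      = Complex.exp (n * (z * Complex.I)) * Complex.exp (-((j + 1 : ℕ) * z) * Complex.I) := by
    rw [← Complex.exp_nat_mul, ← Complex.exp_add, Nat.cast_sub hj']; congr 1; ring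
  simp only [Polynomial.eval_add, Polynomial.eval_mul, Polynomial.eval_C, Polynomial.eval_pow,
    Polynomial.eval_X, h1, h2, Complex.cos, Complex.sin]
  ring_nf

/-- Jensen's formula on the circle of radius `r`. -/
lemma logMahlerMeasure_comp_C_mul_X {p : Polynomial ℂ} (hp : p ≠ 0) {r : ℝ} (hr : 0 < r) :
    (p.comp (Polynomial.C (r : ℂ) * Polynomial.X)).logMahlerMeasure
      = Real.log ‖p.leadingCoeff‖ + p.natDegree * Real.log r
        + (p.roots.map (fun a => Real.posLog (‖a‖ / r))).sum := by
  have hr' : (r : ℂ) ≠ 0 := by exact_mod_cast hr.ne'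
  have h := p.roots_comp_C_mul_X_add_C (r : ℂ) 0 (isUnit_iff_ne_zero.2 hr')
  rw [Polynomial.C_0, add_zero] at h
  rw [Polynomial.logMahlerMeasure_eq_log_leadingCoeff_add_sum_log_roots, h,
    Polynomial.leadingCoeff_comp (by rw [Polynomial.natDegree_C_mul_X _ hr']; simp)]
  have hl : p.leadingCoeff ≠ 0 := by simpa using hp
  rw [Multiset.map_map]
  congr 1
  · rw [norm_mul, Real.log_mul (by simpa using hl) (by simp [hr.ne'])]
    simp [abs_of_pos hr]
  · congr 1
    refine Multiset.map_congr rfl fun a _ => ?_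
    simp [abs_of_pos hr, div_eq_inv_mul]

/-- Convexity of `s ↦ log⁺ (a e^{-s})`, with its kink at `s = 0` when `a = 1`. -/
lemma posLog_second_difference {a h : ℝ} (ha : 0 ≤ a) (hh : 0 < h) :
    (if a = 1 then h else 0) ≤ Real.posLog (a / Real.exp (-h)) + Real.posLog (a / Real.exp h)
      - 2 * Real.posLog (a / 1) := by
  rcases ha.eq_or_lt with rfl | ha
  · simp
  have key : ∀ s : ℝ, Real.posLog (a / Real.exp s) = max 0 (Real.log a - s) := by
    intro s
    change max 0 (Real.log (a / Real.exp s)) = _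
    rw [Real.log_div ha.ne' (Real.exp_pos s).ne', Real.log_exp]
  have k0 : Real.posLog (a / 1) = max 0 (Real.log a) := by simp [Real.posLog_def]
  rw [key, key, k0]
  split_ifs with h1
  · subst h1
    simp [max_eq_right hh.le, max_eq_left (neg_nonpos.2 hh.le)]
  · rcases le_total 0 (Real.log a) with h2 | h2
    · rw [max_eq_right h2]
      linarith [le_max_right 0 (Real.log a - -h), le_max_right 0 (Real.log a - h)]
    · rw [max_eq_left h2]
      linarith [le_max_left 0 (Real.log a - -h), le_max_left 0 (Real.log a - h)]

/-- The second difference of the Mahler measure over radii `e^{-h}, 1, e^h` counts at least the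
roots on the unit circle, because every other root contributes a nonnegative amount. -/
lemma card_roots_norm_one_mul_le {p : Polynomial ℂ} (hp : p ≠ 0) {h : ℝ} (hh : 0 < h) :
    ((p.roots.filter (fun a => ‖a‖ = 1)).card : ℝ) * h
      ≤ (p.comp (Polynomial.C ((Real.exp (-h) : ℝ) : ℂ) * Polynomial.X)).logMahlerMeasure
        + (p.comp (Polynomial.C ((Real.exp h : ℝ) : ℂ) * Polynomial.X)).logMahlerMeasure
        - 2 * (p.comp (Polynomial.C ((1 : ℝ) : ℂ) * Polynomial.X)).logMahlerMeasure := by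
  rw [logMahlerMeasure_comp_C_mul_X hp (Real.exp_pos _),
    logMahlerMeasure_comp_C_mul_X hp (Real.exp_pos _), logMahlerMeasure_comp_C_mul_X hp one_pos,
    Real.log_exp, Real.log_exp, Real.log_one]
  have : ∀ s : Multiset ℂ, ((s.filter (fun a => ‖a‖ = 1)).card : ℝ) * h
      ≤ (s.map (fun a => Real.posLog (‖a‖ / Real.exp (-h)))).sum
        + (s.map (fun a => Real.posLog (‖a‖ / Real.exp h))).sum
        - 2 * (s.map (fun a => Real.posLog (‖a‖ / 1))).sum := by
    intro s
    induction s using Multiset.induction_on with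
    | empty => simp
    | cons a s ih =>
      have := posLog_second_difference (norm_nonneg a) hh
      simp only [Multiset.map_cons, Multiset.sum_cons, Multiset.filter_cons]
      split_ifs at this ⊢ with h1
      · simp only [Multiset.card_add, Multiset.card_singleton]
        push_cast
        linarith
      · simp only [zero_add]
        linarith
  have := this p.roots
  linarith

/-- The mean of `log |f|` over a period of the horizontal line at height `h`. -/
noncomputable def logMean (A B : ℕ → ℝ) (n : ℕ) (h : ℝ) : ℝ :=
  (2 * Real.pi)⁻¹ * ∫ x in (0 : ℝ)..(2 * Real.pi),
    Real.log ‖complexTrigSum A B n (x + h * Complex.I)‖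

lemma complexTrigSum_conj (A B : ℕ → ℝ) (n : ℕ) (z : ℂ) :
    complexTrigSum A B n (starRingEnd ℂ z) = starRingEnd ℂ (complexTrigSum A B n z) := by
  simp only [complexTrigSum, map_sum, map_add, map_mul, Complex.conj_ofReal, ← Complex.cos_conj,
    ← Complex.sin_conj, map_natCast]

lemma logMean_neg (A B : ℕ → ℝ) (n : ℕ) (h : ℝ) :
    logMean A B n (-h) = logMean A B n h := by
  rw [logMean, logMean]
  congr 2
  funext x
  have : (x : ℂ) + ((-h : ℝ) : ℂ) * Complex.I = starRingEnd ℂ (x + h * Complex.I) := by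
    simp
  rw [this, complexTrigSum_conj, Complex.norm_conj]

/-- On the circle of radius `e^{-h}`, `e^{iz}` runs over the horizontal line of height `h`. -/
lemma logMahlerMeasure_trigNumerator {A B : ℕ → ℝ} {n : ℕ} (hQ : trigNumerator A B n ≠ 0) (h : ℝ) :
    n * h + ((trigNumerator A B n).comp
      (Polynomial.C ((Real.exp (-h) : ℝ) : ℂ) * Polynomial.X)).logMahlerMeasure
      = logMean A B n h := by
  have hr' : ((Real.exp (-h) : ℝ) : ℂ) ≠ 0 := by exact_mod_cast (Real.exp_pos _).ne'
  have hc : ((Real.exp (n * h) : ℝ) : ℂ) ≠ 0 := by exact_mod_cast (Real.exp_pos _).ne'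
  have hQ' : (trigNumerator A B n).comp
      (Polynomial.C ((Real.exp (-h) : ℝ) : ℂ) * Polynomial.X) ≠ 0 := by
    intro h0
    rw [Polynomial.comp_eq_zero_iff] at h0
    rcases h0 with h0 | ⟨-, h0⟩
    · exact hQ h0
    · have := congrArg Polynomial.natDegree h0
      rw [Polynomial.natDegree_C_mul_X _ hr', Polynomial.natDegree_C] at this
      exact one_ne_zero this
  have h1 := Polynomial.logMahlerMeasure_C_mul hc hQ'
  rw [Complex.norm_real, Real.norm_of_nonneg (Real.exp_pos _).le, Real.log_exp] at h1
  rw [← h1, Polynomial.logMahlerMeasure_def, Real.circleAverage, logMean, smul_eq_mul]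
  congr 2
  funext x
  have h2 : ((Real.exp (-h) : ℝ) : ℂ) * circleMap 0 1 x
      = Complex.exp ((x + h * Complex.I) * Complex.I) := by
    rw [circleMap, Complex.ofReal_exp]
    simp only [Complex.ofReal_one, one_mul, zero_add]
    rw [← Complex.exp_add]
    congr 1
    push_cast
    linear_combination (-(h : ℂ)) * Complex.I_mul_I
  rw [Polynomial.eval_mul, Polynomial.eval_C, Polynomial.eval_comp, Polynomial.eval_mul,
    Polynomial.eval_C, Polynomial.eval_X, h2, eval_trigNumerator, norm_mul, norm_mul,
    ← mul_assoc, Complex.norm_exp, Complex.norm_real, Real.norm_of_nonneg (Real.exp_pos _).le,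
    ← Real.exp_add]
  have : (n : ℝ) * h + ((n : ℂ) * ((x + h * Complex.I) * Complex.I)).re = 0 := by
    simp [add_mul]
  rw [this, Real.exp_zero, one_mul]

/-- The real zeros of a trigonometric polynomial are controlled by the growth of the mean of
`log |f|` away from the real axis: by Jensen's formula that mean is an even convex function of the
height, and each real zero contributes a kink at height `0`. -/
theorem numZeros_mul_le_logMean {A B : ℕ → ℝ} {n : ℕ} {g : ℝ → ℝ}
    (hg : ∀ x : ℝ, (g x : ℂ) = complexTrigSum A B n x) (h0 : g 0 ≠ 0) {h : ℝ} (hh : 0 < h) :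
    0 ≤ 2 / h * (logMean A B n h - logMean A B n 0) ∧
    (numZeros g 0 (2 * Real.pi) : ℝ≥0∞)
      ≤ ENNReal.ofReal (2 / h * (logMean A B n h - logMean A B n 0)) := by
  classical
  set Q := trigNumerator A B n with hQdef
  have hQe : ∀ x : ℝ, Q.eval (Complex.exp (x * Complex.I))
      = Complex.exp (n * (x * Complex.I)) * g x := by
    intro x; rw [hg]; exact eval_trigNumerator A B n x
  have hQ : Q ≠ 0 := by
    intro hQ0
    have := hQe 0
    rw [hQ0] at this
    simp only [Polynomial.eval_zero, Complex.ofReal_zero, zero_mul, mul_zero, Complex.exp_zero,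
      one_mul] at this
    exact h0 (by exact_mod_cast this.symm)
  -- the zeros in `[0, 2π]` inject into the unit circle since `2π` is not one of them
  have h2π : g (2 * Real.pi) ≠ 0 := by
    intro h1
    have e1 := hQe (2 * Real.pi)
    have e0 := hQe 0
    rw [h1] at e1
    push_cast at e1 e0
    rw [Complex.exp_two_pi_mul_I] at e1
    simp only [zero_mul, Complex.exp_zero, mul_zero, one_mul] at e1 e0
    rw [e1] at e0
    exact h0 (by exact_mod_cast e0.symm)
  have hcard : numZeros g 0 (2 * Real.pi) ≤ ((Q.roots.filter (fun a => ‖a‖ = 1)).card : ℕ∞) := by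
    have hinj : Set.InjOn (fun x : ℝ => Complex.exp (x * Complex.I))
        {x ∈ Set.Icc 0 (2 * Real.pi) | g x = 0} := by
      have hIoo : ∀ x ∈ {x ∈ Set.Icc 0 (2 * Real.pi) | g x = 0}, x < 2 * Real.pi := by
        rintro x ⟨hx, hx0⟩
        exact lt_of_le_of_ne hx.2 (fun h => h2π (h ▸ hx0))
      intro x hx y hy hxy
      have := Complex.exp_eq_exp_iff_exists_int.1 hxy
      obtain ⟨m, hm⟩ := this
      have hm' : x = y + m * (2 * Real.pi) := by
        have h3 : (x : ℂ) * Complex.I = ((y + m * (2 * Real.pi) : ℝ) : ℂ) * Complex.I := by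
          rw [hm]; push_cast; ring
        exact_mod_cast mul_right_cancel₀ Complex.I_ne_zero h3
      have hx1 := hIoo x hx
      have hy1 := hIoo y hy
      have hx0 := hx.1.1
      have hy0 := hy.1.1
      have hπ := Real.pi_pos
      have hmlt : (m : ℝ) < 1 := by nlinarith
      have hmgt : (-1 : ℝ) < m := by nlinarith
      have : m = 0 := by
        have h1 : m < 1 := by exact_mod_cast hmlt
        have h2 : -1 < m := by exact_mod_cast hmgt
        omega
      rw [hm', this]; simp
    calc numZeros g 0 (2 * Real.pi)
        = ((fun x : ℝ => Complex.exp (x * Complex.I)) ''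
            {x ∈ Set.Icc 0 (2 * Real.pi) | g x = 0}).encard := (hinj.encard_image).symm
      _ ≤ ((Q.roots.filter (fun a => ‖a‖ = 1)).toFinset : Set ℂ).encard := by
          refine Set.encard_le_encard ?_
          rintro _ ⟨x, ⟨-, hx⟩, rfl⟩
          simp only [Multiset.toFinset_filter, Finset.coe_filter, Multiset.mem_toFinset,
            Set.mem_ofPred_eq]
          refine ⟨?_, Complex.norm_exp_ofReal_mul_I x⟩
          rw [Polynomial.mem_roots hQ, Polynomial.IsRoot, hQe, hx]
          simp
      _ ≤ _ := by
          rw [Set.encard_coe_eq_coe_finsetCard]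
          exact_mod_cast Multiset.toFinset_card_le _
  have hle := card_roots_norm_one_mul_le hQ hh
  have e1 := logMahlerMeasure_trigNumerator hQ h
  have e2 := logMahlerMeasure_trigNumerator hQ (-h)
  have e3 := logMahlerMeasure_trigNumerator hQ 0
  rw [neg_neg, logMean_neg] at e2
  rw [neg_zero, Real.exp_zero] at e3
  have hfin : ((Q.roots.filter (fun a => ‖a‖ = 1)).card : ℝ)
      ≤ 2 / h * (logMean A B n h - logMean A B n 0) := by
    rw [div_mul_eq_mul_div, le_div_iff₀ hh]
    linarith
  refine ⟨(Nat.cast_nonneg _).trans hfin, ?_⟩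
  calc (numZeros g 0 (2 * Real.pi) : ℝ≥0∞)
      ≤ (((Q.roots.filter (fun a => ‖a‖ = 1)).card : ℕ∞) : ℝ≥0∞) := by exact_mod_cast hcard
    _ = ENNReal.ofReal ((Q.roots.filter (fun a => ‖a‖ = 1)).card : ℝ) := by
        rw [ENNReal.ofReal_natCast]; rfl
    _ ≤ _ := ENNReal.ofReal_le_ofReal hfin

/-! ### Zeros of continuous functions: measurability and sign changes -/

lemma enat_toENNReal_eq_iSup (N : ℕ∞) :
    (N : ℝ≥0∞) = ⨆ m : ℕ, if (m : ℕ∞) ≤ N then (m : ℝ≥0∞) else 0 := by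
  apply le_antisymm
  · induction N using ENat.recTopCoe with
    | top => simp [ENNReal.iSup_natCast]
    | coe k => exact le_iSup_of_le k (by simp)
  · refine iSup_le fun m => ?_
    split_ifs with h
    · exact_mod_cast ENat.toENNReal_le.2 h
    · exact zero_le

/-- The set of parameters for which a continuous family has `m` zeros in a compact set is a
countable union of projections, along a compact space, of closed sets of separated zeros. -/
lemma measurableSet_le_encard_zeros {C : Type*} [TopologicalSpace C] [MeasurableSpace C]
    [OpensMeasurableSpace C] {F : C → ℝ → ℝ} (hF : Continuous (fun p : C × ℝ => F p.1 p.2))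
    {K : Set ℝ} (hK : IsCompact K) (m : ℕ) :
    MeasurableSet {c : C | (m : ℕ∞) ≤ {x ∈ K | F c x = 0}.encard} := by
  let T : ℕ → Set (Fin m → ℝ) := fun q =>
    (Set.univ.pi fun _ => K) ∩ {t | ∀ i j, i ≠ j → 1 / ((q : ℝ) + 1) ≤ |t i - t j|}
  have hT : ∀ q, IsCompact (T q) := by
    intro q
    refine (isCompact_univ_pi fun _ => hK).inter_right ?_
    have : {t : Fin m → ℝ | ∀ i j, i ≠ j → 1 / ((q : ℝ) + 1) ≤ |t i - t j|}
        = ⋂ i, ⋂ j, ⋂ (_ : i ≠ j), {t | 1 / ((q : ℝ) + 1) ≤ |t i - t j|} := by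
      ext t; simp
    rw [this]
    exact isClosed_iInter fun i => isClosed_iInter fun j => isClosed_iInter fun _ =>
      isClosed_le continuous_const (by fun_prop)
  have hcl : ∀ q, IsClosed {c : C | ∃ t ∈ T q, ∀ i, F c (t i) = 0} := by
    intro q
    have : CompactSpace (T q) := isCompact_iff_compactSpace.1 (hT q)
    have h1 : IsClosed {p : C × T q | ∀ i, F p.1 (p.2.1 i) = 0} := by
      have : {p : C × T q | ∀ i, F p.1 (p.2.1 i) = 0}
          = ⋂ i, {p | F p.1 (p.2.1 i) = 0} := by ext; simp
      rw [this]
      refine isClosed_iInter fun i => isClosed_eq ?_ continuous_const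
      exact hF.comp (continuous_fst.prodMk
        ((continuous_apply i).comp (continuous_subtype_val.comp continuous_snd)))
    have h2 := isClosedMap_fst_of_compactSpace (X := C) (Y := T q) _ h1
    convert h2 using 1
    ext c
    constructor
    · rintro ⟨t, ht, h⟩
      exact ⟨(c, ⟨t, ht⟩), h, rfl⟩
    · rintro ⟨⟨c', t⟩, h, rfl⟩
      exact ⟨t.1, t.2, h⟩
  have : {c : C | (m : ℕ∞) ≤ {x ∈ K | F c x = 0}.encard}
      = ⋃ q, {c : C | ∃ t ∈ T q, ∀ i, F c (t i) = 0} := by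
    ext c
    simp only [Set.mem_ofPred_eq, Set.mem_iUnion]
    constructor
    -- finitely many distinct zeros are `1 / (q + 1)`-separated for some `q`
    · intro h
      obtain ⟨s, hs, hsm⟩ := Set.exists_subset_encard_eq h
      have hfin : s.Finite := Set.finite_of_encard_eq_coe hsm
      have := hfin.fintype
      have hc : Fintype.card s = m := by
        have := Set.encard_eq_coe_toFinset_card s
        rw [hsm, Set.toFinset_card] at this
        exact_mod_cast this.symm
      let e : Fin m ≃ s := (Fintype.equivFinOfCardEq hc).symm
      have hsep : ∀ᶠ q : ℕ in atTop, ∀ i j, i ≠ j →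
          1 / ((q : ℝ) + 1) ≤ |((e i : s) : ℝ) - (e j : s)| := by
        refine eventually_all.2 fun i => eventually_all.2 fun j => ?_
        by_cases hij : i = j
        · exact Eventually.of_forall fun q h => absurd hij h
        · have hpos : 0 < |((e i : s) : ℝ) - (e j : s)| := by
            rw [abs_pos, sub_ne_zero]
            intro h
            exact hij (e.injective (Subtype.ext h))
          filter_upwards [tendsto_one_div_add_atTop_nhds_zero_nat.eventually
            (gt_mem_nhds hpos)] with q hq _ using hq.le
      obtain ⟨q, hq⟩ := hsep.exists
      exact ⟨q, fun i => (e i : s), ⟨fun i _ => (hs (e i).2).1, hq⟩, fun i => (hs (e i).2).2⟩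
    · rintro ⟨q, t, ⟨htK, ht⟩, h0⟩
      have hinj : Function.Injective t := by
        intro i j hij
        by_contra hne
        have := ht i j hne
        rw [hij, sub_self, abs_zero] at this
        exact absurd this (not_le.2 (by positivity))
      calc (m : ℕ∞) = (Set.univ : Set (Fin m)).encard := by simp
        _ = (t '' Set.univ).encard := (hinj.encard_image _).symm
        _ ≤ _ := Set.encard_le_encard (by
          rintro _ ⟨i, -, rfl⟩
          exact ⟨htK i trivial, h0 i⟩)
  rw [this]
  exact MeasurableSet.iUnion fun q => (hcl q).measurableSet

/-- The number of zeros of a continuous family in a compact set is a measurable function of the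
parameter. -/
lemma measurable_encard_zeros {C : Type*} [TopologicalSpace C] [MeasurableSpace C]
    [OpensMeasurableSpace C] {F : C → ℝ → ℝ} (hF : Continuous (fun p : C × ℝ => F p.1 p.2))
    {K : Set ℝ} (hK : IsCompact K) :
    Measurable (fun c : C => ({x ∈ K | F c x = 0}.encard : ℝ≥0∞)) := by
  have : (fun c : C => ({x ∈ K | F c x = 0}.encard : ℝ≥0∞))
      = fun c => ⨆ m : ℕ, {c : C | (m : ℕ∞) ≤ {x ∈ K | F c x = 0}.encard}.indicator
          (fun _ => (m : ℝ≥0∞)) c := by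
    funext c
    rw [enat_toENNReal_eq_iSup]
    classical
    simp [Set.indicator_apply]
  rw [this]
  exact Measurable.iSup fun m =>
    measurable_const.indicator (measurableSet_le_encard_zeros hF hK m)

/-- Each sign change of a continuous function over a step `δ` is witnessed by a zero, and a zero
witnesses a set of sign changes of measure at most `δ`. -/
lemma volume_sign_change_le {g : ℝ → ℝ} (hg : Continuous g) {δ : ℝ} (hδ : 0 < δ) (L : ℝ) :
    volume {x ∈ Set.Icc 0 (L - δ) | g x * g (x + δ) < 0}
      ≤ ENNReal.ofReal δ * (numZeros g 0 L : ℝ≥0∞) := by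
  by_cases hfin : {x ∈ Set.Icc 0 L | g x = 0}.Finite
  · have hsub : {x ∈ Set.Icc 0 (L - δ) | g x * g (x + δ) < 0}
        ⊆ ⋃ z ∈ hfin.toFinset, Set.Icc (z - δ) z := by
      rintro x ⟨hx, hneg⟩
      have hxδ : x ≤ x + δ := by linarith
      have : ∃ z ∈ Set.Icc x (x + δ), g z = 0 := by
        rcases mul_neg_iff.1 hneg with ⟨h1, h2⟩ | ⟨h1, h2⟩
        · exact intermediate_value_Icc' hxδ hg.continuousOn ⟨h2.le, h1.le⟩
        · exact intermediate_value_Icc hxδ hg.continuousOn ⟨h1.le, h2.le⟩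
      obtain ⟨z, hz, hz0⟩ := this
      simp only [Set.mem_iUnion]
      refine ⟨z, hfin.mem_toFinset.2 ⟨⟨hx.1.trans hz.1, ?_⟩, hz0⟩, ?_, hz.1⟩
      · linarith [hz.2, hx.2]
      · linarith [hz.2]
    calc volume {x ∈ Set.Icc 0 (L - δ) | g x * g (x + δ) < 0}
        ≤ volume (⋃ z ∈ hfin.toFinset, Set.Icc (z - δ) z) := measure_mono hsub
      _ ≤ ∑ z ∈ hfin.toFinset, volume (Set.Icc (z - δ) z) := measure_biUnion_finset_le _ _
      _ = ENNReal.ofReal δ * (numZeros g 0 L : ℝ≥0∞) := by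
          simp only [Real.volume_Icc, sub_sub_cancel, Finset.sum_const, nsmul_eq_mul]
          rw [mul_comm, numZeros, hfin.encard_eq_coe_toFinset_card]
          simp
  · have : numZeros g 0 L = ⊤ := Set.encard_eq_top (Set.not_finite.1 hfin)
    rw [this]
    simp [ENNReal.mul_top, hδ]

/-! ### Logarithms of planar Gaussian vectors -/

lemma gaussianReal_zero_one_le_volume : gaussianReal 0 1 ≤ (volume : Measure ℝ) := by
  rw [gaussianReal_of_var_ne_zero 0 one_ne_zero]
  calc volume.withDensity (gaussianPDF 0 1) ≤ volume.withDensity 1 := by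
        refine withDensity_mono (ae_of_all _ fun x => ?_)
        rw [gaussianPDF, Pi.one_apply, ← ENNReal.ofReal_one]
        refine ENNReal.ofReal_le_ofReal ?_
        rw [gaussianPDFReal]
        have h1 : 1 ≤ Real.sqrt (2 * Real.pi * (1 : NNReal)) := by
          rw [Real.one_le_sqrt]
          have := Real.pi_gt_three
          simp only [NNReal.coe_one]
          linarith
        have h2 : Real.exp (-(x - 0) ^ 2 / (2 * (1 : NNReal))) ≤ 1 := by
          rw [Real.exp_le_one_iff]
          simp only [NNReal.coe_one]
          nlinarith [sq_nonneg (x - 0)]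
        calc _ ≤ (1 : ℝ) * 1 := mul_le_mul (inv_le_one_of_one_le₀ h1) h2 (Real.exp_pos _).le
              zero_le_one
          _ = 1 := one_mul 1
    _ = volume := withDensity_one

lemma integrable_log_gaussianReal : Integrable Real.log (gaussianReal 0 1) := by
  have h1 : IntegrableOn Real.log (Set.Icc (-1) 1) (gaussianReal 0 1) := by
    have : IntegrableOn Real.log (Set.Icc (-1) 1) (volume : Measure ℝ) :=
      (intervalIntegrable_iff_integrableOn_Icc_of_le (by norm_num)).1
        intervalIntegral.intervalIntegrable_log'
    exact this.mono_measure gaussianReal_zero_one_le_volume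
  have h2 : IntegrableOn Real.log (Set.Icc (-1) 1)ᶜ (gaussianReal 0 1) := by
    have hid : Integrable (fun x : ℝ => x) (gaussianReal 0 1) := IsGaussian.integrable_id
    refine Integrable.mono hid.integrableOn Real.measurable_log.aestronglyMeasurable ?_
    refine (ae_restrict_iff' measurableSet_Icc.compl).2 (ae_of_all _ fun x hx => ?_)
    have hx1 : 1 < |x| := by
      by_contra h
      exact hx (abs_le.1 (not_lt.1 h))
    rw [Real.norm_eq_abs, Real.norm_eq_abs, ← Real.log_abs, abs_of_nonneg (Real.log_nonneg hx1.le)]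
    exact Real.log_le_self (abs_nonneg x)
  have := h1.union h2
  rwa [Set.union_compl_self, integrableOn_univ] at this

lemma map_re_stdGaussian : (stdGaussian ℂ).map Complex.re = gaussianReal 0 1 := by
  apply Measure.ext_of_charFun
  ext t
  have h := charFun_stdGaussian (E := ℂ) (t : ℂ)
  rw [charFun_apply] at h
  rw [charFun_apply, integral_map Complex.measurable_re.aemeasurable (by fun_prop),
    charFun_gaussianReal]
  convert h using 2
  · funext z
    simp [Complex.inner]
  · simp [neg_div]
    norm_cast
    simp

lemma stdGaussian_map_rotation (θ : ℝ) :
    (stdGaussian ℂ).map (fun z => Complex.exp (θ * Complex.I) * z) = stdGaussian ℂ := by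
  have := stdGaussian_map (rotation (Circle.exp θ))
  convert this using 2
  funext z
  rw [rotation_apply, Circle.coe_exp]

/-- A function on `ℂ` integrable for the standard Gaussian measure may be averaged over circles. -/
lemma integral_stdGaussian_eq_circle {f : ℂ → ℝ} (hf : Measurable f)
    (hfi : Integrable f (stdGaussian ℂ)) :
    ∫ z, f z ∂(stdGaussian ℂ)
      = ∫ z, ((2 * Real.pi)⁻¹ * ∫ θ in (0 : ℝ)..(2 * Real.pi),
          f (Complex.exp (θ * Complex.I) * z)) ∂(stdGaussian ℂ) := by
  have hrot : ∀ (θ : ℝ), Measurable (fun z : ℂ => Complex.exp (θ * Complex.I) * z) := by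
    intro θ; fun_prop
  have hinv : ∀ {g : ℂ → ℝ} (θ : ℝ), Measurable g →
      ∫ z, g (Complex.exp (θ * Complex.I) * z) ∂(stdGaussian ℂ) = ∫ z, g z ∂(stdGaussian ℂ) := by
    intro g θ hg
    conv_rhs => rw [← stdGaussian_map_rotation θ]
    rw [integral_map (hrot θ).aemeasurable hg.aestronglyMeasurable]
  have hint : ∀ θ : ℝ, Integrable (fun z => f (Complex.exp (θ * Complex.I) * z))
      (stdGaussian ℂ) := by
    intro θ
    have : Integrable f ((stdGaussian ℂ).map (fun z => Complex.exp (θ * Complex.I) * z)) := by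
      rwa [stdGaussian_map_rotation]
    exact this.comp_measurable (hrot θ)
  have h2π : (0 : ℝ) ≤ 2 * Real.pi := by positivity
  have hmeas : Measurable (fun p : ℝ × ℂ => f (Complex.exp (p.1 * Complex.I) * p.2)) :=
    hf.comp (by fun_prop)
  have hprod : Integrable (fun p : ℝ × ℂ => f (Complex.exp (p.1 * Complex.I) * p.2))
      ((volume.restrict (Set.Ioc 0 (2 * Real.pi))).prod (stdGaussian ℂ)) := by
    rw [integrable_prod_iff hmeas.aestronglyMeasurable]
    refine ⟨ae_of_all _ fun θ => hint θ, ?_⟩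
    have : (fun θ : ℝ => ∫ z, ‖f (Complex.exp (θ * Complex.I) * z)‖ ∂(stdGaussian ℂ))
        = fun _ => ∫ z, ‖f z‖ ∂(stdGaussian ℂ) := by
      funext θ
      exact hinv (g := fun z => ‖f z‖) θ hf.norm
    simp only [this]
    exact integrable_const _
  rw [integral_const_mul]
  simp only [intervalIntegral.integral_of_le h2π]
  rw [← integral_integral_swap hprod]
  simp only [hinv _ hf]
  rw [setIntegral_const, smul_eq_mul, measureReal_def, Real.volume_Ioc, sub_zero,
    ENNReal.toReal_ofReal h2π, ← mul_assoc, inv_mul_cancel₀ (by positivity), one_mul]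

/-- The mean over the circle of `log |α e^{iθ} + β e^{-iθ}|` is `log max(|α|, |β|)`. -/
lemma integral_log_norm_ellipse {α β : ℂ} (hα : α ≠ 0) (hβ : ‖β‖ ≤ ‖α‖) :
    (2 * Real.pi)⁻¹ * ∫ θ in (0 : ℝ)..(2 * Real.pi),
      Real.log ‖α * Complex.exp (θ * Complex.I) + β * Complex.exp (-(θ * Complex.I))‖
      = Real.log ‖α‖ := by
  let G : ℝ → ℝ := fun t => Real.log ‖α * Complex.exp (t * Complex.I) + β‖
  have hG : Function.Periodic G (2 * Real.pi) := by
    intro t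
    simp only [G]
    have : Complex.exp (((t + 2 * Real.pi : ℝ) : ℂ) * Complex.I)
        = Complex.exp (t * Complex.I) := by
      push_cast
      rw [add_mul, Complex.exp_add, Complex.exp_two_pi_mul_I, mul_one]
    rw [this]
  have h1 : ∀ θ : ℝ, Real.log ‖α * Complex.exp (θ * Complex.I)
      + β * Complex.exp (-(θ * Complex.I))‖ = G (2 * θ) := by
    intro θ
    simp only [G]
    have : α * Complex.exp (((2 * θ : ℝ) : ℂ) * Complex.I) + β
        = Complex.exp (θ * Complex.I) * (α * Complex.exp (θ * Complex.I)
          + β * Complex.exp (-(θ * Complex.I))) := by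
      have e1 : Complex.exp (((2 * θ : ℝ) : ℂ) * Complex.I)
          = Complex.exp (θ * Complex.I) * Complex.exp (θ * Complex.I) := by
        rw [← Complex.exp_add]; congr 1; push_cast; ring
      have e2 : Complex.exp (θ * Complex.I) * Complex.exp (-(θ * Complex.I)) = 1 := by
        rw [← Complex.exp_add]; simp
      rw [e1]
      linear_combination (-β) * e2
    rw [this, norm_mul, Complex.norm_exp_ofReal_mul_I, one_mul]
  have hGi : IntervalIntegrable G volume 0 (2 * Real.pi) := by
    have := (Polynomial.C α * Polynomial.X + Polynomial.C β).intervalIntegrable_mahlerMeasure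
    simpa [G, circleMap] using this
  have h2 := Polynomial.logMahlerMeasure_C_mul_X_add_C hα β
  rw [Real.posLog_eq_zero_iff _ |>.2 ?_, add_zero, Polynomial.logMahlerMeasure_def,
    Real.circleAverage] at h2
  · rw [← h2, smul_eq_mul]
    congr 1
    simp only [h1]
    rw [intervalIntegral.integral_comp_mul_left (f := G) two_ne_zero, mul_zero]
    have h3 : ∫ x in (0 : ℝ)..(2 * (2 * Real.pi)), G x
        = 2 * ∫ x in (0 : ℝ)..(2 * Real.pi), G x := by
      have := hG.intervalIntegral_add_zsmul_eq 2 0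
        (fun t₁ t₂ => hG.intervalIntegrable₀ (by positivity) hGi t₁ t₂)
      simpa using this
    rw [h3, smul_eq_mul, ← mul_assoc]
    norm_num
    congr 1
    funext t
    simp [G, circleMap]
  · rw [norm_mul, norm_inv, abs_of_nonneg (by positivity)]
    rw [inv_mul_le_iff₀ (norm_pos_iff.2 hα), mul_one]
    exact hβ

/-- `X + iY` for a standard Gaussian vector `(s, t)`, `X = σ s` and `Y = p s + q t`. -/
noncomputable def gaussPair (σ p q : ℝ) (z : ℂ) : ℂ :=
  ((σ * z.re : ℝ) : ℂ) + ((p * z.re + q * z.im : ℝ) : ℂ) * Complex.I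

lemma measurable_gaussPair (σ p q : ℝ) : Measurable (gaussPair σ p q) := by
  unfold gaussPair; fun_prop

lemma ae_re_ne_zero_stdGaussian : ∀ᵐ z ∂(stdGaussian ℂ), z.re ≠ 0 := by
  have h : ∀ᵐ x ∂(gaussianReal 0 1), x ≠ 0 := by
    have := (gaussianReal_absolutelyContinuous 0 (one_ne_zero (α := NNReal)))
    have h0 : ∀ᵐ x : ℝ ∂volume, x ≠ 0 := by simp [ae_iff]
    exact this.ae_le h0
  rw [← map_re_stdGaussian] at h
  exact ae_of_ae_map Complex.measurable_re.aemeasurable h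

lemma integrable_log_re_stdGaussian : Integrable (fun z : ℂ => Real.log z.re) (stdGaussian ℂ) := by
  have := integrable_log_gaussianReal
  rw [← map_re_stdGaussian] at this
  exact this.comp_measurable Complex.measurable_re

lemma abs_log_norm_gaussPair_le {σ : ℝ} (hσ : 0 < σ) (p q : ℝ) {z : ℂ} (hz : z.re ≠ 0) :
    |Real.log ‖gaussPair σ p q z‖|
      ≤ |Real.log σ| + |Real.log z.re| + (|σ| + |p| + |q|) * ‖z‖ := by
  have hre : (gaussPair σ p q z).re = σ * z.re := by simp [gaussPair]
  have him : (gaussPair σ p q z).im = p * z.re + q * z.im := by simp [gaussPair]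
  have hlow : σ * |z.re| ≤ ‖gaussPair σ p q z‖ := by
    have := Complex.abs_re_le_norm (gaussPair σ p q z)
    rwa [hre, abs_mul, abs_of_pos hσ] at this
  have hup : ‖gaussPair σ p q z‖ ≤ (|σ| + |p| + |q|) * ‖z‖ := by
    refine (Complex.norm_le_abs_re_add_abs_im _).trans ?_
    rw [hre, him]
    have h1 := abs_add_le (p * z.re) (q * z.im)
    rw [abs_mul, abs_mul] at h1
    rw [abs_mul]
    have h2 := Complex.abs_re_le_norm z
    have h3 := Complex.abs_im_le_norm z
    nlinarith [mul_le_mul_of_nonneg_left h2 (abs_nonneg σ),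
      mul_le_mul_of_nonneg_left h2 (abs_nonneg p), mul_le_mul_of_nonneg_left h3 (abs_nonneg q)]
  have hpos : 0 < σ * |z.re| := mul_pos hσ (abs_pos.2 hz)
  rw [abs_le]
  have hl1 := Real.log_le_log hpos hlow
  rw [Real.log_mul hσ.ne' (abs_pos.2 hz).ne', Real.log_abs] at hl1
  have hl2 : Real.log ‖gaussPair σ p q z‖ ≤ ‖gaussPair σ p q z‖ :=
    Real.log_le_self (norm_nonneg _)
  have := neg_abs_le (Real.log σ)
  have := neg_abs_le (Real.log z.re)
  have : 0 ≤ (|σ| + |p| + |q|) * ‖z‖ := by positivity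
  have := abs_nonneg (Real.log σ)
  have := abs_nonneg (Real.log z.re)
  constructor <;> linarith

lemma integrable_gaussPair_bound (A B : ℝ) :
    Integrable (fun z : ℂ => (A + |Real.log z.re|) + B * ‖z‖) (stdGaussian ℂ) := by
  have hid : Integrable (fun z : ℂ => z) (stdGaussian ℂ) := IsGaussian.integrable_id
  exact ((integrable_const _).add integrable_log_re_stdGaussian.abs).add (hid.norm.const_mul _)

lemma integrable_log_norm_gaussPair {σ : ℝ} (hσ : 0 < σ) (p q : ℝ) :
    Integrable (fun z => Real.log ‖gaussPair σ p q z‖) (stdGaussian ℂ) := by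
  refine (integrable_gaussPair_bound |Real.log σ| (|σ| + |p| + |q|)).mono'
    ((measurable_gaussPair σ p q).norm.log.aestronglyMeasurable) ?_
  filter_upwards [ae_re_ne_zero_stdGaussian] with z hz using abs_log_norm_gaussPair_le hσ p q hz

lemma integral_abs_log_norm_gaussPair_le {σ : ℝ} (hσ : 0 < σ) (p q : ℝ) :
    ∫ z, |Real.log ‖gaussPair σ p q z‖| ∂(stdGaussian ℂ)
      ≤ |Real.log σ| + ∫ z : ℂ, |Real.log z.re| ∂(stdGaussian ℂ)
        + (|σ| + |p| + |q|) * ∫ z : ℂ, ‖z‖ ∂(stdGaussian ℂ) := by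
  have hid : Integrable (fun z : ℂ => z) (stdGaussian ℂ) := IsGaussian.integrable_id
  have h1 : Integrable (fun z : ℂ => |Real.log σ| + |Real.log z.re|) (stdGaussian ℂ) :=
    (integrable_const _).add integrable_log_re_stdGaussian.abs
  calc _ ≤ ∫ z : ℂ, (|Real.log σ| + |Real.log z.re|) + (|σ| + |p| + |q|) * ‖z‖
        ∂(stdGaussian ℂ) := by
        refine integral_mono_ae (integrable_log_norm_gaussPair hσ p q).abs
          (integrable_gaussPair_bound _ _) ?_
        filter_upwards [ae_re_ne_zero_stdGaussian] with z hz using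
          abs_log_norm_gaussPair_le hσ p q hz
    _ = _ := by
        rw [integral_add h1 (hid.norm.const_mul _), integral_add (integrable_const _)
          integrable_log_re_stdGaussian.abs, integral_const_mul]
        simp

/-- `E log |s + it|` for a standard Gaussian vector `(s, t)`, minus `log 2`: the normalization for
which `E log |X| = logGaussConst + log σ` for a centred Gaussian variable `X` of variance `σ²`. -/
noncomputable def logGaussConst : ℝ := ∫ z, Real.log ‖z‖ ∂(stdGaussian ℂ) - Real.log 2

/-- A real linear map of the plane is the sum of a complex linear and a complex antilinear one;
under a rotation of `z` by `θ` these two parts are multiplied by `e^{iθ}` and `e^{-iθ}`. -/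
lemma gaussPair_eq (σ p q : ℝ) (z : ℂ) :
    gaussPair σ p q z = ((σ + q) / 2 + p / 2 * Complex.I) * z
      + ((σ - q) / 2 + p / 2 * Complex.I) * starRingEnd ℂ z := by
  apply Complex.ext <;> simp [gaussPair] <;> ring

/-- `E log |σ s + i (p s + q t)|` for a standard Gaussian vector `(s, t)`: averaging over rotations
of `(s, t)` reduces it to the mean of the logarithm over an ellipse. -/
lemma integral_log_norm_gaussPair {σ q : ℝ} (hσ : 0 < σ) (p : ℝ) (hq : 0 ≤ q) :
    ∫ z, Real.log ‖gaussPair σ p q z‖ ∂(stdGaussian ℂ)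
      = logGaussConst + Real.log (Real.sqrt ((σ + q) ^ 2 + p ^ 2)) := by
  set α : ℂ := (σ + q) / 2 + p / 2 * Complex.I with hαdef
  set β : ℂ := (σ - q) / 2 + p / 2 * Complex.I with hβdef
  have hαre : α.re = (σ + q) / 2 := by simp [hαdef]
  have hαim : α.im = p / 2 := by simp [hαdef]
  have hβre : β.re = (σ - q) / 2 := by simp [hβdef]
  have hβim : β.im = p / 2 := by simp [hβdef]
  have hα : α ≠ 0 := by
    intro h
    have := congrArg Complex.re h
    rw [hαre, Complex.zero_re] at this
    linarith
  have hβ : ‖β‖ ≤ ‖α‖ := by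
    rw [← sq_le_sq₀ (norm_nonneg _) (norm_nonneg _), Complex.sq_norm, Complex.sq_norm,
      Complex.normSq_apply, Complex.normSq_apply, hαre, hαim, hβre, hβim]
    nlinarith
  have hαn : ‖α‖ = Real.sqrt ((σ + q) ^ 2 + p ^ 2) / 2 := by
    rw [Complex.norm_def, Complex.normSq_apply, hαre, hαim]
    rw [show (σ + q) / 2 * ((σ + q) / 2) + p / 2 * (p / 2) = ((σ + q) ^ 2 + p ^ 2) / 2 ^ 2 by ring,
      Real.sqrt_div' _ (by positivity), Real.sqrt_sq (by norm_num)]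
  have hlogz : Integrable (fun z : ℂ => Real.log ‖z‖) (stdGaussian ℂ) := by
    have := integrable_log_norm_gaussPair one_pos 0 1
    refine this.congr (ae_of_all _ fun z => ?_)
    simp [gaussPair, Complex.re_add_im]
  rw [integral_stdGaussian_eq_circle (measurable_gaussPair σ p q).norm.log
    (integrable_log_norm_gaussPair hσ p q)]
  have key : ∀ᵐ z ∂(stdGaussian ℂ), (2 * Real.pi)⁻¹ * ∫ θ in (0 : ℝ)..(2 * Real.pi),
      Real.log ‖gaussPair σ p q (Complex.exp (θ * Complex.I) * z)‖
      = Real.log ‖α‖ + Real.log ‖z‖ := by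
    filter_upwards [ae_re_ne_zero_stdGaussian] with z hz
    have hz0 : z ≠ 0 := fun h => hz (by simp [h])
    have h1 := integral_log_norm_ellipse (α := α * z) (β := β * starRingEnd ℂ z)
      (mul_ne_zero hα hz0) (by
        rw [norm_mul, norm_mul, Complex.norm_conj]
        exact mul_le_mul_of_nonneg_right hβ (norm_nonneg _))
    rw [norm_mul, Real.log_mul (norm_ne_zero_iff.2 hα) (norm_ne_zero_iff.2 hz0)] at h1
    rw [← h1]
    congr 2
    funext θ
    rw [gaussPair_eq, map_mul, ← Complex.exp_conj, map_mul, Complex.conj_I, Complex.conj_ofReal,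
      mul_neg, ← hαdef, ← hβdef]
    congr 2
    ring
  rw [integral_congr_ae key, integral_add (integrable_const _) hlogz, integral_const]
  have hs : 0 < Real.sqrt ((σ + q) ^ 2 + p ^ 2) := Real.sqrt_pos.2 (by positivity)
  rw [hαn, Real.log_div hs.ne' two_ne_zero, logGaussConst]
  simp
  ring

/-! ### Gaussian pairs -/

/-- The standard Gaussian measure of a cone in the plane is the proportion of directions in it. -/
lemma integral_cone_stdGaussian {S : Set ℂ} (hS : MeasurableSet S)
    (hcone : ∀ r : ℝ, 0 < r → ∀ z : ℂ, (r : ℂ) * z ∈ S ↔ z ∈ S) :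
    (stdGaussian ℂ).real S = (2 * Real.pi)⁻¹ *
      ∫ θ in (-(Real.pi / 2))..(-(Real.pi / 2) + 2 * Real.pi),
        S.indicator (fun _ => (1 : ℝ)) (Complex.exp (θ * Complex.I)) := by
  have hm : Measurable (S.indicator (fun _ => (1 : ℝ))) := measurable_const.indicator hS
  have hi : Integrable (S.indicator (fun _ => (1 : ℝ))) (stdGaussian ℂ) :=
    (integrable_const (1 : ℝ)).indicator hS
  have hper : Function.Periodic
      (fun θ : ℝ => S.indicator (fun _ => (1 : ℝ)) (Complex.exp (θ * Complex.I)))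
      (2 * Real.pi) := by
    intro t
    have : Complex.exp (((t + 2 * Real.pi : ℝ) : ℂ) * Complex.I)
        = Complex.exp (t * Complex.I) := by
      push_cast
      rw [add_mul, Complex.exp_add, Complex.exp_two_pi_mul_I, mul_one]
    simp only [this]
  have h1 : (stdGaussian ℂ).real S = ∫ z, S.indicator (fun _ => (1 : ℝ)) z ∂(stdGaussian ℂ) := by
    rw [integral_indicator hS, setIntegral_const, smul_eq_mul, mul_one]
  rw [h1, integral_stdGaussian_eq_circle hm hi]
  have key : ∀ᵐ z ∂(stdGaussian ℂ), (2 * Real.pi)⁻¹ * ∫ θ in (0 : ℝ)..(2 * Real.pi),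
      S.indicator (fun _ => (1 : ℝ)) (Complex.exp (θ * Complex.I) * z)
      = (2 * Real.pi)⁻¹ * ∫ θ in (-(Real.pi / 2))..(-(Real.pi / 2) + 2 * Real.pi),
        S.indicator (fun _ => (1 : ℝ)) (Complex.exp (θ * Complex.I)) := by
    filter_upwards [ae_re_ne_zero_stdGaussian] with z hz
    have hz0 : 0 < ‖z‖ := norm_pos_iff.2 fun h => hz (by simp [h])
    congr 1
    have h2 : ∀ θ : ℝ, S.indicator (fun _ => (1 : ℝ)) (Complex.exp (θ * Complex.I) * z)
        = S.indicator (fun _ => (1 : ℝ))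
          (Complex.exp (((θ + z.arg : ℝ) : ℂ) * Complex.I)) := by
      intro θ
      have h3 : Complex.exp (θ * Complex.I) * z
          = (‖z‖ : ℂ) * Complex.exp (((θ + z.arg : ℝ) : ℂ) * Complex.I) := by
        conv_lhs => rw [← Complex.norm_mul_exp_arg_mul_I z]
        push_cast
        rw [add_mul, Complex.exp_add]
        ring
      rw [h3]
      classical
      simp only [Set.indicator_apply, hcone _ hz0]
    simp only [h2]
    rw [intervalIntegral.integral_comp_add_right
      (f := fun θ : ℝ => S.indicator (fun _ => (1 : ℝ)) (Complex.exp (θ * Complex.I))),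
      zero_add, add_comm (2 * Real.pi)]
    exact hper.intervalIntegral_add_eq _ _
  rw [integral_congr_ae key]
  simp

/-- For a correlated Gaussian pair with angle `φ`, the product is negative on two sectors of
opening `φ`. -/
lemma le_measure_gaussPair_mul_neg {σ τ φ : ℝ} (hσ : 0 < σ) (hτ : 0 < τ) (hφ0 : 0 ≤ φ)
    (hφ : φ ≤ Real.pi) :
    φ / Real.pi ≤ (stdGaussian ℂ).real
      {z | (gaussPair σ (τ * Real.cos φ) (τ * Real.sin φ) z).re
        * (gaussPair σ (τ * Real.cos φ) (τ * Real.sin φ) z).im < 0} := by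
  set S := {z | (gaussPair σ (τ * Real.cos φ) (τ * Real.sin φ) z).re
        * (gaussPair σ (τ * Real.cos φ) (τ * Real.sin φ) z).im < 0} with hSdef
  have hG := measurable_gaussPair σ (τ * Real.cos φ) (τ * Real.sin φ)
  have hS : MeasurableSet S :=
    measurableSet_lt ((Complex.measurable_re.comp hG).mul (Complex.measurable_im.comp hG))
      measurable_const
  have hmem : ∀ z : ℂ, z ∈ S ↔
      (σ * z.re) * (τ * Real.cos φ * z.re + τ * Real.sin φ * z.im) < 0 := by
    intro z
    simp [hSdef, gaussPair, -Complex.ofReal_cos, -Complex.ofReal_sin, -Complex.ofReal_mul]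
  have hπ := Real.pi_pos
  rw [integral_cone_stdGaussian hS]
  swap
  · intro r hr z
    rw [hmem, hmem]
    simp only [Complex.re_ofReal_mul, Complex.im_ofReal_mul]
    rw [show σ * (r * z.re) * (τ * Real.cos φ * (r * z.re) + τ * Real.sin φ * (r * z.im))
      = (r * r) * (σ * z.re * (τ * Real.cos φ * z.re + τ * Real.sin φ * z.im)) by ring]
    exact ⟨fun h => (pos_iff_neg_of_mul_neg h).1 (mul_pos hr hr),
      fun h => mul_neg_of_pos_of_neg (mul_pos hr hr) h⟩
  have hsec : ∀ θ ∈ Set.Ioo (-(Real.pi / 2)) (-(Real.pi / 2) + φ)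
      ∪ Set.Ioo (Real.pi / 2) (Real.pi / 2 + φ), Complex.exp (θ * Complex.I) ∈ S := by
    intro θ hθ
    rw [hmem, Complex.exp_ofReal_mul_I_re, Complex.exp_ofReal_mul_I_im]
    rw [show σ * Real.cos θ * (τ * Real.cos φ * Real.cos θ + τ * Real.sin φ * Real.sin θ)
      = (σ * τ) * (Real.cos θ * Real.cos (θ - φ)) by rw [Real.cos_sub]; ring]
    refine mul_neg_of_pos_of_neg (mul_pos hσ hτ) ?_
    rcases hθ with ⟨h1, h2⟩ | ⟨h1, h2⟩
    · have c1 : 0 < Real.cos θ := Real.cos_pos_of_mem_Ioo ⟨h1, by linarith⟩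
      have c2 : Real.cos (θ - φ) < 0 := by
        rw [← Real.cos_neg]
        exact Real.cos_neg_of_pi_div_two_lt_of_lt (by linarith) (by linarith)
      exact mul_neg_of_pos_of_neg c1 c2
    · have c1 : Real.cos θ < 0 :=
        Real.cos_neg_of_pi_div_two_lt_of_lt (by linarith) (by linarith)
      have c2 : 0 < Real.cos (θ - φ) := Real.cos_pos_of_mem_Ioo ⟨by linarith, by linarith⟩
      exact mul_neg_of_neg_of_pos c1 c2
  set A := Set.Ioo (-(Real.pi / 2)) (-(Real.pi / 2) + φ)
      ∪ Set.Ioo (Real.pi / 2) (Real.pi / 2 + φ) with hA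
  have hAm : MeasurableSet A := measurableSet_Ioo.union measurableSet_Ioo
  have hvol : volume.real A = 2 * φ := by
    rw [hA, measureReal_union _ measurableSet_Ioo (by simp) (by simp)]
    · rw [Real.volume_real_Ioo_of_le (by linarith), Real.volume_real_Ioo_of_le (by linarith)]
      ring
    · rw [Set.disjoint_left]
      rintro x ⟨_, h2⟩ ⟨h3, _⟩
      linarith
  have hAsub : A ⊆ Set.Ioc (-(Real.pi / 2)) (-(Real.pi / 2) + 2 * Real.pi) := by
    rintro x (⟨h1, h2⟩ | ⟨h1, h2⟩) <;> constructor <;> linarith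
  have hmeas : Measurable (fun θ : ℝ => S.indicator (fun _ => (1 : ℝ))
      (Complex.exp (θ * Complex.I))) :=
    (measurable_const.indicator hS).comp (by fun_prop)
  have hint : 2 * φ ≤ ∫ θ in (-(Real.pi / 2))..(-(Real.pi / 2) + 2 * Real.pi),
        S.indicator (fun _ => (1 : ℝ)) (Complex.exp (θ * Complex.I)) := by
    rw [intervalIntegral.integral_of_le (by linarith)]
    calc 2 * φ = ∫ θ in Set.Ioc (-(Real.pi / 2)) (-(Real.pi / 2) + 2 * Real.pi),
          A.indicator (fun _ => (1 : ℝ)) θ := by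
          rw [setIntegral_indicator hAm, Set.inter_eq_right.2 hAsub, setIntegral_const, hvol]
          simp
      _ ≤ _ := by
          refine integral_mono_of_nonneg (ae_of_all _ fun θ =>
            Set.indicator_nonneg (fun _ _ => zero_le_one) _) ?_ (ae_of_all _ fun θ => ?_)
          · refine Integrable.of_bound hmeas.aestronglyMeasurable 1 (ae_of_all _ fun θ => ?_)
            · classical
              rw [Set.indicator_apply]; split_ifs <;> simp
          · classical
            by_cases hθ : θ ∈ A
            · simp [Set.indicator_of_mem hθ, Set.indicator_of_mem (hsec θ hθ)]
            · rw [Set.indicator_of_notMem hθ]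
              exact Set.indicator_nonneg (fun _ _ => zero_le_one) _
  calc φ / Real.pi = (2 * Real.pi)⁻¹ * (2 * φ) := by field_simp
    _ ≤ _ := mul_le_mul_of_nonneg_left hint (by positivity)

section Pair

variable {Ω : Type*} [MeasurableSpace Ω] {P : Measure Ω}

/-- `(X, Y)` is a centred Gaussian vector with variances `v`, `u` and covariance `c`, expressed
through the laws of the linear combinations of `X` and `Y`. -/
structure IsGaussianPair (P : Measure Ω) (X Y : Ω → ℝ) (v c u : ℝ) : Prop where
  aemeasurable_left : AEMeasurable X P
  aemeasurable_right : AEMeasurable Y P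
  nonneg : ∀ s t : ℝ, 0 ≤ v * s ^ 2 + 2 * c * s * t + u * t ^ 2
  map_eq : ∀ s t : ℝ, P.map (fun ω => s * X ω + t * Y ω)
    = gaussianReal 0 (Real.toNNReal (v * s ^ 2 + 2 * c * s * t + u * t ^ 2))

lemma IsGaussianPair.sq_le {X Y : Ω → ℝ} {v c u : ℝ} (h : IsGaussianPair P X Y v c u)
    (hv : 0 < v) : c ^ 2 ≤ v * u := by
  have := h.nonneg (-c) v
  have h2 : v * (c ^ 2) ≤ v * (v * u) := by nlinarith
  exact le_of_mul_le_mul_left h2 hv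

/-- A centred Gaussian pair is the image of a standard Gaussian vector by any square root of its
covariance matrix; the factor `gaussPair σ p q` is a triangular one. -/
lemma IsGaussianPair.map_eq_gaussPair {X Y : Ω → ℝ} {v c u : ℝ} (h : IsGaussianPair P X Y v c u)
    [IsFiniteMeasure P] {σ p q : ℝ} (hv : v = σ ^ 2) (hc : c = σ * p) (hu : u = p ^ 2 + q ^ 2) :
    P.map (fun ω => (X ω : ℂ) + Y ω * Complex.I) = (stdGaussian ℂ).map (gaussPair σ p q) := by
  have hX := h.aemeasurable_left
  have hY := h.aemeasurable_right
  have hZ : AEMeasurable (fun ω => (X ω : ℂ) + Y ω * Complex.I) P := by fun_prop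
  apply Measure.ext_of_charFun
  ext t
  rw [charFun_apply, charFun_apply, integral_map hZ (by fun_prop),
    integral_map (measurable_gaussPair σ p q).aemeasurable (by fun_prop)]
  have h1 : ∀ ω, inner ℝ ((X ω : ℂ) + Y ω * Complex.I) t = t.re * X ω + t.im * Y ω := by
    intro ω
    simp [Complex.inner]
  have h2 : ∀ z : ℂ, inner ℝ (gaussPair σ p q z) t
      = inner ℝ z (((σ * t.re + p * t.im : ℝ) : ℂ) + ((q * t.im : ℝ) : ℂ) * Complex.I) := by
    intro z
    simp [Complex.inner, gaussPair]
    ring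
  simp only [h1, h2]
  rw [← charFun_apply, charFun_stdGaussian]
  have h3 := charFun_gaussianReal (μ := 0)
    (v := Real.toNNReal (v * t.re ^ 2 + 2 * c * t.re * t.im + u * t.im ^ 2)) 1
  rw [← h.map_eq, charFun_apply, integral_map (by fun_prop) (by fun_prop)] at h3
  simp only [Real.inner_apply, mul_one] at h3
  rw [h3, Real.coe_toNNReal _ (h.nonneg _ _)]
  congr 1
  rw [← Complex.ofReal_pow, ← Complex.ofReal_pow, Complex.sq_norm, Complex.normSq_add_mul_I,
    hv, hc, hu]
  push_cast
  ring

lemma IsGaussianPair.map_eq_gaussPair_cholesky {X Y : Ω → ℝ} {v c u : ℝ}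
    (h : IsGaussianPair P X Y v c u) [IsFiniteMeasure P] (hv : 0 < v) :
    P.map (fun ω => (X ω : ℂ) + Y ω * Complex.I) = (stdGaussian ℂ).map
      (gaussPair (Real.sqrt v) (c / Real.sqrt v) (Real.sqrt (u - (c / Real.sqrt v) ^ 2))) := by
  have hs := Real.sqrt_pos.2 hv
  refine h.map_eq_gaussPair (Real.sq_sqrt hv.le).symm (by field_simp) ?_
  rw [Real.sq_sqrt, add_sub_cancel]
  rw [sub_nonneg, div_pow, Real.sq_sqrt hv.le, div_le_iff₀ hv, mul_comm]
  exact h.sq_le hv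

lemma IsGaussianPair.integrable_log_norm {X Y : Ω → ℝ} {v c u : ℝ}
    (h : IsGaussianPair P X Y v c u) [IsFiniteMeasure P] (hv : 0 < v) :
    Integrable (fun ω => Real.log ‖(X ω : ℂ) + Y ω * Complex.I‖) P := by
  have hX := h.aemeasurable_left
  have hY := h.aemeasurable_right
  have hZ : AEMeasurable (fun ω => (X ω : ℂ) + Y ω * Complex.I) P := by fun_prop
  have h1 := integrable_log_norm_gaussPair (Real.sqrt_pos.2 hv) (c / Real.sqrt v)
    (Real.sqrt (u - (c / Real.sqrt v) ^ 2))
  have hm : Measurable (fun z : ℂ => Real.log ‖z‖) := measurable_norm.log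
  have h2 : Integrable (fun z : ℂ => Real.log ‖z‖)
      (P.map (fun ω => (X ω : ℂ) + Y ω * Complex.I)) := by
    rw [h.map_eq_gaussPair_cholesky hv, integrable_map_measure hm.aestronglyMeasurable
      (measurable_gaussPair _ _ _).aemeasurable]
    exact h1
  exact h2.comp_aemeasurable hZ

lemma IsGaussianPair.integral_abs_log_norm_le {X Y : Ω → ℝ} {v c u : ℝ}
    (h : IsGaussianPair P X Y v c u) [IsFiniteMeasure P] (hv : 0 < v) :
    ∫ ω, |Real.log ‖(X ω : ℂ) + Y ω * Complex.I‖| ∂P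
      ≤ |Real.log (Real.sqrt v)| + ∫ z : ℂ, |Real.log z.re| ∂(stdGaussian ℂ)
        + (Real.sqrt v + 2 * Real.sqrt u) * ∫ z : ℂ, ‖z‖ ∂(stdGaussian ℂ) := by
  have hX := h.aemeasurable_left
  have hY := h.aemeasurable_right
  have hZ : AEMeasurable (fun ω => (X ω : ℂ) + Y ω * Complex.I) P := by fun_prop
  have hm : Measurable (fun z : ℂ => |Real.log ‖z‖|) := measurable_norm.log.abs
  rw [← integral_map hZ hm.aestronglyMeasurable, h.map_eq_gaussPair_cholesky hv,
    integral_map (measurable_gaussPair _ _ _).aemeasurable hm.aestronglyMeasurable]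
  refine (integral_abs_log_norm_gaussPair_le (Real.sqrt_pos.2 hv) _ _).trans
    (add_le_add le_rfl (mul_le_mul_of_nonneg_right ?_ (integral_nonneg fun _ => norm_nonneg _)))
  have h1 : |c / Real.sqrt v| ≤ Real.sqrt u := by
    refine Real.abs_le_sqrt ?_
    rw [div_pow, Real.sq_sqrt hv.le, div_le_iff₀ hv, mul_comm]
    exact h.sq_le hv
  have h2 : Real.sqrt (u - (c / Real.sqrt v) ^ 2) ≤ Real.sqrt u :=
    Real.sqrt_le_sqrt (by linarith [sq_nonneg (c / Real.sqrt v)])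
  rw [abs_of_nonneg (Real.sqrt_nonneg v), abs_of_nonneg (Real.sqrt_nonneg _)]
  linarith

lemma IsGaussianPair.integral_log_norm {X Y : Ω → ℝ} {v c u : ℝ}
    (h : IsGaussianPair P X Y v c u) [IsFiniteMeasure P] (hv : 0 < v) :
    ∫ ω, Real.log ‖(X ω : ℂ) + Y ω * Complex.I‖ ∂P
      = logGaussConst + Real.log (Real.sqrt
        ((Real.sqrt v + Real.sqrt (u - (c / Real.sqrt v) ^ 2)) ^ 2
          + (c / Real.sqrt v) ^ 2)) := by
  have hX := h.aemeasurable_left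
  have hY := h.aemeasurable_right
  have hZ : AEMeasurable (fun ω => (X ω : ℂ) + Y ω * Complex.I) P := by fun_prop
  have hm : Measurable (fun z : ℂ => Real.log ‖z‖) := measurable_norm.log
  rw [← integral_log_norm_gaussPair (Real.sqrt_pos.2 hv) _ (Real.sqrt_nonneg _),
    ← integral_map hZ hm.aestronglyMeasurable, h.map_eq_gaussPair_cholesky hv,
    integral_map (measurable_gaussPair _ _ _).aemeasurable hm.aestronglyMeasurable]

/-- An upper bound for `E log |X + iY|` that depends on the variances alone; it is attained when `X`
and `Y` are independent. -/
lemma IsGaussianPair.integral_log_norm_le {X Y : Ω → ℝ} {v c u : ℝ}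
    (h : IsGaussianPair P X Y v c u) [IsFiniteMeasure P] (hv : 0 < v) :
    ∫ ω, Real.log ‖(X ω : ℂ) + Y ω * Complex.I‖ ∂P
      ≤ logGaussConst + Real.log (Real.sqrt v + Real.sqrt u) := by
  have hs := Real.sqrt_pos.2 hv
  rw [h.integral_log_norm hv]
  refine add_le_add le_rfl (Real.log_le_log (Real.sqrt_pos.2 ?_) ?_)
  · positivity
  · have hp : (c / Real.sqrt v) ^ 2 ≤ u := by
      rw [div_pow, Real.sq_sqrt hv.le, div_le_iff₀ hv, mul_comm]
      exact h.sq_le hv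
    have hu : 0 ≤ u := (sq_nonneg _).trans hp
    have h1 : Real.sqrt (u - (c / Real.sqrt v) ^ 2) ≤ Real.sqrt u :=
      Real.sqrt_le_sqrt (by linarith [sq_nonneg (c / Real.sqrt v)])
    have h2 := Real.sq_sqrt (sub_nonneg.2 hp)
    have h3 := Real.sq_sqrt hu
    rw [Real.sqrt_le_left (by positivity)]
    nlinarith

/-- Two centred Gaussian variables of correlation `r = cos φ` have opposite signs with probability
`φ / π`, and `φ ≥ √(2 (1 - r))`. -/
lemma IsGaussianPair.le_measure_mul_neg {X Y : Ω → ℝ} {v c u : ℝ}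
    (h : IsGaussianPair P X Y v c u) [IsFiniteMeasure P] (hv : 0 < v) (hu : 0 < u) :
    ENNReal.ofReal (Real.sqrt (2 * (1 - c / (Real.sqrt v * Real.sqrt u))) / Real.pi)
      ≤ P {ω | X ω * Y ω < 0} := by
  have hX := h.aemeasurable_left
  have hY := h.aemeasurable_right
  have hZ : AEMeasurable (fun ω => (X ω : ℂ) + Y ω * Complex.I) P := by fun_prop
  have hs := Real.sqrt_pos.2 hv
  have ht := Real.sqrt_pos.2 hu
  set r := c / (Real.sqrt v * Real.sqrt u) with hr
  have hr2 : r ^ 2 ≤ 1 := by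
    rw [hr, div_pow, mul_pow, Real.sq_sqrt hv.le, Real.sq_sqrt hu.le,
      div_le_one (mul_pos hv hu)]
    exact h.sq_le hv
  have hr1 : -1 ≤ r ∧ r ≤ 1 := abs_le.1 ((sq_le_one_iff_abs_le_one r).1 hr2)
  have hcos : Real.cos (Real.arccos r) = r := Real.cos_arccos hr1.1 hr1.2
  have hle : Real.sqrt (2 * (1 - r)) ≤ Real.arccos r := by
    rw [Real.sqrt_le_left (Real.arccos_nonneg r)]
    have := Real.one_sub_sq_div_two_le_cos (x := Real.arccos r)
    rw [hcos] at this
    linarith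
  have hmap := h.map_eq_gaussPair (σ := Real.sqrt v) (p := Real.sqrt u * Real.cos (Real.arccos r))
    (q := Real.sqrt u * Real.sin (Real.arccos r)) (Real.sq_sqrt hv.le).symm
    (by rw [hcos, hr]; field_simp) (by
      rw [mul_pow, mul_pow, ← mul_add, Real.cos_sq_add_sin_sq, mul_one, Real.sq_sqrt hu.le])
  have hS : MeasurableSet {z : ℂ | z.re * z.im < 0} :=
    measurableSet_lt (Complex.measurable_re.mul Complex.measurable_im) measurable_const
  have h1 : P {ω | X ω * Y ω < 0}
      = P.map (fun ω => (X ω : ℂ) + Y ω * Complex.I) {z : ℂ | z.re * z.im < 0} := by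
    rw [Measure.map_apply_of_aemeasurable hZ hS]
    congr 1
    ext ω
    simp
  rw [h1, hmap, Measure.map_apply (measurable_gaussPair _ _ _) hS]
  refine ENNReal.ofReal_le_of_le_toReal ?_
  refine le_trans ?_ (le_measure_gaussPair_mul_neg hs ht (Real.arccos_nonneg r)
    (Real.arccos_le_pi r))
  gcongr

end Pair

/-! ### Linear forms in the coefficients and the spectral measure -/

/-- The linear form `∑_{k=1}^n (a_k Re w_k + b_k Im w_k)` in the coefficients. -/
noncomputable def coeffForm {Ω : Type*} (a b : ℕ+ → Ω → ℝ) (n : ℕ) (w : ℕ → ℂ) (ω : Ω) : ℝ :=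
  ∑ j ∈ Finset.range n, (a j.succPNat ω * (w j).re + b j.succPNat ω * (w j).im)

/-- The trigonometric polynomial `∑_{k=1}^n w_k e^{-iky}`, the spectral representation of the
linear form with weights `w`. -/
noncomputable def specSum (n : ℕ) (w : ℕ → ℂ) (y : ℝ) : ℂ :=
  ∑ j ∈ Finset.range n, w j * Complex.exp (-Complex.I * (j + 1 : ℕ) * y)

/-- The variance of the linear form with weights `w`, in terms of the spectral measure. -/
noncomputable def specVar (μ : Measure ℝ) (n : ℕ) (w : ℕ → ℂ) : ℝ :=
  ∫ y in Set.Icc (-Real.pi) Real.pi, ‖specSum n w y‖ ^ 2 ∂μ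

/-- The covariance of the linear forms with weights `w` and `w'`, in terms of the spectral
measure. -/
noncomputable def specCov (μ : Measure ℝ) (n : ℕ) (w w' : ℕ → ℂ) : ℝ :=
  ∫ y in Set.Icc (-Real.pi) Real.pi, (specSum n w y * starRingEnd ℂ (specSum n w' y)).re ∂μ

lemma continuous_specSum (n : ℕ) (w : ℕ → ℂ) : Continuous (specSum n w) := by
  unfold specSum; fun_prop

lemma integrableOn_specSum_sq (μ : Measure ℝ) [IsFiniteMeasure μ] (n : ℕ) (w : ℕ → ℂ) :
    IntegrableOn (fun y => ‖specSum n w y‖ ^ 2) (Set.Icc (-Real.pi) Real.pi) μ :=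
  ((continuous_specSum n w).norm.pow 2).continuousOn.integrableOn_compact isCompact_Icc

lemma specVar_nonneg (μ : Measure ℝ) (n : ℕ) (w : ℕ → ℂ) : 0 ≤ specVar μ n w :=
  integral_nonneg fun _ => by positivity

lemma specSum_add_smul (n : ℕ) (w w' : ℕ → ℂ) (s t : ℝ) (y : ℝ) :
    specSum n (fun j => s * w j + t * w' j) y = s * specSum n w y + t * specSum n w' y := by
  simp only [specSum, Finset.mul_sum, ← Finset.sum_add_distrib]
  exact Finset.sum_congr rfl fun j _ => by ring

lemma specVar_add_smul (μ : Measure ℝ) [IsFiniteMeasure μ] (n : ℕ) (w w' : ℕ → ℂ) (s t : ℝ) :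
    specVar μ n (fun j => s * w j + t * w' j)
      = specVar μ n w * s ^ 2 + 2 * specCov μ n w w' * s * t + specVar μ n w' * t ^ 2 := by
  have hc : IntegrableOn (fun y => (specSum n w y * starRingEnd ℂ (specSum n w' y)).re)
      (Set.Icc (-Real.pi) Real.pi) μ := by
    refine Continuous.integrableOn_Icc ?_
    have h1 := continuous_specSum n w
    have h2 := continuous_specSum n w'
    exact Complex.continuous_re.comp (h1.mul (Complex.continuous_conj.comp h2))
  have h1 := integrableOn_specSum_sq μ n w
  have h2 := integrableOn_specSum_sq μ n w'
  have key : ∀ y, ‖specSum n (fun j => s * w j + t * w' j) y‖ ^ 2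
      = s ^ 2 * ‖specSum n w y‖ ^ 2
        + (2 * s * t) * (specSum n w y * starRingEnd ℂ (specSum n w' y)).re
        + t ^ 2 * ‖specSum n w' y‖ ^ 2 := by
    intro y
    rw [specSum_add_smul]
    simp only [Complex.sq_norm, Complex.normSq_apply, Complex.add_re, Complex.add_im,
      Complex.mul_re, Complex.mul_im, Complex.ofReal_re, Complex.ofReal_im, Complex.conj_re,
      Complex.conj_im]
    ring
  unfold specVar specCov
  simp only [key]
  have h12 : IntegrableOn (fun y => s ^ 2 * ‖specSum n w y‖ ^ 2
      + (2 * s * t) * (specSum n w y * starRingEnd ℂ (specSum n w' y)).re)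
      (Set.Icc (-Real.pi) Real.pi) μ := (h1.const_mul _).add (hc.const_mul _)
  rw [integral_add h12 (h2.const_mul _),
    integral_add (h1.const_mul _) (hc.const_mul _), integral_const_mul, integral_const_mul,
    integral_const_mul]
  ring

/-- The spectral expression of the variance agrees with its expression through the covariance
function. -/
lemma specVar_eq_sum {ρ : ℤ → ℝ} {μ : Measure ℝ} [IsLocallyFiniteMeasure μ]
    (hμ : ∀ k : ℤ, (ρ k : ℂ) =
      ∫ x in Set.Icc (-Real.pi) Real.pi, Complex.exp (-Complex.I * k * x) ∂μ) (n : ℕ)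
    (w : ℕ → ℂ) :
    specVar μ n w = ∑ j ∈ Finset.range n, ∑ l ∈ Finset.range n,
      ρ ((j : ℤ) - (l : ℤ)) * ((w j).re * (w l).re + (w j).im * (w l).im) := by
  have hρ : ∀ j l : ℕ, ∫ y in Set.Icc (-Real.pi) Real.pi,
      (w j * starRingEnd ℂ (w l)) * Complex.exp (-Complex.I * ((j : ℤ) - (l : ℤ) : ℤ) * y) ∂μ
      = (w j * starRingEnd ℂ (w l)) * ρ ((j : ℤ) - (l : ℤ)) := by
    intro j l
    rw [integral_const_mul, hμ]
  have hexp : ∀ y : ℝ, ((‖specSum n w y‖ ^ 2 : ℝ) : ℂ)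
      = ∑ j ∈ Finset.range n, ∑ l ∈ Finset.range n,
        (w j * starRingEnd ℂ (w l)) * Complex.exp (-Complex.I * ((j : ℤ) - (l : ℤ) : ℤ) * y) := by
    intro y
    rw [Complex.sq_norm, ← Complex.mul_conj, specSum, map_sum, Finset.sum_mul_sum]
    refine Finset.sum_congr rfl fun j _ => Finset.sum_congr rfl fun l _ => ?_
    have : Complex.exp (-Complex.I * ((j : ℤ) - (l : ℤ) : ℤ) * y)
        = Complex.exp (-Complex.I * (j + 1 : ℕ) * y)
          * Complex.exp (Complex.I * (l + 1 : ℕ) * y) := by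
      rw [← Complex.exp_add]; congr 1; push_cast; ring
    rw [this, map_mul, ← Complex.exp_conj]
    simp only [map_mul, map_neg, Complex.conj_I, Complex.conj_ofReal, map_natCast, neg_neg]
    ring
  have hC : ((specVar μ n w : ℝ) : ℂ) = ∑ j ∈ Finset.range n, ∑ l ∈ Finset.range n,
      (w j * starRingEnd ℂ (w l)) * ρ ((j : ℤ) - (l : ℤ)) := by
    rw [specVar, ← integral_complex_ofReal]
    simp only [hexp]
    have hint : ∀ j l : ℕ, Integrable (fun y : ℝ => (w j * starRingEnd ℂ (w l))
        * Complex.exp (-Complex.I * ((j : ℤ) - (l : ℤ) : ℤ) * y))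
        (μ.restrict (Set.Icc (-Real.pi) Real.pi)) := by
      intro j l
      exact Continuous.integrableOn_Icc (by fun_prop)
    rw [integral_finsetSum _ fun j _ => integrable_finsetSum _ fun l _ => hint j l]
    refine Finset.sum_congr rfl fun j _ => ?_
    rw [integral_finsetSum _ fun l _ => hint j l]
    exact Finset.sum_congr rfl fun l _ => hρ j l
  have := congrArg Complex.re hC
  rw [Complex.ofReal_re, Complex.re_sum] at this
  rw [this]
  refine Finset.sum_congr rfl fun j _ => ?_
  rw [Complex.re_sum]
  refine Finset.sum_congr rfl fun l _ => ?_
  simp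
  ring

section Coefficients

variable {Ω : Type*} [MeasurableSpace Ω] {P : Measure Ω} {ρ : ℤ → ℝ} {a b : ℕ+ → Ω → ℝ}

lemma IsStationaryGaussian.hasGaussianLaw_sum (ha : IsStationaryGaussian P ρ a) (n : ℕ)
    (c : ℕ → ℝ) :
    HasGaussianLaw (fun ω => ∑ j ∈ Finset.range n, a j.succPNat ω * c j) P := by
  have h := ((ha.gaussian.comp_right Nat.succPNat).smul c).hasGaussianLaw_fun_sum
    (I := Finset.range n)
  simpa [mul_comm] using h

lemma IsStationaryGaussian.integral_sum (ha : IsStationaryGaussian P ρ a) (n : ℕ) (c : ℕ → ℝ) :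
    ∫ ω, ∑ j ∈ Finset.range n, a j.succPNat ω * c j ∂P = 0 := by
  rw [integral_finsetSum _ fun j _ =>
    ((ha.gaussian.hasGaussianLaw_eval _).integrable).mul_const _]
  refine Finset.sum_eq_zero fun j _ => ?_
  rw [integral_mul_const, ha.centered, zero_mul]

lemma IsStationaryGaussian.variance_sum (ha : IsStationaryGaussian P ρ a) [IsProbabilityMeasure P]
    (n : ℕ) (c : ℕ → ℝ) :
    Var[fun ω => ∑ j ∈ Finset.range n, a j.succPNat ω * c j; P]
      = ∑ j ∈ Finset.range n, ∑ l ∈ Finset.range n, ρ ((j : ℤ) - (l : ℤ)) * (c j * c l) := by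
  have hL : ∀ k, MemLp (a k) 2 P := fun k => (ha.gaussian.hasGaussianLaw_eval k).memLp_two
  rw [variance_of_integral_eq_zero (ha.hasGaussianLaw_sum n c).aemeasurable (ha.integral_sum n c)]
  have h1 : ∀ ω, (∑ j ∈ Finset.range n, a j.succPNat ω * c j) ^ 2
      = ∑ j ∈ Finset.range n, ∑ l ∈ Finset.range n,
        (a j.succPNat ω * a l.succPNat ω) * (c j * c l) := by
    intro ω
    rw [sq, Finset.sum_mul_sum]
    exact Finset.sum_congr rfl fun j _ => Finset.sum_congr rfl fun l _ => by ring
  simp only [h1]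
  have hint : ∀ j l : ℕ, Integrable (fun ω => (a j.succPNat ω * a l.succPNat ω) * (c j * c l)) P :=
    fun j l => ((hL _).integrable_mul (hL _)).mul_const _
  rw [integral_finsetSum _ fun j _ => integrable_finsetSum _ fun l _ => hint j l]
  refine Finset.sum_congr rfl fun j _ => ?_
  rw [integral_finsetSum _ fun l _ => hint j l]
  refine Finset.sum_congr rfl fun l _ => ?_
  rw [integral_mul_const, ha.covariance]
  congr 2
  simp

lemma map_coeffForm [IsProbabilityMeasure P] (ha : IsStationaryGaussian P ρ a)
    (hb : IsStationaryGaussian P ρ b)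
    (hab : IndepFun (fun ω k => a k ω) (fun ω k => b k ω) P) {μ : Measure ℝ}
    (hμ : IsSpectralMeasure ρ μ) (n : ℕ) (w : ℕ → ℂ) :
    AEMeasurable (coeffForm a b n w) P ∧
    P.map (coeffForm a b n w) = gaussianReal 0 (Real.toNNReal (specVar μ n w)) := by
  have := hμ.isProbabilityMeasure
  set X : Ω → ℝ := fun ω => ∑ j ∈ Finset.range n, a j.succPNat ω * (w j).re with hX
  set Y : Ω → ℝ := fun ω => ∑ j ∈ Finset.range n, b j.succPNat ω * (w j).im with hY
  have hXl : HasGaussianLaw X P := ha.hasGaussianLaw_sum n _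
  have hYl : HasGaussianLaw Y P := hb.hasGaussianLaw_sum n _
  have hXY : IndepFun X Y P := by
    have hφ : ∀ c : ℕ → ℝ, Measurable
        (fun f : ℕ+ → ℝ => ∑ j ∈ Finset.range n, f j.succPNat * c j) := by
      intro c; fun_prop
    exact hab.comp (hφ fun j => (w j).re) (hφ fun j => (w j).im)
  have heq : coeffForm a b n w = X + Y := by
    funext ω
    simp [coeffForm, hX, hY, Finset.sum_add_distrib]
  have hl : HasGaussianLaw (X + Y) P := iIndepFun.hasGaussianLaw_add hXl hYl hXY
  rw [heq]
  refine ⟨hl.aemeasurable, ?_⟩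
  rw [hl.map_eq_gaussianReal]
  have hm : ∫ ω, (X + Y) ω ∂P = 0 := by
    simp only [Pi.add_apply]
    rw [integral_add hXl.integrable hYl.integrable, hX, hY, ha.integral_sum, hb.integral_sum,
      add_zero]
  have hv : Var[X + Y; P] = specVar μ n w := by
    rw [hXY.variance_add hXl.memLp_two hYl.memLp_two, hX, hY, ha.variance_sum, hb.variance_sum,
      specVar_eq_sum hμ.fourier, ← Finset.sum_add_distrib]
    refine Finset.sum_congr rfl fun j _ => ?_
    rw [← Finset.sum_add_distrib]
    exact Finset.sum_congr rfl fun l _ => by ring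
  rw [hm, hv]

lemma isGaussianPair_coeffForm [IsProbabilityMeasure P] (ha : IsStationaryGaussian P ρ a)
    (hb : IsStationaryGaussian P ρ b)
    (hab : IndepFun (fun ω k => a k ω) (fun ω k => b k ω) P) {μ : Measure ℝ}
    (hμ : IsSpectralMeasure ρ μ) (n : ℕ) (w w' : ℕ → ℂ) :
    IsGaussianPair P (coeffForm a b n w) (coeffForm a b n w')
      (specVar μ n w) (specCov μ n w w') (specVar μ n w') := by
  have := hμ.isProbabilityMeasure
  refine ⟨(map_coeffForm ha hb hab hμ n w).1, (map_coeffForm ha hb hab hμ n w').1, ?_, ?_⟩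
  · intro s t
    rw [← specVar_add_smul]
    exact specVar_nonneg _ _ _
  · intro s t
    rw [← specVar_add_smul, ← (map_coeffForm ha hb hab hμ n _).2]
    congr 1
    funext ω
    simp only [coeffForm, Finset.mul_sum, ← Finset.sum_add_distrib]
    refine Finset.sum_congr rfl fun j _ => ?_
    simp
    ring

end Coefficients

/-! ### Kernels of tilted linear forms -/

/-- The weights `w_k = g(k/n) e^{ikx}`, `k = j + 1`. For `g = 1` the corresponding linear form is
`∑ (a_k cos(kx) + b_k sin(kx))`; other profiles `g` give its values at points at distance of order
`1/n` of `x`, real or complex. -/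
noncomputable def tilt (g : ℝ → ℂ) (n : ℕ) (x : ℝ) (j : ℕ) : ℂ :=
  g ((j + 1 : ℕ) / n) * Complex.exp (Complex.I * (j + 1 : ℕ) * x)

/-- Parseval's identity. -/
lemma specVar_volume (n : ℕ) (w : ℕ → ℂ) :
    specVar volume n w = 2 * Real.pi * ∑ j ∈ Finset.range n, ‖w j‖ ^ 2 := by
  have hπ := Real.pi_pos
  have hfour : ∀ k : ℤ, (((fun k : ℤ => if k = 0 then 2 * Real.pi else 0) k : ℝ) : ℂ) =
      ∫ x in Set.Icc (-Real.pi) Real.pi, Complex.exp (-Complex.I * k * x) := by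
    intro k
    rw [integral_Icc_eq_integral_Ioc, ← intervalIntegral.integral_of_le (by linarith)]
    by_cases hk : k = 0
    · subst hk
      simp
      ring
    · have hc : -Complex.I * (k : ℂ) ≠ 0 := by simpa using hk
      simp only [hk, if_false]
      rw [integral_exp_mul_complex hc]
      have : Complex.exp (-Complex.I * k * (Real.pi : ℝ))
          = Complex.exp (-Complex.I * k * ((-Real.pi : ℝ) : ℂ)) := by
        rw [Complex.exp_eq_exp_iff_exists_int]
        exact ⟨-k, by push_cast; ring⟩
      rw [this]
      simp
  rw [specVar_eq_sum (ρ := fun k : ℤ => if k = 0 then 2 * Real.pi else 0) hfour, Finset.mul_sum]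
  refine Finset.sum_congr rfl fun j hj => ?_
  rw [Finset.sum_eq_single j]
  · simp [Complex.sq_norm, Complex.normSq_apply]
  · intro l _ hl
    have : (j : ℤ) - l ≠ 0 := by omega
    simp [this]
  · intro h; exact absurd hj h

/-- Summation by parts for a power sum with coefficients of bounded variation. -/
lemma sub_one_mul_sum_mul_pow (G : ℕ → ℂ) (z : ℂ) (n : ℕ) :
    (z - 1) * ∑ j ∈ Finset.range (n + 1), G j * z ^ (j + 1)
      = G n * z ^ (n + 2) - G 0 * z - ∑ j ∈ Finset.range n, (G (j + 1) - G j) * z ^ (j + 2) := by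
  induction n with
  | zero => simp; ring
  | succ n ih =>
    rw [Finset.sum_range_succ, mul_add, ih, Finset.sum_range_succ _ n]
    ring

lemma specSum_tilt (g : ℝ → ℂ) (n : ℕ) (x y : ℝ) :
    specSum n (tilt g n x) y = ∑ j ∈ Finset.range n,
      g ((j + 1 : ℕ) / n) * Complex.exp ((x - y : ℝ) * Complex.I) ^ (j + 1) := by
  refine Finset.sum_congr rfl fun j _ => ?_
  rw [tilt, mul_assoc, ← Complex.exp_add, ← Complex.exp_nat_mul]
  congr 2
  push_cast
  ring

lemma tilt_mem_Icc {n j : ℕ} (hj : j < n) : ((j + 1 : ℕ) : ℝ) / n ∈ Set.Icc (0 : ℝ) 1 := by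
  have hn : (0 : ℝ) < n := by exact_mod_cast (Nat.zero_lt_of_lt hj)
  refine ⟨by positivity, ?_⟩
  rw [div_le_one hn]
  exact_mod_cast hj

lemma norm_specSum_tilt_le {g : ℝ → ℂ} {M : ℝ} (hM : ∀ t ∈ Set.Icc (0 : ℝ) 1, ‖g t‖ ≤ M)
    (n : ℕ) (x y : ℝ) : ‖specSum n (tilt g n x) y‖ ≤ n * M := by
  rw [specSum_tilt]
  calc _ ≤ ∑ j ∈ Finset.range n, M := by
        refine norm_sum_le_of_le _ fun j hj => ?_
        rw [norm_mul, norm_pow, Complex.norm_exp_ofReal_mul_I, one_pow, mul_one]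
        exact hM _ (tilt_mem_Icc (Finset.mem_range.1 hj))
    _ = n * M := by simp

/-- The kernels of the tilted forms decay like the inverse distance to the diagonal, by summation by
parts. -/
lemma norm_sub_one_mul_specSum_tilt_le {g : ℝ → ℂ} {M : ℝ} {L : NNReal}
    (hM : ∀ t ∈ Set.Icc (0 : ℝ) 1, ‖g t‖ ≤ M) (hL : LipschitzOnWith L g (Set.Icc 0 1))
    (n : ℕ) (x y : ℝ) :
    ‖Complex.exp ((x - y : ℝ) * Complex.I) - 1‖ * ‖specSum n (tilt g n x) y‖ ≤ 2 * M + L := by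
  have hM0 : 0 ≤ M := (norm_nonneg _).trans (hM 0 (by simp))
  have hz : ∀ k : ℕ, ‖Complex.exp ((x - y : ℝ) * Complex.I) ^ k‖ = 1 := by
    intro k
    rw [norm_pow, Complex.norm_exp_ofReal_mul_I, one_pow]
  rw [specSum_tilt, ← norm_mul]
  set z := Complex.exp ((x - y : ℝ) * Complex.I)
  rcases n with _ | n
  · simp; positivity
  rw [sub_one_mul_sum_mul_pow]
  refine (norm_sub_le _ _).trans (add_le_add ((norm_sub_le _ _).trans ?_) ?_)
  · rw [norm_mul, norm_mul, hz, ← pow_one z, hz]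
    have h1 := hM _ (tilt_mem_Icc (n := n + 1) (j := n) (by omega))
    have h2 := hM _ (tilt_mem_Icc (n := n + 1) (j := 0) (by omega))
    linarith
  · calc _ ≤ ∑ j ∈ Finset.range n, (L : ℝ) * (1 / (n + 1 : ℕ)) := by
          refine norm_sum_le_of_le _ fun j hj => ?_
          have hj' := Finset.mem_range.1 hj
          rw [norm_mul, hz, mul_one]
          have := hL.dist_le_mul _ (tilt_mem_Icc (n := n + 1) (j := j + 1) (by omega))
            _ (tilt_mem_Icc (n := n + 1) (j := j) (by omega))
          rw [dist_eq_norm, Real.dist_eq] at this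
          refine this.trans (le_of_eq ?_)
          congr 1
          rw [← sub_div]
          push_cast
          rw [abs_of_nonneg] <;> ring_nf
          positivity
      _ = L * (n / (n + 1 : ℕ)) := by simp; ring
      _ ≤ L * 1 := by
          refine mul_le_mul_of_nonneg_left ?_ L.2
          rw [div_le_one (by positivity)]
          push_cast; linarith
      _ = L := mul_one _

lemma exists_mul_abs_le_norm_exp_sub_one {R : ℝ} (hR : R < 2 * Real.pi) :
    ∃ c > 0, ∀ u : ℝ, |u| ≤ R → c * |u| ≤ ‖Complex.exp (u * Complex.I) - 1‖ := by
  have hπ := Real.pi_pos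
  set d := min 1 ((Real.pi - R / 2) / Real.pi) with hd
  have hd0 : 0 < d := lt_min one_pos (div_pos (by linarith) hπ)
  refine ⟨2 / Real.pi * d, by positivity, fun u hu => ?_⟩
  have hnorm : ‖Complex.exp (u * Complex.I) - 1‖ = 2 * |Real.sin (|u| / 2)| := by
    have h1 : ‖Complex.exp (u * Complex.I) - 1‖ = ‖2 * Real.sin (u / 2)‖ := by
      rw [mul_comm, Complex.norm_exp_I_mul_ofReal_sub_one]
    rw [h1, norm_mul, Real.norm_eq_abs, Real.norm_eq_abs, abs_two]
    rcases abs_cases u with ⟨h, _⟩ | ⟨h, _⟩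
    · rw [h]
    · rw [h, neg_div, Real.sin_neg, abs_neg]
  rw [hnorm]
  set t := |u| / 2 with ht
  have ht0 : 0 ≤ t := by positivity
  have htR : t ≤ R / 2 := by rw [ht]; linarith
  have hut : |u| = 2 * t := by rw [ht]; ring
  have key : 2 / Real.pi * d * t ≤ Real.sin t := by
    rcases le_total t (Real.pi / 2) with h | h
    · have h1 := Real.mul_le_sin ht0 h
      have h2 : d * t ≤ t := mul_le_of_le_one_left ht0 (min_le_left _ _)
      calc 2 / Real.pi * d * t = 2 / Real.pi * (d * t) := by ring
        _ ≤ 2 / Real.pi * t := mul_le_mul_of_nonneg_left h2 (by positivity)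
        _ ≤ _ := h1
    · have h1 := Real.mul_le_sin (x := Real.pi - t) (by linarith) (by linarith)
      rw [Real.sin_pi_sub] at h1
      refine le_trans ?_ h1
      have h2 : d ≤ (Real.pi - R / 2) / Real.pi := min_le_right _ _
      have h3 : d * t ≤ (Real.pi - R / 2) / Real.pi * Real.pi :=
        mul_le_mul h2 (by linarith) ht0 (hd0.le.trans h2)
      rw [div_mul_cancel₀ _ hπ.ne'] at h3
      calc 2 / Real.pi * d * t = 2 / Real.pi * (d * t) := by ring
        _ ≤ 2 / Real.pi * (Real.pi - t) :=
          mul_le_mul_of_nonneg_left (by linarith) (by positivity)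
  rw [hut]
  have := le_abs_self (Real.sin t)
  linarith

/-- The kernel `|∑ g(k/n) e^{iku}|² / n` is dominated by a multiple of `n / (1 + n² u²)`, away from
the nonzero multiples of `2π`. -/
lemma exists_specSum_sq_le {g : ℝ → ℂ} {L : NNReal} (hL : LipschitzOnWith L g (Set.Icc 0 1))
    {R : ℝ} (hR : R < 2 * Real.pi) :
    ∃ C : ℝ, 0 ≤ C ∧ ∀ (n : ℕ) (x y : ℝ), 0 < n → |x - y| ≤ R →
      ‖specSum n (tilt g n x) y‖ ^ 2 / n ≤ C * (n / (1 + (n * |x - y|) ^ 2)) := by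
  obtain ⟨M, hM⟩ := isCompact_Icc.exists_bound_of_continuousOn hL.continuousOn
  obtain ⟨c, hc, hcu⟩ := exists_mul_abs_le_norm_exp_sub_one hR
  have hM0 : 0 ≤ M := (norm_nonneg _).trans (hM 0 (by simp))
  refine ⟨M ^ 2 + ((2 * M + L) / c) ^ 2, by positivity, fun n x y hn hxy => ?_⟩
  have hn' : (0 : ℝ) < n := by exact_mod_cast hn
  set s := ‖specSum n (tilt g n x) y‖ with hs
  have hs0 : 0 ≤ s := norm_nonneg _
  have h1 : s ≤ n * M := norm_specSum_tilt_le hM n x y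
  have h2 : |x - y| * s ≤ (2 * M + L) / c := by
    rw [le_div_iff₀ hc]
    calc |x - y| * s * c = (c * |x - y|) * s := by ring
      _ ≤ _ := mul_le_mul_of_nonneg_right (hcu _ hxy) hs0
      _ ≤ _ := norm_sub_one_mul_specSum_tilt_le hM hL n x y
  have h3 : s ^ 2 ≤ (n * M) ^ 2 := pow_le_pow_left₀ hs0 h1 2
  have h4 : (|x - y| * s) ^ 2 ≤ ((2 * M + L) / c) ^ 2 := pow_le_pow_left₀ (by positivity) h2 2
  rw [← mul_div_assoc, div_le_div_iff₀ hn' (by positivity)]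
  have h5 : (n : ℝ) ^ 2 * (|x - y| * s) ^ 2 ≤ n ^ 2 * ((2 * M + L) / c) ^ 2 :=
    mul_le_mul_of_nonneg_left h4 (by positivity)
  nlinarith

/-- Right-endpoint Riemann sums of a Lipschitz function on `[0, 1]`. -/
lemma tendsto_riemannSum {G : ℝ → ℝ} {L : NNReal} (hL : LipschitzOnWith L G (Set.Icc 0 1)) :
    Tendsto (fun n : ℕ => (∑ j ∈ Finset.range n, G ((j + 1 : ℕ) / n)) / n) atTop
      (𝓝 (∫ t in (0 : ℝ)..1, G t)) := by
  have hb : ∀ n : ℕ, 0 < n →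
      |(∑ j ∈ Finset.range n, G ((j + 1 : ℕ) / n)) / n - ∫ t in (0 : ℝ)..1, G t| ≤ L / n := by
    intro n hn
    have hn' : (0 : ℝ) < n := by exact_mod_cast hn
    have hle : ∀ j : ℕ, (j : ℝ) / n ≤ ((j + 1 : ℕ) : ℝ) / n := by
      intro j
      gcongr
      simp
    have hsub : ∀ j < n, Set.uIcc ((j : ℝ) / n) (((j + 1 : ℕ) : ℝ) / n) ⊆ Set.Icc 0 1 := by
      intro j hj
      rw [Set.uIcc_of_le (hle j)]
      exact Set.Icc_subset_Icc (by positivity) (tilt_mem_Icc hj).2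
    have hint : ∀ j < n, IntervalIntegrable G volume ((j : ℝ) / n) (((j + 1 : ℕ) : ℝ) / n) :=
      fun j hj => (hL.continuousOn.mono (hsub j hj)).intervalIntegrable
    have hsum := intervalIntegral.sum_integral_adjacent_intervals
      (f := G) (μ := volume) (a := fun j : ℕ => (j : ℝ) / n) (n := n) hint
    rw [Nat.cast_zero, zero_div, div_self hn'.ne'] at hsum
    rw [← hsum, Finset.sum_div, ← Finset.sum_sub_distrib]
    have hterm : ∀ j ∈ Finset.range n, ‖G ((j + 1 : ℕ) / n) / n
        - ∫ t in ((j : ℝ) / n)..(((j + 1 : ℕ) : ℝ) / n), G t‖ ≤ L / n * (1 / n) := by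
      intro j hj
      have hj' := Finset.mem_range.1 hj
      have hlen : ((j + 1 : ℕ) : ℝ) / n - (j : ℝ) / n = 1 / n := by
        push_cast; field_simp; ring
      have h1 : G ((j + 1 : ℕ) / n) / n
          = ∫ t in ((j : ℝ) / n)..(((j + 1 : ℕ) : ℝ) / n), G ((j + 1 : ℕ) / n) := by
        rw [intervalIntegral.integral_const, hlen, smul_eq_mul]; ring
      rw [h1, ← intervalIntegral.integral_sub intervalIntegrable_const (hint j hj')]
      refine (intervalIntegral.norm_integral_le_of_norm_le_const (C := L / n) ?_).trans
        (le_of_eq ?_)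
      · intro t ht
        have ht' : t ∈ Set.uIcc ((j : ℝ) / n) (((j + 1 : ℕ) : ℝ) / n) :=
          Set.uIoc_subset_uIcc ht
        have := hL.dist_le_mul _ (tilt_mem_Icc hj') _ (hsub j hj' ht')
        rw [dist_eq_norm] at this
        refine this.trans ?_
        rw [div_eq_mul_one_div (L : ℝ), Real.dist_eq, ← hlen]
        refine mul_le_mul_of_nonneg_left ?_ L.2
        rw [Set.uIcc_of_le (hle j)] at ht'
        rw [abs_of_nonneg (by linarith [ht'.2])]
        linarith [ht'.1]
      · rw [hlen, abs_of_nonneg (by positivity)]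
    rw [← Real.norm_eq_abs]
    refine (norm_sum_le_of_le _ hterm).trans (le_of_eq ?_)
    simp
    field_simp
  rw [tendsto_iff_norm_sub_tendsto_zero]
  refine squeeze_zero' (Eventually.of_forall fun n => norm_nonneg _) ?_
    (tendsto_const_div_atTop_nhds_zero_nat (L : ℝ))
  filter_upwards [eventually_gt_atTop 0] with n hn
  rw [Real.norm_eq_abs]
  exact hb n hn

lemma lipschitzOnWith_norm_sq {g : ℝ → ℂ} {L : NNReal} (hL : LipschitzOnWith L g (Set.Icc 0 1)) :
    ∃ L' : NNReal, LipschitzOnWith L' (fun t => ‖g t‖ ^ 2) (Set.Icc 0 1) := by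
  obtain ⟨M, hM⟩ := isCompact_Icc.exists_bound_of_continuousOn hL.continuousOn
  have hM0 : 0 ≤ M := (norm_nonneg _).trans (hM 0 (by simp))
  refine ⟨Real.toNNReal (2 * M) * L, LipschitzOnWith.of_dist_le_mul fun s hs t ht => ?_⟩
  have h1 := hL.dist_le_mul s hs t ht
  have h2 : |‖g s‖ - ‖g t‖| ≤ dist (g s) (g t) := by
    rw [dist_eq_norm]; exact abs_norm_sub_norm_le _ _
  rw [Real.dist_eq, show ‖g s‖ ^ 2 - ‖g t‖ ^ 2 = (‖g s‖ + ‖g t‖) * (‖g s‖ - ‖g t‖) by ring,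
    abs_mul, abs_of_nonneg (by positivity)]
  rw [NNReal.coe_mul, Real.coe_toNNReal _ (by positivity), mul_assoc (2 * M)]
  exact mul_le_mul (by simpa [two_mul] using add_le_add (hM s hs) (hM t ht)) (h2.trans h1)
    (abs_nonneg _) (by positivity)

lemma norm_tilt (g : ℝ → ℂ) (n : ℕ) (x : ℝ) (j : ℕ) :
    ‖tilt g n x j‖ = ‖g ((j + 1 : ℕ) / n)‖ := by
  rw [tilt, norm_mul]
  have : Complex.I * (j + 1 : ℕ) * x = (((j + 1 : ℕ) * x : ℝ) : ℂ) * Complex.I := by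
    push_cast; ring
  rw [this, Complex.norm_exp_ofReal_mul_I, mul_one]

lemma tendsto_specVar_volume {g : ℝ → ℂ} {L : NNReal} (hL : LipschitzOnWith L g (Set.Icc 0 1))
    (x : ℝ) : Tendsto (fun n : ℕ => specVar volume n (tilt g n x) / n) atTop
      (𝓝 (2 * Real.pi * ∫ t in (0 : ℝ)..1, ‖g t‖ ^ 2)) := by
  obtain ⟨L', hL'⟩ := lipschitzOnWith_norm_sq hL
  have := (tendsto_riemannSum hL').const_mul (2 * Real.pi)
  refine this.congr fun n => ?_
  rw [specVar_volume]
  simp only [norm_tilt]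
  ring

/-! ### Pointwise limits of the variances -/

/-- Dyadic decomposition of the kernel `n / (1 + n² (x - y)²)` into indicators of balls. -/
lemma ofReal_kernel_le_tsum (x y : ℝ) {n : ℕ} (hn : 0 < n) :
    ENNReal.ofReal (n / (1 + (n * |x - y|) ^ 2))
      ≤ ∑' m : ℕ, (Metric.closedBall x (2 ^ m / n)).indicator
        (fun _ => ENNReal.ofReal (4 * n / 4 ^ m)) y := by
  have hn' : (0 : ℝ) < n := by exact_mod_cast hn
  obtain ⟨m, hm1, hm2⟩ : ∃ m : ℕ, n * |x - y| ≤ 2 ^ m ∧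
      (n : ℝ) / (1 + (n * |x - y|) ^ 2) ≤ 4 * n / 4 ^ m := by
    rcases le_total (n * |x - y|) 1 with h | h
    · refine ⟨0, by simpa using h, ?_⟩
      rw [pow_zero, div_one]
      calc (n : ℝ) / (1 + (n * |x - y|) ^ 2) ≤ n / 1 :=
            div_le_div_of_nonneg_left hn'.le one_pos (by linarith [sq_nonneg (n * |x - y|)])
        _ ≤ 4 * n := by linarith
    · obtain ⟨k, hk1, hk2⟩ := exists_nat_pow_near h (one_lt_two)
      refine ⟨k + 1, hk2.le, ?_⟩
      have h4 : (4 : ℝ) ^ k ≤ (n * |x - y|) ^ 2 := by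
        calc (4 : ℝ) ^ k = (2 ^ k) ^ 2 := by rw [← pow_mul, mul_comm, pow_mul]; norm_num
          _ ≤ _ := pow_le_pow_left₀ (by positivity) hk1 2
      rw [pow_succ (4 : ℝ) k, mul_comm (4 : ℝ) (n : ℝ),
        mul_div_mul_right _ _ (by norm_num : (4 : ℝ) ≠ 0)]
      exact div_le_div_of_nonneg_left hn'.le (by positivity) (by linarith)
  refine le_trans ?_ (ENNReal.le_tsum m)
  rw [Set.indicator_of_mem]
  · exact ENNReal.ofReal_le_ofReal hm2
  · rw [Metric.mem_closedBall, Real.dist_eq, abs_sub_comm, le_div_iff₀ hn', mul_comm]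
    exact hm1

/-- The Poisson-type kernels `n / (1 + n² (x - y)²)` integrate to `0` in the limit against a finite
measure with vanishing density at `x`. -/
lemma tendsto_lintegral_kernel {ν : Measure ℝ} [IsFiniteMeasure ν] {x : ℝ}
    (hν : Tendsto (fun r : ℝ => ν (Metric.closedBall x r) / volume (Metric.closedBall x r))
      (𝓝[>] 0) (𝓝 0)) :
    Tendsto (fun n : ℕ => ∫⁻ y, ENNReal.ofReal (n / (1 + (n * |x - y|) ^ 2)) ∂ν) atTop (𝓝 0) := by
  set Φ : ℝ → ℝ≥0∞ := fun r => ν (Metric.closedBall x r) / volume (Metric.closedBall x r) with hΦ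
  obtain ⟨C, hC, hΦC⟩ : ∃ C : ℝ≥0∞, C ≠ ∞ ∧ ∀ r > 0, Φ r ≤ C := by
    have h1 : ∀ᶠ r in 𝓝[>] (0 : ℝ), Φ r < 1 := hν.eventually (gt_mem_nhds zero_lt_one)
    obtain ⟨r0, hr0, hr⟩ := mem_nhdsGT_iff_exists_Ioo_subset.1 h1
    have hr0' : (0 : ℝ) < r0 := hr0
    refine ⟨1 + ν Set.univ / ENNReal.ofReal (2 * r0), ?_, fun r hrpos => ?_⟩
    · refine ENNReal.add_ne_top.2 ⟨ENNReal.one_ne_top, ENNReal.div_ne_top (measure_ne_top _ _) ?_⟩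
      simpa using hr0'
    · rcases lt_or_ge r r0 with h | h
      · exact (le_of_lt (hr ⟨hrpos, h⟩)).trans le_self_add
      · refine le_trans ?_ le_add_self
        simp only [hΦ, Real.volume_closedBall]
        exact ENNReal.div_le_div (measure_mono (Set.subset_univ _))
          (ENNReal.ofReal_le_ofReal (by linarith))
  have hbound : ∀ n : ℕ, 0 < n → ∫⁻ y, ENNReal.ofReal (n / (1 + (n * |x - y|) ^ 2)) ∂ν
      ≤ ∑' m : ℕ, ENNReal.ofReal (8 / 2 ^ m) * Φ (2 ^ m / n) := by
    intro n hn
    have hn' : (0 : ℝ) < n := by exact_mod_cast hn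
    calc _ ≤ ∫⁻ y, ∑' m : ℕ, (Metric.closedBall x (2 ^ m / n)).indicator
          (fun _ => ENNReal.ofReal (4 * n / 4 ^ m)) y ∂ν :=
          lintegral_mono fun y => ofReal_kernel_le_tsum x y hn
      _ = ∑' m : ℕ, ENNReal.ofReal (8 / 2 ^ m) * Φ (2 ^ m / n) := by
          rw [lintegral_tsum fun m =>
            (measurable_const.indicator Metric.isClosed_closedBall.measurableSet).aemeasurable]
          refine tsum_congr fun m => ?_
          rw [lintegral_indicator_const Metric.isClosed_closedBall.measurableSet]
          have h2 : (0 : ℝ) < 2 * (2 ^ m / n) := by positivity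
          have h3 : ν (Metric.closedBall x (2 ^ m / n))
              = ENNReal.ofReal (2 * (2 ^ m / n)) * Φ (2 ^ m / n) := by
            simp only [hΦ, Real.volume_closedBall]
            rw [ENNReal.mul_div_cancel (by simpa using h2) ENNReal.ofReal_ne_top]
          rw [h3, ← mul_assoc, ← ENNReal.ofReal_mul (by positivity)]
          congr 2
          have : (4 : ℝ) ^ m = 2 ^ m * 2 ^ m := by rw [← mul_pow]; norm_num
          rw [this]
          field_simp
          norm_num
  have hlim : Tendsto (fun n : ℕ => ∑' m : ℕ, ENNReal.ofReal (8 / 2 ^ m) * Φ (2 ^ m / n)) atTop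
      (𝓝 0) := by
    have hsum : ∑' m : ℕ, ENNReal.ofReal (8 / 2 ^ m) * C ≠ ∞ := by
      rw [ENNReal.tsum_mul_right]
      refine ENNReal.mul_ne_top ?_ hC
      have hs : Summable (fun m : ℕ => (8 : ℝ) / 2 ^ m) := by
        have := (summable_geometric_two).mul_left (8 : ℝ)
        refine this.congr fun m => ?_
        rw [one_div, inv_pow]; rfl
      rw [← ENNReal.ofReal_tsum_of_nonneg (fun m => by positivity) hs]
      exact ENNReal.ofReal_ne_top
    have := tendsto_lintegral_of_dominated_convergence' (μ := Measure.count)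
      (F := fun (n : ℕ) (m : ℕ) => ENNReal.ofReal (8 / 2 ^ m) * Φ (2 ^ m / ((n + 1 : ℕ) : ℝ)))
      (f := fun _ => 0) (fun m => ENNReal.ofReal (8 / 2 ^ m) * C)
      (fun n => (measurable_of_countable _).aemeasurable)
      (fun n => ae_of_all _ fun m => by
        exact mul_le_mul_right (hΦC _ (by positivity)) _) (by rwa [lintegral_count])
      (ae_of_all _ fun m => by
        have h0 : Tendsto (fun n : ℕ => (2 : ℝ) ^ m / ((n + 1 : ℕ) : ℝ)) atTop (𝓝[>] 0) := by
          refine tendsto_nhdsWithin_iff.2 ⟨?_, Eventually.of_forall fun n => ?_⟩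
          · exact (tendsto_const_div_atTop_nhds_zero_nat ((2 : ℝ) ^ m)).comp
              (tendsto_add_atTop_nat 1)
          · exact Set.mem_Ioi.2 (by positivity)
        have := ENNReal.Tendsto.const_mul (a := ENNReal.ofReal (8 / 2 ^ m)) (hν.comp h0)
          (Or.inr ENNReal.ofReal_ne_top)
        simpa using this)
    simp only [lintegral_count, tsum_zero] at this
    exact (tendsto_add_atTop_iff_nat 1).1 this
  refine tendsto_of_tendsto_of_tendsto_of_le_of_le' tendsto_const_nhds hlim
    (Eventually.of_forall fun _ => zero_le) ?_
  filter_upwards [eventually_gt_atTop 0] with n hn using hbound n hn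

lemma tendsto_integral_kernel {ν : Measure ℝ} [IsFiniteMeasure ν] {x : ℝ}
    (hν : Tendsto (fun r : ℝ => ν (Metric.closedBall x r) / volume (Metric.closedBall x r))
      (𝓝[>] 0) (𝓝 0)) :
    Tendsto (fun n : ℕ => ∫ y, n / (1 + (n * |x - y|) ^ 2) ∂ν) atTop (𝓝 0) := by
  have := (ENNReal.tendsto_toReal ENNReal.zero_ne_top).comp (tendsto_lintegral_kernel hν)
  refine this.congr fun n => ?_
  rw [integral_eq_lintegral_of_nonneg_ae (ae_of_all _ fun y => by positivity)]
  · rfl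
  · have hm : Measurable (fun y : ℝ => (n : ℝ) / (1 + (n * |x - y|) ^ 2)) := by fun_prop
    exact hm.aestronglyMeasurable

section Decomposition

variable {μ μs : Measure ℝ} {ψ : ℝ → ℝ}

lemma IsLebesgueDecomposition.isFiniteMeasure (h : IsLebesgueDecomposition μ μs ψ)
    [IsFiniteMeasure μ] : IsFiniteMeasure μs :=
  isFiniteMeasure_of_le μ (by rw [h.eq_add]; exact Measure.le_add_right le_rfl)

lemma IsLebesgueDecomposition.integrableOn (h : IsLebesgueDecomposition μ μs ψ)
    [IsFiniteMeasure μ] : IntegrableOn ψ (Set.Icc (-Real.pi) Real.pi) volume := by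
  refine ⟨h.measurable.aestronglyMeasurable, ?_⟩
  rw [hasFiniteIntegral_iff_ofReal (ae_of_all _ h.nonneg)]
  have h1 : ((volume.restrict (Set.Icc (-Real.pi) Real.pi)).withDensity
      (fun x => ENNReal.ofReal (ψ x))) Set.univ ≤ μ Set.univ := by
    conv_rhs => rw [h.eq_add]
    exact le_add_self
  rw [withDensity_apply _ MeasurableSet.univ, Measure.restrict_univ] at h1
  exact h1.trans_lt (measure_lt_top _ _)

lemma IsLebesgueDecomposition.setIntegral_eq (h : IsLebesgueDecomposition μ μs ψ)
    [IsFiniteMeasure μ] {f : ℝ → ℝ} (hf : Continuous f) :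
    ∫ y in Set.Icc (-Real.pi) Real.pi, f y ∂μ
      = ∫ y in Set.Icc (-Real.pi) Real.pi, f y ∂μs
        + ∫ y in Set.Icc (-Real.pi) Real.pi, ψ y * f y := by
  have := h.isFiniteMeasure
  have hfin : IsFiniteMeasure ((volume.restrict (Set.Icc (-Real.pi) Real.pi)).withDensity
      (fun x => ENNReal.ofReal (ψ x))) :=
    isFiniteMeasure_of_le μ (by conv_rhs => rw [h.eq_add]
                                exact Measure.le_add_left le_rfl)
  conv_lhs => rw [h.eq_add]
  rw [Measure.restrict_add, integral_add_measure hf.integrableOn_Icc hf.integrableOn_Icc]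
  congr 1
  rw [restrict_withDensity measurableSet_Icc, Measure.restrict_restrict measurableSet_Icc,
    Set.inter_self, integral_withDensity_eq_integral_toReal_smul
      h.measurable.ennreal_ofReal (ae_of_all _ fun _ => ENNReal.ofReal_lt_top)]
  refine integral_congr_ae (ae_of_all _ fun y => ?_)
  simp only [ENNReal.toReal_ofReal (h.nonneg y), smul_eq_mul]

/-- The variation of `μ - ψ(x) dy` on `[-π, π]`, written as `μs + |ψ(y) - ψ(x)| dy`. -/
noncomputable def localDefect (μs : Measure ℝ) (ψ : ℝ → ℝ) (x : ℝ) : Measure ℝ :=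
  μs + (volume.restrict (Set.Icc (-Real.pi) Real.pi)).withDensity (fun y => ‖ψ y - ψ x‖ₑ)

lemma IsLebesgueDecomposition.isFiniteMeasure_localDefect (h : IsLebesgueDecomposition μ μs ψ)
    [IsFiniteMeasure μ] (x : ℝ) : IsFiniteMeasure (localDefect μs ψ x) := by
  have := h.isFiniteMeasure
  have hi : IntegrableOn (fun y => ψ y - ψ x) (Set.Icc (-Real.pi) Real.pi) volume :=
    h.integrableOn.sub (integrable_const _)
  have : IsFiniteMeasure ((volume.restrict (Set.Icc (-Real.pi) Real.pi)).withDensity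
      (fun y => ‖ψ y - ψ x‖ₑ)) := isFiniteMeasure_withDensity hi.2.ne
  unfold localDefect
  infer_instance

lemma IsLebesgueDecomposition.ae_tendsto_localDefect (h : IsLebesgueDecomposition μ μs ψ)
    [IsFiniteMeasure μ] : ∀ᵐ x, x ∈ Set.Ioo (-Real.pi) Real.pi →
      Tendsto (fun r : ℝ => localDefect μs ψ x (Metric.closedBall x r)
        / volume (Metric.closedBall x r)) (𝓝[>] 0) (𝓝 0) := by
  have := h.isFiniteMeasure
  set K := Set.Icc (-Real.pi) Real.pi with hK
  have hloc : LocallyIntegrable (K.indicator ψ) volume :=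
    (h.integrableOn.integrable_indicator measurableSet_Icc).locallyIntegrable
  have h1 := Besicovitch.ae_tendsto_rnDeriv μs (volume : Measure ℝ)
  have h2 := (Besicovitch.vitaliFamily (volume : Measure ℝ)).ae_tendsto_lintegral_enorm_sub_div hloc
  have h3 : μs.rnDeriv volume =ᵐ[volume] 0 :=
    Measure.rnDeriv_eq_zero_of_mutuallySingular h.singular Measure.AbsolutelyContinuous.rfl
  filter_upwards [h1, h2, h3] with x hx1 hx2 hx3 hx
  rw [hx3] at hx1
  have hx2' := hx2.comp (Besicovitch.tendsto_filterAt volume x)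
  have hsum := hx1.add hx2'
  rw [Pi.zero_apply, add_zero] at hsum
  refine hsum.congr' ?_
  -- inside `[-π, π]` the truncated density agrees with `ψ`
  filter_upwards [Ioo_mem_nhdsGT (show (0 : ℝ) < min (x + Real.pi) (Real.pi - x) from
    lt_min (by linarith [hx.1]) (by linarith [hx.2]))] with r hr
  have hsub : Metric.closedBall x r ⊆ K := by
    rw [Real.closedBall_eq_Icc]
    have h4 := lt_min_iff.1 hr.2
    exact Set.Icc_subset_Icc (by linarith) (by linarith)
  simp only [Function.comp_apply, localDefect, Measure.add_apply]
  rw [withDensity_apply _ Metric.isClosed_closedBall.measurableSet,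
    Measure.restrict_restrict Metric.isClosed_closedBall.measurableSet,
    Set.inter_eq_left.2 hsub, ENNReal.add_div]
  congr 2
  refine setLIntegral_congr_fun Metric.isClosed_closedBall.measurableSet fun y hy => ?_
  have hxK : x ∈ K := Set.Ioo_subset_Icc_self hx
  simp only [Set.indicator_of_mem (hsub hy), Set.indicator_of_mem hxK]

/-- At almost every point the variances of the tilted linear forms, divided by `n`, converge to
`2π ψ(x) ∫₀¹ |g|²`: the kernels are approximate identities and almost every `x` is a Lebesgue point
of the density at which the singular part has derivative zero. -/
theorem IsLebesgueDecomposition.ae_tendsto_specVar (h : IsLebesgueDecomposition μ μs ψ)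
    [IsFiniteMeasure μ] : ∀ᵐ x, x ∈ Set.Ioo (-Real.pi) Real.pi →
      ∀ (g : ℝ → ℂ) (L : NNReal), LipschitzOnWith L g (Set.Icc 0 1) →
      Tendsto (fun n : ℕ => specVar μ n (tilt g n x) / n) atTop
        (𝓝 (2 * Real.pi * ψ x * ∫ t in (0 : ℝ)..1, ‖g t‖ ^ 2)) := by
  have := h.isFiniteMeasure
  filter_upwards [h.ae_tendsto_localDefect] with x hx hxI g L hL
  have hfin := h.isFiniteMeasure_localDefect x
  have hker := tendsto_integral_kernel (hx hxI)
  set K := Set.Icc (-Real.pi) Real.pi with hK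
  obtain ⟨C, hC0, hC⟩ := exists_specSum_sq_le hL (R := Real.pi + |x|)
    (by have := abs_lt.2 ⟨hxI.1, hxI.2⟩; linarith)
  have hvol := (tendsto_specVar_volume hL x).const_mul (ψ x)
  rw [show ψ x * (2 * Real.pi * ∫ t in (0 : ℝ)..1, ‖g t‖ ^ 2)
    = 2 * Real.pi * ψ x * ∫ t in (0 : ℝ)..1, ‖g t‖ ^ 2 by ring] at hvol
  refine tendsto_of_tendsto_of_dist hvol ?_
  refine squeeze_zero' (Eventually.of_forall fun _ => dist_nonneg) ?_
    (by simpa using hker.const_mul C)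
  filter_upwards [eventually_gt_atTop 0] with n hn
  have hn' : (0 : ℝ) < n := by exact_mod_cast hn
  set κ : ℝ → ℝ := fun y => ‖specSum n (tilt g n x) y‖ ^ 2 with hκ
  have hκc : Continuous κ := (continuous_specSum _ _).norm.pow 2
  have hκ0 : ∀ y, 0 ≤ κ y := fun y => by positivity
  have hψi := h.integrableOn
  have hbdd : ∃ B, ∀ y ∈ K, ‖κ y‖ ≤ B :=
    isCompact_Icc.exists_bound_of_continuousOn hκc.continuousOn
  obtain ⟨B, hB⟩ := hbdd
  have hψκ : IntegrableOn (fun y => ψ y * κ y) K volume :=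
    Integrable.mul_bdd (c := B) hψi hκc.aestronglyMeasurable
      ((ae_restrict_iff' measurableSet_Icc).2 (ae_of_all _ hB))
  have hdiff : IntegrableOn (fun y => ‖ψ y - ψ x‖ * κ y) K volume := by
    have : IntegrableOn (fun y => (ψ y - ψ x) * κ y) K volume :=
      Integrable.mul_bdd (c := B) (hψi.sub (integrable_const _)) hκc.aestronglyMeasurable
        ((ae_restrict_iff' measurableSet_Icc).2 (ae_of_all _ hB))
    refine this.norm.congr (ae_of_all _ fun y => ?_)
    simp only [norm_mul, Real.norm_of_nonneg (hκ0 y)]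
  have e1 : specVar μ n (tilt g n x) - ψ x * specVar volume n (tilt g n x)
      = ∫ y in K, κ y ∂μs + ∫ y in K, (ψ y - ψ x) * κ y := by
    have := h.setIntegral_eq hκc
    rw [specVar, specVar, this, add_sub_assoc, ← integral_const_mul, ← integral_sub hψκ]
    · congr 2
      funext y
      ring
    · exact (hκc.integrableOn_Icc).const_mul _
  have e2 : ∫ y in K, κ y ∂(localDefect μs ψ x)
      = ∫ y in K, κ y ∂μs + ∫ y in K, ‖ψ y - ψ x‖ * κ y := by
    have hfin2 : IsFiniteMeasure ((volume.restrict K).withDensity (fun y => ‖ψ y - ψ x‖ₑ)) :=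
      isFiniteMeasure_of_le (localDefect μs ψ x) (Measure.le_add_left le_rfl)
    rw [localDefect, Measure.restrict_add, integral_add_measure hκc.integrableOn_Icc
      hκc.integrableOn_Icc]
    congr 1
    rw [restrict_withDensity measurableSet_Icc, Measure.restrict_restrict measurableSet_Icc,
      Set.inter_self, integral_withDensity_eq_integral_toReal_smul
      (h.measurable.sub_const _).enorm (ae_of_all _ fun _ => enorm_lt_top)]
    simp [hK]
  have e3 : |specVar μ n (tilt g n x) - ψ x * specVar volume n (tilt g n x)|
      ≤ ∫ y in K, κ y ∂(localDefect μs ψ x) := by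
    rw [e1, e2]
    refine (abs_add_le _ _).trans (add_le_add (le_of_eq (abs_of_nonneg
      (integral_nonneg hκ0))) ?_)
    refine (abs_integral_le_integral_abs).trans (le_of_eq ?_)
    refine integral_congr_ae (ae_of_all _ fun y => ?_)
    simp only [abs_mul, abs_of_nonneg (hκ0 y), Real.norm_eq_abs]
  have hkc : Continuous (fun y : ℝ => (n : ℝ) / (1 + (n * |x - y|) ^ 2)) := by
    refine Continuous.div (by fun_prop) (by fun_prop) fun y => by positivity
  have hki : Integrable (fun y : ℝ => (n : ℝ) / (1 + (n * |x - y|) ^ 2)) (localDefect μs ψ x) := by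
    refine Integrable.of_bound hkc.aestronglyMeasurable n (ae_of_all _ fun y => ?_)
    rw [Real.norm_of_nonneg (by positivity)]
    exact div_le_self hn'.le (by linarith [sq_nonneg (n * |x - y|)])
  rw [Real.dist_eq, abs_sub_comm, ← mul_div_assoc, ← sub_div, abs_div, abs_of_pos hn']
  calc _ ≤ (∫ y in K, κ y ∂(localDefect μs ψ x)) / n := by gcongr
    _ = ∫ y in K, κ y / n ∂(localDefect μs ψ x) := by rw [integral_div]
    _ ≤ ∫ y in K, C * (n / (1 + (n * |x - y|) ^ 2)) ∂(localDefect μs ψ x) := by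
        refine setIntegral_mono_on (hκc.div_const _).integrableOn_Icc
          (hki.integrableOn.const_mul C) measurableSet_Icc fun y hy => hC n x y hn ?_
        have := abs_le.2 ⟨hy.1, hy.2⟩
        linarith [abs_sub x y]
    _ ≤ ∫ y, C * (n / (1 + (n * |x - y|) ^ 2)) ∂(localDefect μs ψ x) :=
        setIntegral_le_integral (hki.const_mul C) (ae_of_all _ fun y => by
          simp only [Pi.zero_apply]; positivity)
    _ = C * ∫ y, n / (1 + (n * |x - y|) ^ 2) ∂(localDefect μs ψ x) := integral_const_mul _ _

end Decomposition

/-! ### Periodicity, logarithmic Fatou lemma and positivity of variances -/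

lemma ae_of_ae_Ioo_of_periodic {p : ℝ → Prop} (c : ℝ)
    (hp : ∀ x, p (x + 2 * Real.pi) ↔ p x)
    (h : ∀ᵐ x, x ∈ Set.Ioo c (c + 2 * Real.pi) → p x) : ∀ᵐ x, p x := by
  have hT : (0 : ℝ) < 2 * Real.pi := by positivity
  have hpz : ∀ (k : ℤ) (x : ℝ), p (x - k • (2 * Real.pi)) ↔ p x := by
    have hper : Function.Periodic p (2 * Real.pi) := fun x => propext (hp x)
    intro k x
    rw [hper.sub_zsmul_eq k]
  have h1 : ∀ᵐ x : ℝ, ∀ k : ℤ, x - k • (2 * Real.pi) ∈ Set.Ioo c (c + 2 * Real.pi) →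
      p (x - k • (2 * Real.pi)) := by
    rw [ae_all_iff]
    intro k
    exact (measurePreserving_sub_right volume (k • (2 * Real.pi))).quasiMeasurePreserving.ae h
  have h2 : ∀ᵐ x : ℝ, ∀ k : ℤ, x - k • (2 * Real.pi) ≠ c := by
    rw [ae_all_iff]
    intro k
    have : ∀ᵐ x : ℝ, x ≠ c + k • (2 * Real.pi) := by simp [ae_iff]
    filter_upwards [this] with x hx h
    exact hx (by linarith)
  filter_upwards [h1, h2] with x hx1 hx2
  have hm := sub_toIcoDiv_zsmul_mem_Ico hT c x
  exact (hpz _ x).1 (hx1 _ ⟨lt_of_le_of_ne hm.1 (hx2 _).symm, hm.2⟩)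

lemma tilt_add_two_pi (g : ℝ → ℂ) (n : ℕ) (x : ℝ) : tilt g n (x + 2 * Real.pi) = tilt g n x := by
  funext j
  rw [tilt, tilt]
  congr 1
  rw [Complex.exp_eq_exp_iff_exists_int]
  exact ⟨(j + 1 : ℕ), by push_cast; ring⟩

section LogPsi

variable {ψ : ℝ → ℝ}

lemma LogMemLp.ae_pos {p : ℝ} (hlog : LogMemLp ψ p)
    (hper : Function.Periodic ψ (2 * Real.pi)) : ∀ᵐ x, 0 < ψ x := by
  refine ae_of_ae_Ioo_of_periodic 0 (fun x => by rw [hper]) ?_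
  have := (ae_restrict_iff' measurableSet_Icc).1 hlog.1
  filter_upwards [this] with x hx hxI
  rw [zero_add] at hxI
  exact hx (Set.Ioo_subset_Icc_self hxI)

lemma LogMemLp.integrableOn {η : ℝ} (hη : 0 < η) (hlog : LogMemLp ψ (1 + η))
    (hper : Function.Periodic ψ (2 * Real.pi)) :
    IntegrableOn (fun x => Real.log (ψ x)) (Set.Icc (-Real.pi) Real.pi) := by
  have h1 : IntegrableOn (fun x => Real.log (ψ x)) (Set.Icc 0 (2 * Real.pi)) := by
    refine hlog.2.integrable ?_
    rw [← ENNReal.ofReal_one]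
    exact ENNReal.ofReal_le_ofReal (by linarith)
  have hper' : Function.Periodic (fun x => Real.log (ψ x)) (2 * Real.pi) := by
    intro x; simp only [hper x]
  have h2 : IntervalIntegrable (fun x => Real.log (ψ x)) volume 0 (2 * Real.pi) :=
    (intervalIntegrable_iff_integrableOn_Icc_of_le (by positivity)).2 h1
  exact (intervalIntegrable_iff_integrableOn_Icc_of_le (by linarith [Real.pi_pos])).1
    (hper'.intervalIntegrable₀ (by positivity) h2 _ _)

end LogPsi

/-- A Fatou-type upper bound for integrals of logarithms of functions bounded in `L²`. The bound in
`L²` makes `δ s_n² - log s_n` a family bounded below whose integrals differ little from those of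
`-log s_n`. -/
lemma eventually_integral_log_le {α : Type*} [MeasurableSpace α] {ν : Measure α} [IsFiniteMeasure ν]
    (hν : 0 < ν.real Set.univ) {s : ℕ → α → ℝ} {s' : α → ℝ} {C : ℝ}
    (hpos : ∀ᶠ n in atTop, ∀ x, 0 < s n x) (hpos' : ∀ᵐ x ∂ν, 0 < s' x)
    (hmeas : ∀ n, Measurable (s n))
    (hlog : ∀ᶠ n in atTop, Integrable (fun x => Real.log (s n x)) ν)
    (hlog' : Integrable (fun x => Real.log (s' x)) ν)
    (hsq : ∀ᶠ n in atTop, Integrable (fun x => s n x ^ 2) ν)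
    (hC : ∀ᶠ n in atTop, ∫ x, s n x ^ 2 ∂ν ≤ C)
    (hlim : ∀ᵐ x ∂ν, Tendsto (fun n => s n x) atTop (𝓝 (s' x))) {e : ℝ} (he : 0 < e) :
    ∀ᶠ n in atTop, ∫ x, Real.log (s n x) ∂ν ≤ ∫ x, Real.log (s' x) ∂ν + e := by
  by_contra hcon
  rw [not_eventually] at hcon
  obtain ⟨n0, hC0⟩ : ∃ n, 0 ≤ C := by
    obtain ⟨n, hn⟩ := hC.exists
    exact ⟨n, (integral_nonneg fun x => sq_nonneg _).trans hn⟩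
  set δ : ℝ := e / (C + 1) / 2 with hδdef
  have hδ : 0 < δ := by positivity
  have hδC : δ * C < e := by
    have : δ * C ≤ e / 2 := by
      rw [hδdef, div_right_comm, div_mul_eq_mul_div, div_le_iff₀ (by positivity)]
      nlinarith
    linarith
  -- `δ t² + c - log t ≥ 0` is what Fatou's lemma is applied to; `c` is enlarged so that the final
  -- comparison of two values of `ENNReal.ofReal` does not degenerate to `0 ≤ 0`
  obtain ⟨c, hc1, hc2⟩ : ∃ c : ℝ, (∀ t > 0, Real.log t ≤ δ * t ^ 2 + c) ∧
      0 < c * ν.real Set.univ - ∫ x, Real.log (s' x) ∂ν := by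
    refine ⟨|-(Real.log δ) / 2| + (|∫ x, Real.log (s' x) ∂ν| + 1) / ν.real Set.univ,
      fun t ht => ?_, ?_⟩
    · have h1 := Real.log_le_sub_one_of_pos (show 0 < δ * t ^ 2 by positivity)
      rw [Real.log_mul hδ.ne' (by positivity), Real.log_pow] at h1
      have h2 := le_abs_self (-(Real.log δ) / 2)
      have h3 : 0 ≤ (|∫ x, Real.log (s' x) ∂ν| + 1) / ν.real Set.univ := by positivity
      push_cast at h1
      nlinarith [sq_nonneg t]
    · rw [add_mul, div_mul_cancel₀ _ hν.ne']
      have h2 := le_abs_self (∫ x, Real.log (s' x) ∂ν)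
      have h3 : 0 ≤ |-(Real.log δ) / 2| * ν.real Set.univ := by positivity
      linarith
  have hfatou : ∫⁻ x, ENNReal.ofReal (δ * s' x ^ 2 + c - Real.log (s' x)) ∂ν
      ≤ liminf (fun n => ∫⁻ x, ENNReal.ofReal (δ * s n x ^ 2 + c - Real.log (s n x)) ∂ν)
        atTop := by
    refine le_trans (lintegral_mono_ae ?_) (lintegral_liminf_le fun n => ?_)
    · filter_upwards [hpos', hlim] with x hx hxl
      refine le_of_eq (Tendsto.liminf_eq ?_).symm
      refine ENNReal.tendsto_ofReal ?_
      exact (((hxl.pow 2).const_mul δ).add_const c).sub (hxl.log hx.ne')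
    · exact ((((hmeas n).pow_const 2).const_mul δ).add_const c |>.sub
        (hmeas n).log).ennreal_ofReal
  have hlow : ENNReal.ofReal (c * ν.real Set.univ - ∫ x, Real.log (s' x) ∂ν)
      ≤ ∫⁻ x, ENNReal.ofReal (δ * s' x ^ 2 + c - Real.log (s' x)) ∂ν := by
    have h1 : c * ν.real Set.univ - ∫ x, Real.log (s' x) ∂ν
        = ∫ x, (c - Real.log (s' x)) ∂ν := by
      rw [integral_sub (integrable_const _) hlog', integral_const, smul_eq_mul, mul_comm]
    rw [h1]
    have h2 : Integrable (fun x => c - Real.log (s' x)) ν := (integrable_const _).sub hlog'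
    have h3 : ENNReal.ofReal (∫ x, (c - Real.log (s' x)) ∂ν)
        ≤ ∫⁻ x, ENNReal.ofReal (c - Real.log (s' x)) ∂ν := by
      refine ENNReal.ofReal_le_of_le_toReal ?_
      rw [integral_eq_lintegral_pos_part_sub_lintegral_neg_part h2]
      exact sub_le_self _ ENNReal.toReal_nonneg
    refine h3.trans (lintegral_mono fun x => ?_)
    exact ENNReal.ofReal_le_ofReal (by nlinarith [sq_nonneg (s' x)])
  have hup : liminf (fun n => ∫⁻ x, ENNReal.ofReal (δ * s n x ^ 2 + c - Real.log (s n x)) ∂ν) atTop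
      ≤ ENNReal.ofReal (c * ν.real Set.univ - ∫ x, Real.log (s' x) ∂ν - (e - δ * C)) := by
    refine liminf_le_of_frequently_le' ?_
    refine (hcon.and_eventually (hpos.and (hlog.and (hsq.and hC)))).mono ?_
    rintro n ⟨h1, h2, h3, h4, h5⟩
    have hi : Integrable (fun x => δ * s n x ^ 2 + c) ν := (h4.const_mul δ).add (integrable_const c)
    have hi2 : Integrable (fun x => δ * s n x ^ 2 + c - Real.log (s n x)) ν := hi.sub h3
    rw [← ofReal_integral_eq_lintegral_ofReal hi2 (ae_of_all _ fun x => by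
      have := hc1 _ (h2 x)
      simp only [Pi.zero_apply]; linarith)]
    refine ENNReal.ofReal_le_ofReal ?_
    rw [integral_sub hi h3, integral_add (h4.const_mul δ) (integrable_const c),
      integral_const_mul, integral_const, smul_eq_mul]
    rw [not_le] at h1
    have := mul_le_mul_of_nonneg_left h5 hδ.le
    linarith
  have := (ENNReal.ofReal_le_ofReal_iff' ).1 (hlow.trans (hfatou.trans hup))
  rcases this with h | h <;> linarith

section Spectral

variable {ρ : ℤ → ℝ} {μ μs : Measure ℝ} {ψ : ℝ → ℝ}

lemma continuous_specVar_tilt (hμ : IsSpectralMeasure ρ μ) (g : ℝ → ℂ) (n : ℕ) :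
    Continuous (fun x => specVar μ n (tilt g n x)) := by
  have := hμ.isProbabilityMeasure
  have htc : ∀ j, Continuous (fun x => tilt g n x j) := by
    intro j; unfold tilt; fun_prop
  simp only [specVar_eq_sum hμ.fourier]
  refine continuous_finsetSum _ fun j _ => continuous_finsetSum _ fun l _ => ?_
  have h1 := Complex.continuous_re.comp (htc j)
  have h2 := Complex.continuous_re.comp (htc l)
  have h3 := Complex.continuous_im.comp (htc j)
  have h4 := Complex.continuous_im.comp (htc l)
  exact continuous_const.mul ((h1.mul h2).add (h3.mul h4))

lemma IsLebesgueDecomposition.integrableOn_mul (h : IsLebesgueDecomposition μ μs ψ)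
    [IsFiniteMeasure μ] {f : ℝ → ℝ} (hf : Continuous f) :
    IntegrableOn (fun y => ψ y * f y) (Set.Icc (-Real.pi) Real.pi) := by
  obtain ⟨B, hB⟩ := isCompact_Icc.exists_bound_of_continuousOn
    (hf.continuousOn (s := Set.Icc (-Real.pi) Real.pi))
  exact Integrable.mul_bdd (c := B) h.integrableOn hf.aestronglyMeasurable
    ((ae_restrict_iff' measurableSet_Icc).2 (ae_of_all _ hB))

lemma IsLebesgueDecomposition.integral_mul_le_specVar (h : IsLebesgueDecomposition μ μs ψ)
    [IsFiniteMeasure μ] (n : ℕ) (w : ℕ → ℂ) :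
    ∫ y in Set.Icc (-Real.pi) Real.pi, ψ y * ‖specSum n w y‖ ^ 2 ≤ specVar μ n w := by
  have hcont : Continuous (fun y => ‖specSum n w y‖ ^ 2) := (continuous_specSum n w).norm.pow 2
  rw [specVar, h.setIntegral_eq hcont]
  have : 0 ≤ ∫ y in Set.Icc (-Real.pi) Real.pi, ‖specSum n w y‖ ^ 2 ∂μs :=
    integral_nonneg fun _ => by positivity
  linarith

lemma IsLebesgueDecomposition.integral_mul_specSum_pos (h : IsLebesgueDecomposition μ μs ψ)
    [IsFiniteMeasure μ] (hψ : ∀ᵐ x, 0 < ψ x) {n : ℕ} {w : ℕ → ℂ} (hw : ∃ j < n, w j ≠ 0) :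
    0 < ∫ y in Set.Icc (-Real.pi) Real.pi, ψ y * ‖specSum n w y‖ ^ 2 := by
  have hcont : Continuous (fun y => ‖specSum n w y‖ ^ 2) := (continuous_specSum n w).norm.pow 2
  have h0 : ∀ y, 0 ≤ ψ y * ‖specSum n w y‖ ^ 2 := fun y => mul_nonneg (h.nonneg y) (by positivity)
  refine lt_of_le_of_ne (integral_nonneg h0) fun heq => ?_
  have h1 := (integral_eq_zero_iff_of_nonneg h0 (h.integrableOn_mul hcont)).1 heq.symm
  have h2 : specVar volume n w = 0 := by
    rw [specVar]
    refine integral_eq_zero_of_ae ?_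
    filter_upwards [h1, ae_restrict_of_ae hψ] with y hy hy'
    exact (mul_eq_zero.1 hy).resolve_left hy'.ne'
  rw [specVar_volume] at h2
  obtain ⟨j, hj, hwj⟩ := hw
  have h3 : 0 < ∑ j ∈ Finset.range n, ‖w j‖ ^ 2 :=
    Finset.sum_pos' (fun _ _ => by positivity) ⟨j, Finset.mem_range.2 hj, by positivity⟩
  have := Real.pi_pos
  nlinarith [mul_pos this h3]

/-- A linear form with nonzero weights is nondegenerate: the density is positive almost everywhere
and a nonzero trigonometric polynomial vanishes only on a null set. -/
lemma IsLebesgueDecomposition.specVar_pos (h : IsLebesgueDecomposition μ μs ψ)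
    [IsFiniteMeasure μ] (hψ : ∀ᵐ x, 0 < ψ x) {n : ℕ} {w : ℕ → ℂ} (hw : ∃ j < n, w j ≠ 0) :
    0 < specVar μ n w :=
  (h.integral_mul_specSum_pos hψ hw).trans_le (h.integral_mul_le_specVar n w)

lemma tilt_ne_zero {g : ℝ → ℂ} (hg : ∀ t ∈ Set.Icc (0 : ℝ) 1, g t ≠ 0) {n : ℕ} (hn : 0 < n)
    (x : ℝ) : ∃ j < n, tilt g n x j ≠ 0 :=
  ⟨0, hn, mul_ne_zero (hg _ (tilt_mem_Icc hn)) (Complex.exp_ne_zero _)⟩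

/-- The evaluation point `x` and the frequency `y` play symmetric roles. -/
lemma norm_specSum_tilt_swap (g : ℝ → ℂ) (n : ℕ) (x y : ℝ) :
    ‖specSum n (tilt g n x) y‖ = ‖specSum n (tilt (fun t => starRingEnd ℂ (g t)) n y) x‖ := by
  rw [← Complex.norm_conj (specSum n (tilt g n x) y)]
  congr 1
  rw [specSum, specSum, map_sum]
  refine Finset.sum_congr rfl fun j _ => ?_
  simp only [tilt, map_mul, ← Complex.exp_conj, Complex.conj_I, Complex.conj_ofReal, map_natCast,
    map_neg, neg_neg]
  rw [mul_assoc, ← Complex.exp_add, mul_assoc (starRingEnd ℂ (g _)), ← Complex.exp_add]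
  congr 2
  ring

lemma setIntegral_specSum_tilt_sq (g : ℝ → ℂ) (n : ℕ) (y : ℝ) :
    ∫ x in Set.Icc (-Real.pi) Real.pi, ‖specSum n (tilt g n x) y‖ ^ 2
      = 2 * Real.pi * ∑ j ∈ Finset.range n, ‖g ((j + 1 : ℕ) / n)‖ ^ 2 := by
  simp only [norm_specSum_tilt_swap g n _ y]
  have := specVar_volume n (tilt (fun t => starRingEnd ℂ (g t)) n y)
  simp only [norm_tilt, Complex.norm_conj] at this
  exact this

lemma continuous_specSum_tilt (g : ℝ → ℂ) (n : ℕ) :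
    Continuous (fun p : ℝ × ℝ => ‖specSum n (tilt g n p.1) p.2‖ ^ 2) := by
  unfold specSum tilt; fun_prop

lemma integrable_prod_specSum_tilt (g : ℝ → ℂ) (n : ℕ) (ν₁ ν₂ : Measure ℝ) [IsFiniteMeasure ν₁]
    [IsFiniteMeasure ν₂] :
    Integrable (fun p : ℝ × ℝ => ‖specSum n (tilt g n p.1) p.2‖ ^ 2) (ν₁.prod ν₂) := by
  refine Integrable.of_bound (continuous_specSum_tilt g n).aestronglyMeasurable
    ((∑ j ∈ Finset.range n, ‖g ((j + 1 : ℕ) / n)‖) ^ 2) (ae_of_all _ fun p => ?_)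
  rw [Real.norm_of_nonneg (by positivity)]
  refine pow_le_pow_left₀ (norm_nonneg _) ?_ 2
  rw [specSum_tilt]
  refine norm_sum_le_of_le _ fun j _ => ?_
  rw [norm_mul, norm_pow, Complex.norm_exp_ofReal_mul_I, one_pow, mul_one]

lemma setIntegral_specVar_tilt (hμ : IsSpectralMeasure ρ μ) (g : ℝ → ℂ) (n : ℕ) :
    ∫ x in Set.Icc (-Real.pi) Real.pi, specVar μ n (tilt g n x)
      = 2 * Real.pi * ∑ j ∈ Finset.range n, ‖g ((j + 1 : ℕ) / n)‖ ^ 2 := by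
  have := hμ.isProbabilityMeasure
  have hI : μ.restrict (Set.Icc (-Real.pi) Real.pi) = μ :=
    Measure.restrict_eq_self_of_ae_mem (by rw [ae_iff]; exact hμ.carried)
  simp only [specVar, hI]
  rw [integral_integral_swap (f := fun x y => ‖specSum n (tilt g n x) y‖ ^ 2)
    (integrable_prod_specSum_tilt g n _ μ)]
  simp only [setIntegral_specSum_tilt_sq]
  simp

end Spectral

/-! ### The integral of the logarithm of a ratio of variances -/

section Spectral

variable {ρ : ℤ → ℝ} {μ μs : Measure ℝ} {ψ : ℝ → ℝ}

/-- Jensen's inequality for the logarithm and the Fejér-type probability kernel, through the tangent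
line of the logarithm at the mean. -/
lemma IsLebesgueDecomposition.integral_kernel_mul_log_le (h : IsLebesgueDecomposition μ μs ψ)
    [IsFiniteMeasure μ] (hψ : ∀ᵐ x, 0 < ψ x)
    (hlog : IntegrableOn (fun x => Real.log (ψ x)) (Set.Icc (-Real.pi) Real.pi))
    {n : ℕ} (hn : 0 < n) (x : ℝ) :
    ∫ y in Set.Icc (-Real.pi) Real.pi, ‖specSum n (tilt (fun _ => 1) n x) y‖ ^ 2 * Real.log (ψ y)
      ≤ 2 * Real.pi * n * Real.log (specVar μ n (tilt (fun _ => 1) n x) / (2 * Real.pi * n)) := by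
  set κ : ℝ → ℝ := fun y => ‖specSum n (tilt (fun _ => 1) n x) y‖ ^ 2 with hκ
  have hκc : Continuous κ := (continuous_specSum _ _).norm.pow 2
  have hκ0 : ∀ y, 0 ≤ κ y := fun y => by positivity
  have hw : ∃ j < n, tilt (fun _ => 1) n x j ≠ 0 := tilt_ne_zero (fun _ _ => one_ne_zero) hn x
  have hN : (0 : ℝ) < 2 * Real.pi * n := by
    have : (0 : ℝ) < n := by exact_mod_cast hn
    positivity
  have hmass : ∫ y in Set.Icc (-Real.pi) Real.pi, κ y = 2 * Real.pi * n := by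
    have := specVar_volume n (tilt (fun _ => 1) n x)
    simp only [norm_tilt, norm_one, one_pow, Finset.sum_const, Finset.card_range, nsmul_eq_mul,
      mul_one] at this
    exact this
  set I := ∫ y in Set.Icc (-Real.pi) Real.pi, ψ y * κ y with hI
  have hIpos : 0 < I := h.integral_mul_specSum_pos hψ hw
  have hIle : I ≤ specVar μ n (tilt (fun _ => 1) n x) := h.integral_mul_le_specVar n _
  set m := I / (2 * Real.pi * n) with hm
  have hmpos : 0 < m := div_pos hIpos hN
  obtain ⟨B, hB⟩ := isCompact_Icc.exists_bound_of_continuousOn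
    (hκc.continuousOn (s := Set.Icc (-Real.pi) Real.pi))
  have hB' : ∀ᵐ y ∂(volume.restrict (Set.Icc (-Real.pi) Real.pi)), ‖κ y‖ ≤ B :=
    (ae_restrict_iff' measurableSet_Icc).2 (ae_of_all _ hB)
  have hi1 : IntegrableOn (fun y => κ y * Real.log (ψ y)) (Set.Icc (-Real.pi) Real.pi) :=
    Integrable.bdd_mul (c := B) hlog hκc.aestronglyMeasurable hB'
  have hi2 : IntegrableOn (fun y => ψ y * κ y) (Set.Icc (-Real.pi) Real.pi) :=
    h.integrableOn_mul hκc
  have hi3 : IntegrableOn κ (Set.Icc (-Real.pi) Real.pi) := hκc.integrableOn_Icc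
  calc _ ≤ ∫ y in Set.Icc (-Real.pi) Real.pi, ((Real.log m - 1) * κ y + m⁻¹ * (ψ y * κ y)) := by
        refine integral_mono_ae hi1 ((hi3.const_mul _).add (hi2.const_mul _)) ?_
        filter_upwards [ae_restrict_of_ae hψ] with y hy
        have h1 := Real.log_le_sub_one_of_pos (div_pos hy hmpos)
        rw [Real.log_div hy.ne' hmpos.ne'] at h1
        have h2 := mul_le_mul_of_nonneg_left h1 (hκ0 y)
        have h3 : κ y * (ψ y / m) = m⁻¹ * (ψ y * κ y) := by
          rw [div_eq_mul_inv]; ring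
        simp only [hκ] at h2 h3 ⊢
        linarith
    _ = 2 * Real.pi * n * Real.log m := by
        rw [integral_add (hi3.const_mul _) (hi2.const_mul _), integral_const_mul,
          integral_const_mul, hmass, ← hI]
        have : m⁻¹ * I = 2 * Real.pi * n := by
          rw [hm]; field_simp
        rw [this]; ring
    _ ≤ _ := by
        refine mul_le_mul_of_nonneg_left (Real.log_le_log hmpos ?_) hN.le
        rw [hm]
        gcongr

/-- The integral of the logarithm of the variance is bounded below by its limit value: this replaces
any uniform integrability of the negative part of the logarithm. -/
lemma IsLebesgueDecomposition.integral_log_le_integral_log_specVar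
    (h : IsLebesgueDecomposition μ μs ψ) (hμ : IsSpectralMeasure ρ μ) (hψ : ∀ᵐ x, 0 < ψ x)
    (hlog : IntegrableOn (fun x => Real.log (ψ x)) (Set.Icc (-Real.pi) Real.pi))
    {n : ℕ} (hn : 0 < n) :
    ∫ y in Set.Icc (-Real.pi) Real.pi, Real.log (ψ y)
      ≤ ∫ x in Set.Icc (-Real.pi) Real.pi,
        Real.log (specVar μ n (tilt (fun _ => 1) n x) / (2 * Real.pi * n)) := by
  have := hμ.isProbabilityMeasure
  have hN : (0 : ℝ) < 2 * Real.pi * n := by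
    have : (0 : ℝ) < n := by exact_mod_cast hn
    positivity
  have hpos : ∀ x, 0 < specVar μ n (tilt (fun _ => 1) n x) := fun x =>
    h.specVar_pos hψ (tilt_ne_zero (fun _ _ => one_ne_zero) hn x)
  have hcont : Continuous (fun x =>
      Real.log (specVar μ n (tilt (fun _ => 1) n x) / (2 * Real.pi * n))) :=
    ((continuous_specVar_tilt hμ _ n).div_const _).log fun x => (div_pos (hpos x) hN).ne'
  set ν := (volume : Measure ℝ).restrict (Set.Icc (-Real.pi) Real.pi) with hν
  have hprod : Integrable (fun p : ℝ × ℝ =>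
      ‖specSum n (tilt (fun _ => 1) n p.1) p.2‖ ^ 2 * Real.log (ψ p.2)) (ν.prod ν) := by
    have h1 : Integrable (fun p : ℝ × ℝ => Real.log (ψ p.2)) (ν.prod ν) := hlog.comp_snd ν
    refine Integrable.bdd_mul (c := (n : ℝ) ^ 2) h1
      (continuous_specSum_tilt _ n).aestronglyMeasurable (ae_of_all _ fun p => ?_)
    rw [Real.norm_of_nonneg (by positivity)]
    refine pow_le_pow_left₀ (norm_nonneg _) ?_ 2
    have := norm_specSum_tilt_le (g := fun _ => 1) (M := 1) (fun t _ => by simp) n p.1 p.2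
    simpa using this
  have hswap : ∫ x, ∫ y, ‖specSum n (tilt (fun _ => 1) n x) y‖ ^ 2 * Real.log (ψ y) ∂ν ∂ν
      = 2 * Real.pi * n * ∫ y, Real.log (ψ y) ∂ν := by
    rw [integral_integral_swap (f := fun x y =>
      ‖specSum n (tilt (fun _ => 1) n x) y‖ ^ 2 * Real.log (ψ y)) hprod, ← integral_const_mul]
    refine integral_congr_ae (ae_of_all _ fun y => ?_)
    simp only
    rw [integral_mul_const, setIntegral_specSum_tilt_sq]
    simp
  have hle : ∫ x, ∫ y, ‖specSum n (tilt (fun _ => 1) n x) y‖ ^ 2 * Real.log (ψ y) ∂ν ∂ν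
      ≤ ∫ x, 2 * Real.pi * n
        * Real.log (specVar μ n (tilt (fun _ => 1) n x) / (2 * Real.pi * n)) ∂ν :=
    integral_mono hprod.integral_prod_left ((hcont.integrableOn_Icc).const_mul _)
      fun x => h.integral_kernel_mul_log_le hψ hlog hn x
  rw [hswap, integral_const_mul] at hle
  exact le_of_mul_le_mul_left hle hN

/-- The excess of the logarithm of the standard deviations of the tilted forms over that of the
untilted one has asymptotically at most the mean predicted by the pointwise limits. -/
theorem IsLebesgueDecomposition.eventually_integral_log_sub_le
    (h : IsLebesgueDecomposition μ μs ψ) (hμ : IsSpectralMeasure ρ μ) (hψ : ∀ᵐ x, 0 < ψ x)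
    (hlog : IntegrableOn (fun x => Real.log (ψ x)) (Set.Icc (-Real.pi) Real.pi))
    {g₁ g₂ : ℝ → ℂ} {L₁ L₂ : NNReal} (hg₁ : LipschitzOnWith L₁ g₁ (Set.Icc 0 1))
    (hg₂ : LipschitzOnWith L₂ g₂ (Set.Icc 0 1)) (hne : ∀ t ∈ Set.Icc (0 : ℝ) 1, g₁ t ≠ 0)
    (hA : 0 < ∫ t in (0 : ℝ)..1, ‖g₁ t‖ ^ 2) {e : ℝ} (he : 0 < e) :
    ∀ᶠ n : ℕ in atTop, ∫ x in Set.Icc (-Real.pi) Real.pi,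
      (Real.log (Real.sqrt (specVar μ n (tilt g₁ n x)) + Real.sqrt (specVar μ n (tilt g₂ n x)))
        - Real.log (Real.sqrt (specVar μ n (tilt (fun _ => 1) n x))))
      ≤ 2 * Real.pi * Real.log (Real.sqrt (∫ t in (0 : ℝ)..1, ‖g₁ t‖ ^ 2)
        + Real.sqrt (∫ t in (0 : ℝ)..1, ‖g₂ t‖ ^ 2)) + e := by
  have := hμ.isProbabilityMeasure
  have hπ := Real.pi_pos
  set A := ∫ t in (0 : ℝ)..1, ‖g₁ t‖ ^ 2 with hAdef
  set B := ∫ t in (0 : ℝ)..1, ‖g₂ t‖ ^ 2 with hBdef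
  set D := Real.sqrt A + Real.sqrt B with hD
  have hDpos : 0 < D := add_pos_of_pos_of_nonneg (Real.sqrt_pos.2 hA) (Real.sqrt_nonneg _)
  set ν := (volume : Measure ℝ).restrict (Set.Icc (-Real.pi) Real.pi) with hν
  have hνu : ν.real Set.univ = 2 * Real.pi := by
    rw [hν, measureReal_restrict_apply_univ, Real.volume_real_Icc_of_le (by linarith)]; ring
  obtain ⟨M₁, hM₁⟩ := isCompact_Icc.exists_bound_of_continuousOn hg₁.continuousOn
  obtain ⟨M₂, hM₂⟩ := isCompact_Icc.exists_bound_of_continuousOn hg₂.continuousOn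
  -- the logarithm of `s n` is treated from above by Fatou's lemma, that of `v n` from below by
  -- Jensen's inequality
  let U : ℕ → ℝ → ℝ := fun n x => specVar μ n (tilt g₁ n x)
  let V : ℕ → ℝ → ℝ := fun n x => specVar μ n (tilt g₂ n x)
  let v : ℕ → ℝ → ℝ := fun n x => specVar μ n (tilt (fun _ => 1) n x)
  let s : ℕ → ℝ → ℝ := fun n x => Real.sqrt (U n x / n) + Real.sqrt (V n x / n)
  have hUc : ∀ n, Continuous (U n) := fun n => continuous_specVar_tilt hμ g₁ n
  have hVc : ∀ n, Continuous (V n) := fun n => continuous_specVar_tilt hμ g₂ n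
  have hvc : ∀ n, Continuous (v n) := fun n => continuous_specVar_tilt hμ _ n
  have hUpos : ∀ n : ℕ, 0 < n → ∀ x, 0 < U n x := fun n hn x =>
    h.specVar_pos hψ (tilt_ne_zero hne hn x)
  have hvpos : ∀ n : ℕ, 0 < n → ∀ x, 0 < v n x := fun n hn x =>
    h.specVar_pos hψ (tilt_ne_zero (fun _ _ => one_ne_zero) hn x)
  have hV0 : ∀ n x, 0 ≤ V n x := fun n x => specVar_nonneg _ _ _
  have hsc : ∀ n, Continuous (s n) := fun n =>
    ((hUc n).div_const _).sqrt.add ((hVc n).div_const _).sqrt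
  have hspos : ∀ n : ℕ, 0 < n → ∀ x, 0 < s n x := fun n hn x =>
    add_pos_of_pos_of_nonneg
      (Real.sqrt_pos.2 (div_pos (hUpos n hn x) (by exact_mod_cast hn))) (Real.sqrt_nonneg _)
  have hslog : ∀ n : ℕ, 0 < n → Integrable (fun x => Real.log (s n x)) ν := fun n hn =>
    ((hsc n).log fun x => (hspos n hn x).ne').integrableOn_Icc
  have hbound : ∀ (g : ℝ → ℂ) (M : ℝ), (∀ t ∈ Set.Icc (0 : ℝ) 1, ‖g t‖ ≤ M) → ∀ n : ℕ, 0 < n →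
      ∫ x, specVar μ n (tilt g n x) / n ∂ν ≤ 2 * Real.pi * M ^ 2 := by
    intro g M hM n hn
    have hn' : (0 : ℝ) < n := by exact_mod_cast hn
    rw [integral_div, setIntegral_specVar_tilt hμ, mul_div_assoc]
    refine mul_le_mul_of_nonneg_left ?_ (by positivity)
    rw [div_le_iff₀ hn']
    calc _ ≤ ∑ j ∈ Finset.range n, M ^ 2 := Finset.sum_le_sum fun j hj =>
          pow_le_pow_left₀ (norm_nonneg _) (hM _ (tilt_mem_Icc (Finset.mem_range.1 hj))) 2
      _ = M ^ 2 * n := by simp [mul_comm]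
  have hsC : ∀ n : ℕ, 0 < n → ∫ x, s n x ^ 2 ∂ν
      ≤ 2 * (2 * Real.pi * M₁ ^ 2 + 2 * Real.pi * M₂ ^ 2) := by
    intro n hn
    have hn' : (0 : ℝ) < n := by exact_mod_cast hn
    have i1 : Integrable (fun x => U n x / n) ν := ((hUc n).div_const _).integrableOn_Icc
    have i2 : Integrable (fun x => V n x / n) ν := ((hVc n).div_const _).integrableOn_Icc
    calc ∫ x, s n x ^ 2 ∂ν ≤ ∫ x, 2 * (U n x / n + V n x / n) ∂ν := by
          refine integral_mono ((hsc n).pow 2).integrableOn_Icc ((i1.add i2).const_mul 2)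
            fun x => ?_
          have e1 := Real.sq_sqrt (div_nonneg (hUpos n hn x).le hn'.le)
          have e2 := Real.sq_sqrt (div_nonneg (hV0 n x) hn'.le)
          simp only [s]
          nlinarith [sq_nonneg (Real.sqrt (U n x / n) - Real.sqrt (V n x / n))]
      _ = 2 * (∫ x, U n x / n ∂ν + ∫ x, V n x / n ∂ν) := by
          rw [integral_const_mul, integral_add i1 i2]
      _ ≤ _ := by
          have b1 := hbound g₁ M₁ hM₁ n hn
          have b2 := hbound g₂ M₂ hM₂ n hn
          linarith
  have hlim : ∀ᵐ x ∂ν, Tendsto (fun n => s n x) atTop (𝓝 (Real.sqrt (2 * Real.pi * ψ x) * D)) := by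
    have hIoo : ∀ᵐ x, x ∈ Set.Icc (-Real.pi) Real.pi → x ∈ Set.Ioo (-Real.pi) Real.pi := by
      have h1 : ∀ᵐ x : ℝ, x ≠ -Real.pi := by simp [ae_iff]
      have h2 : ∀ᵐ x : ℝ, x ≠ Real.pi := by simp [ae_iff]
      filter_upwards [h1, h2] with x hx1 hx2 hx
      exact ⟨lt_of_le_of_ne hx.1 hx1.symm, lt_of_le_of_ne hx.2 hx2⟩
    rw [hν, ae_restrict_iff' measurableSet_Icc]
    filter_upwards [h.ae_tendsto_specVar, hIoo] with x hx hxI hxK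
    have l1 := (hx (hxI hxK) g₁ L₁ hg₁).sqrt
    have l2 := (hx (hxI hxK) g₂ L₂ hg₂).sqrt
    have hψ0 : 0 ≤ 2 * Real.pi * ψ x := mul_nonneg (by positivity) (h.nonneg x)
    rw [Real.sqrt_mul hψ0] at l1 l2
    have := l1.add l2
    rwa [← mul_add] at this
  have hlim_log : ∀ᵐ x ∂ν, Real.log (Real.sqrt (2 * Real.pi * ψ x) * D)
      = (1 / 2) * Real.log (ψ x) + ((1 / 2) * Real.log (2 * Real.pi) + Real.log D) := by
    filter_upwards [ae_restrict_of_ae hψ] with x hx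
    have : 0 < 2 * Real.pi * ψ x := by positivity
    rw [Real.log_mul (Real.sqrt_pos.2 this).ne' hDpos.ne', Real.log_sqrt this.le,
      Real.log_mul (by positivity) hx.ne']
    ring
  have hlimi : Integrable (fun x => Real.log (Real.sqrt (2 * Real.pi * ψ x) * D)) ν := by
    have : Integrable (fun x => (1 / 2) * Real.log (ψ x)
        + ((1 / 2) * Real.log (2 * Real.pi) + Real.log D)) ν :=
      (hlog.const_mul _).add (integrable_const _)
    exact this.congr (by filter_upwards [hlim_log] with x hx using hx.symm)
  have hmain := eventually_integral_log_le (ν := ν) (by rw [hνu]; positivity) (s := s)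
    (s' := fun x => Real.sqrt (2 * Real.pi * ψ x) * D)
    (by filter_upwards [eventually_gt_atTop 0] with n hn using hspos n hn)
    (by filter_upwards [ae_restrict_of_ae hψ] with x hx
        exact mul_pos (Real.sqrt_pos.2 (by positivity)) hDpos)
    (fun n => (hsc n).measurable)
    (by filter_upwards [eventually_gt_atTop 0] with n hn using hslog n hn) hlimi
    (Eventually.of_forall fun n => ((hsc n).pow 2).integrableOn_Icc)
    (by filter_upwards [eventually_gt_atTop 0] with n hn using hsC n hn) hlim he
  filter_upwards [hmain, eventually_gt_atTop 0] with n hn hn0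
  have hn' : (0 : ℝ) < n := by exact_mod_cast hn0
  have hN : (0 : ℝ) < 2 * Real.pi * n := by positivity
  have hvi : Integrable (fun x => Real.log (v n x / (2 * Real.pi * n))) ν :=
    (((hvc n).div_const _).log fun x => (div_pos (hvpos n hn0 x) hN).ne').integrableOn_Icc
  have hJ := h.integral_log_le_integral_log_specVar hμ hψ hlog hn0
  have hpt : ∀ x, Real.log (Real.sqrt (U n x) + Real.sqrt (V n x)) - Real.log (Real.sqrt (v n x))
      = Real.log (s n x)
        - ((1 / 2) * Real.log (v n x / (2 * Real.pi * n)) + (1 / 2) * Real.log (2 * Real.pi)) := by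
    intro x
    have e1 : s n x = (Real.sqrt (U n x) + Real.sqrt (V n x)) / Real.sqrt n := by
      simp only [s]
      rw [Real.sqrt_div (hUpos n hn0 x).le, Real.sqrt_div (hV0 n x), add_div]
    have e2 : 0 < Real.sqrt (U n x) + Real.sqrt (V n x) :=
      add_pos_of_pos_of_nonneg (Real.sqrt_pos.2 (hUpos n hn0 x)) (Real.sqrt_nonneg _)
    rw [e1, Real.log_div e2.ne' (Real.sqrt_pos.2 hn').ne', Real.log_sqrt hn'.le,
      Real.log_sqrt (hvpos n hn0 x).le, Real.log_div (hvpos n hn0 x).ne' hN.ne',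
      Real.log_mul (by positivity) hn'.ne']
    ring
  have hi2 : Integrable (fun x => (1 / 2) * Real.log (v n x / (2 * Real.pi * n))
      + (1 / 2) * Real.log (2 * Real.pi)) ν := (hvi.const_mul _).add (integrable_const _)
  have e3 : ∫ x, Real.log (Real.sqrt (2 * Real.pi * ψ x) * D) ∂ν
      = (1 / 2) * ∫ x, Real.log (ψ x) ∂ν
        + 2 * Real.pi * ((1 / 2) * Real.log (2 * Real.pi) + Real.log D) := by
    rw [integral_congr_ae hlim_log, integral_add (hlog.const_mul _) (integrable_const _),
      integral_const_mul, integral_const, hνu, smul_eq_mul]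
  calc _ = ∫ x, (Real.log (s n x) - ((1 / 2) * Real.log (v n x / (2 * Real.pi * n))
        + (1 / 2) * Real.log (2 * Real.pi))) ∂ν := integral_congr_ae (ae_of_all _ hpt)
    _ = ∫ x, Real.log (s n x) ∂ν - ((1 / 2) * ∫ x, Real.log (v n x / (2 * Real.pi * n)) ∂ν
        + 2 * Real.pi * ((1 / 2) * Real.log (2 * Real.pi))) := by
        rw [integral_sub (hslog n hn0) hi2, integral_add (hvi.const_mul _) (integrable_const _),
          integral_const_mul, integral_const, hνu, smul_eq_mul]
    _ ≤ _ := by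
        rw [e3] at hn
        simp only [v, hν] at hJ ⊢
        linarith

end Spectral

/-! ### The trigonometric polynomial as a family of linear forms -/

section FixedDegree

variable {Ω : Type*} {a b : ℕ+ → Ω → ℝ}

lemma continuous_tilt (g : ℝ → ℂ) (n j : ℕ) : Continuous (fun x => tilt g n x j) := by
  unfold tilt; fun_prop

lemma continuous_coeffForm_tilt (g : ℝ → ℂ) (n : ℕ) (ω : Ω) :
    Continuous (fun x => coeffForm a b n (tilt g n x) ω) := by
  unfold coeffForm
  have := continuous_tilt g n
  fun_prop

lemma trigPoly_eq_coeffForm (n : ℕ) (ω : Ω) (x : ℝ) :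
    trigPoly a b n ω x = 1 / Real.sqrt n * coeffForm a b n (tilt (fun _ => 1) n x) ω := by
  rw [trigPoly, coeffForm]
  congr 1
  refine Finset.sum_congr rfl fun j _ => ?_
  have : Complex.I * ((j + 1 : ℕ) : ℂ) * (x : ℂ) = (((j + 1 : ℕ) * x : ℝ) : ℂ) * Complex.I := by
    push_cast; ring
  rw [tilt, one_mul, this, Complex.exp_ofReal_mul_I_re, Complex.exp_ofReal_mul_I_im]

lemma numZeros_trigPoly {n : ℕ} (hn : 0 < n) (ω : Ω) (s t : ℝ) :
    numZeros (trigPoly a b n ω) s t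
      = numZeros (fun x => coeffForm a b n (tilt (fun _ => 1) n x) ω) s t := by
  have : (1 / Real.sqrt n) ≠ 0 := by positivity
  simp only [numZeros, trigPoly_eq_coeffForm, mul_eq_zero, this, false_or]

/-- The values of the trigonometric polynomial on the line of height `ε / n` are given by two linear
forms in the coefficients, with weights tilted by `cosh` and `sinh`. -/
lemma complexTrigSum_add_mul_I (n : ℕ) (ω : Ω) (ε x : ℝ) :
    complexTrigSum (fun j => a j.succPNat ω) (fun j => b j.succPNat ω) n
        (x + ((ε / n : ℝ) : ℂ) * Complex.I)
      = (coeffForm a b n (tilt (fun t => Complex.cosh (ε * t)) n x) ω : ℂ)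
        + coeffForm a b n (tilt (fun t => Complex.I * Complex.sinh (ε * t)) n x) ω * Complex.I := by
  rw [complexTrigSum, coeffForm, coeffForm, Complex.ofReal_sum, Complex.ofReal_sum, Finset.sum_mul,
    ← Finset.sum_add_distrib]
  refine Finset.sum_congr rfl fun j _ => ?_
  have h1 : ((j + 1 : ℕ) : ℂ) * ((x : ℂ) + ((ε / n : ℝ) : ℂ) * Complex.I)
      = (((j + 1 : ℕ) * x : ℝ) : ℂ) + ((ε * ((j + 1 : ℕ) / n) : ℝ) : ℂ) * Complex.I := by
    push_cast; ring
  have h2 : Complex.I * ((j + 1 : ℕ) : ℂ) * (x : ℂ) = (((j + 1 : ℕ) * x : ℝ) : ℂ) * Complex.I := by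
    push_cast; ring
  have h3 : (ε : ℂ) * (((j + 1 : ℕ) / n : ℝ) : ℂ) = ((ε * ((j + 1 : ℕ) / n) : ℝ) : ℂ) := by
    push_cast; ring
  rw [tilt, tilt, h1, h2, h3, Complex.cos_add_mul_I, Complex.sin_add_mul_I, Complex.exp_mul_I]
  generalize ((j + 1 : ℕ) * x : ℝ) = θ
  generalize (ε * ((j + 1 : ℕ) / n) : ℝ) = y
  rw [← Complex.ofReal_cos, ← Complex.ofReal_sin, ← Complex.ofReal_cosh, ← Complex.ofReal_sinh]
  apply Complex.ext <;> simp <;> ring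

lemma coeffForm_eq_complexTrigSum (n : ℕ) (ω : Ω) (x : ℝ) :
    (coeffForm a b n (tilt (fun _ => 1) n x) ω : ℂ)
      = complexTrigSum (fun j => a j.succPNat ω) (fun j => b j.succPNat ω) n x := by
  have := complexTrigSum_add_mul_I (a := a) (b := b) n ω 0 x
  simp only [zero_div, Complex.ofReal_zero, zero_mul, add_zero, Complex.cosh_zero,
    Complex.sinh_zero, mul_zero] at this
  rw [this]
  simp [coeffForm, tilt]

/-- A translation by `ε / n` is the tilt by the profile `t ↦ e^{iεt}`. -/
lemma tilt_add_div (n : ℕ) (ε x : ℝ) :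
    tilt (fun _ => 1) n (x + ε / n) = tilt (fun t => Complex.exp (ε * t * Complex.I)) n x := by
  funext j
  rw [tilt, tilt, one_mul, ← Complex.exp_add]
  congr 1
  push_cast
  ring

variable [MeasurableSpace Ω] {P : Measure Ω} {ρ : ℤ → ℝ} {μ μs : Measure ℝ} {ψ : ℝ → ℝ}

lemma aemeasurable_numZeros_trigPoly (ha : ∀ k, AEMeasurable (a k) P)
    (hb : ∀ k, AEMeasurable (b k) P) (n : ℕ) (s t : ℝ) :
    AEMeasurable (fun ω => (numZeros (trigPoly a b n ω) s t : ℝ≥0∞)) P := by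
  let F : (ℕ+ → ℝ) × (ℕ+ → ℝ) → ℝ → ℝ := fun c x => 1 / Real.sqrt n * ∑ j ∈ Finset.range n,
    (c.1 j.succPNat * Real.cos ((j + 1 : ℕ) * x) + c.2 j.succPNat * Real.sin ((j + 1 : ℕ) * x))
  have hF : Continuous (fun p : ((ℕ+ → ℝ) × (ℕ+ → ℝ)) × ℝ => F p.1 p.2) := by
    fun_prop
  have hm := measurable_encard_zeros hF (isCompact_Icc (a := s) (b := t))
  exact hm.comp_aemeasurable (f := fun ω => ((fun k => a k ω), fun k => b k ω))
    ((aemeasurable_pi_lambda _ ha).prodMk (aemeasurable_pi_lambda _ hb))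

lemma aemeasurable_coeffForm_prod [SFinite P] (ha : ∀ k, AEMeasurable (a k) P)
    (hb : ∀ k, AEMeasurable (b k) P) (g : ℝ → ℂ) (n : ℕ) (ν : Measure ℝ) [SFinite ν] :
    AEMeasurable (fun p : Ω × ℝ => coeffForm a b n (tilt g n p.2) p.1) (P.prod ν) := by
  unfold coeffForm
  have hc := fun j => (continuous_tilt g n j).measurable
  have ha' := fun k => (ha k).comp_quasiMeasurePreserving
    (Measure.quasiMeasurePreserving_fst (μ := P) (ν := ν))
  have hb' := fun k => (hb k).comp_quasiMeasurePreserving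
    (Measure.quasiMeasurePreserving_fst (μ := P) (ν := ν))
  refine Finset.aemeasurable_fun_sum _ fun j _ => ?_
  refine ((ha' _).mul ?_).add ((hb' _).mul ?_)
  · exact (Complex.measurable_re.comp ((hc j).comp measurable_snd)).aemeasurable
  · exact (Complex.measurable_im.comp ((hc j).comp measurable_snd)).aemeasurable

/-- The logarithm of a tilted pair is integrable jointly in the randomness and the evaluation
point. -/
lemma integrable_log_norm_prod [IsProbabilityMeasure P] (ha : IsStationaryGaussian P ρ a)
    (hb : IsStationaryGaussian P ρ b)
    (hab : IndepFun (fun ω k => a k ω) (fun ω k => b k ω) P)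
    (hμ : IsSpectralMeasure ρ μ) {n : ℕ} {g₁ g₂ : ℝ → ℂ}
    (hv : ∀ x, 0 < specVar μ n (tilt g₁ n x)) (s t : ℝ) :
    Integrable (fun p : Ω × ℝ => Real.log ‖(coeffForm a b n (tilt g₁ n p.2) p.1 : ℂ)
      + coeffForm a b n (tilt g₂ n p.2) p.1 * Complex.I‖)
      (P.prod (volume.restrict (Set.Icc s t))) := by
  have ha' : ∀ k, AEMeasurable (a k) P := fun k => ha.gaussian.aemeasurable k
  have hb' : ∀ k, AEMeasurable (b k) P := fun k => hb.gaussian.aemeasurable k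
  have hG := fun x => isGaussianPair_coeffForm ha hb hab hμ n (tilt g₁ n x) (tilt g₂ n x)
  have hm : AEStronglyMeasurable (fun p : Ω × ℝ =>
      Real.log ‖(coeffForm a b n (tilt g₁ n p.2) p.1 : ℂ)
        + coeffForm a b n (tilt g₂ n p.2) p.1 * Complex.I‖)
      (P.prod (volume.restrict (Set.Icc s t))) := by
    have h1 := aemeasurable_coeffForm_prod ha' hb' g₁ n (volume.restrict (Set.Icc s t))
    have h2 := aemeasurable_coeffForm_prod ha' hb' g₂ n (volume.restrict (Set.Icc s t))
    exact (Real.measurable_log.comp_aemeasurable (by fun_prop)).aestronglyMeasurable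
  rw [integrable_prod_iff' hm]
  refine ⟨ae_of_all _ fun x => (hG x).integrable_log_norm (hv x), ?_⟩
  have hv' := continuous_specVar_tilt hμ g₁ n
  have hu' := continuous_specVar_tilt hμ g₂ n
  have hcont : Continuous (fun x => |Real.log (Real.sqrt (specVar μ n (tilt g₁ n x)))|
      + ∫ z : ℂ, |Real.log z.re| ∂(stdGaussian ℂ)
      + (Real.sqrt (specVar μ n (tilt g₁ n x)) + 2 * Real.sqrt (specVar μ n (tilt g₂ n x)))
        * ∫ z : ℂ, ‖z‖ ∂(stdGaussian ℂ)) := by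
    have : Continuous (fun x => Real.log (Real.sqrt (specVar μ n (tilt g₁ n x)))) :=
      hv'.sqrt.log fun x => (Real.sqrt_pos.2 (hv x)).ne'
    fun_prop
  refine Integrable.mono' (hcont.integrableOn_Icc (a := s) (b := t)) ?_ (ae_of_all _ fun x => ?_)
  · exact hm.prod_swap.norm.integral_prod_right'
  · rw [Real.norm_of_nonneg (integral_nonneg fun _ => norm_nonneg _)]
    exact (hG x).integral_abs_log_norm_le (hv x)

end FixedDegree

/-! ### Bounds for the expected number of zeros at a fixed degree -/

section Expectation

variable {Ω : Type*} [MeasurableSpace Ω] {P : Measure Ω} [IsProbabilityMeasure P] {ρ : ℤ → ℝ}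
  {a b : ℕ+ → Ω → ℝ} {μ μs : Measure ℝ} {ψ : ℝ → ℝ}

lemma ae_coeffForm_ne_zero (ha : IsStationaryGaussian P ρ a) (hb : IsStationaryGaussian P ρ b)
    (hab : IndepFun (fun ω k => a k ω) (fun ω k => b k ω) P) (hμ : IsSpectralMeasure ρ μ)
    {n : ℕ} {w : ℕ → ℂ} (hw : 0 < specVar μ n w) : ∀ᵐ ω ∂P, coeffForm a b n w ω ≠ 0 := by
  obtain ⟨hm, hmap⟩ := map_coeffForm ha hb hab hμ n w
  have := nullSingletonClass_gaussianReal (μ := 0) (v := Real.toNNReal (specVar μ n w))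
    (Real.toNNReal_pos.2 hw).ne'
  have h0 : P.map (coeffForm a b n w) {0} = 0 := by rw [hmap]; exact measure_singleton 0
  rw [Measure.map_apply_of_aemeasurable hm (measurableSet_singleton 0)] at h0
  filter_upwards [measure_eq_zero_iff_ae_notMem.1 h0] with ω hω using hω

lemma cosh_ofReal_ne_zero (ε t : ℝ) : Complex.cosh (ε * t) ≠ 0 := by
  rw [← Complex.ofReal_mul, ← Complex.ofReal_cosh]
  exact_mod_cast (Real.cosh_pos _).ne'

/-- Upper bound for the expected number of zeros, by taking expectations in the comparison of the
zeros with the growth of `log |f|` between the real axis and the height `ε / n`. -/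
theorem lintegral_numZeros_le (ha : IsStationaryGaussian P ρ a) (hb : IsStationaryGaussian P ρ b)
    (hab : IndepFun (fun ω k => a k ω) (fun ω k => b k ω) P) (hμ : IsSpectralMeasure ρ μ)
    (hdec : IsLebesgueDecomposition μ μs ψ) (hψ : ∀ᵐ x, 0 < ψ x) {n : ℕ} (hn : 0 < n)
    {ε : ℝ} (hε : 0 < ε) :
    ∫⁻ ω, (numZeros (trigPoly a b n ω) 0 (2 * Real.pi) : ℝ≥0∞) ∂P
      ≤ ENNReal.ofReal (n / (ε * Real.pi) * ∫ x in Set.Icc (-Real.pi) Real.pi,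
        (Real.log (Real.sqrt (specVar μ n (tilt (fun t => Complex.cosh (ε * t)) n x))
          + Real.sqrt (specVar μ n (tilt (fun t => Complex.I * Complex.sinh (ε * t)) n x)))
          - Real.log (Real.sqrt (specVar μ n (tilt (fun _ => 1) n x))))) := by
  have := hμ.isProbabilityMeasure
  have hπ := Real.pi_pos
  have hnr : (0 : ℝ) < n := by exact_mod_cast hn
  set g₁ : ℝ → ℂ := fun t => Complex.cosh (ε * t) with hg₁
  set g₂ : ℝ → ℂ := fun t => Complex.I * Complex.sinh (ε * t) with hg₂
  have hv : ∀ x, 0 < specVar μ n (tilt g₁ n x) := fun x =>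
    hdec.specVar_pos hψ (tilt_ne_zero (fun t _ => cosh_ofReal_ne_zero ε t) hn x)
  have hv0 : ∀ x, 0 < specVar μ n (tilt (fun _ => 1) n x) := fun x =>
    hdec.specVar_pos hψ (tilt_ne_zero (fun _ _ => one_ne_zero) hn x)
  have hvc := continuous_specVar_tilt hμ g₁ n
  have huc := continuous_specVar_tilt hμ g₂ n
  have hv0c := continuous_specVar_tilt hμ (fun _ => 1) n
  set ν := volume.restrict (Set.Icc 0 (2 * Real.pi)) with hν
  set f₁ : Ω → ℝ → ℝ := fun ω x => Real.log ‖(coeffForm a b n (tilt g₁ n x) ω : ℂ)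
    + coeffForm a b n (tilt g₂ n x) ω * Complex.I‖ with hf₁
  -- on the real axis the second form has weights `0`, and then `E log |f|` is known exactly
  set f₀ : Ω → ℝ → ℝ := fun ω x => Real.log ‖(coeffForm a b n (tilt (fun _ => 1) n x) ω : ℂ)
    + coeffForm a b n (tilt (fun _ => 0) n x) ω * Complex.I‖ with hf₀
  have hi₁ : Integrable (Function.uncurry f₁) (P.prod ν) :=
    integrable_log_norm_prod ha hb hab hμ hv 0 (2 * Real.pi)
  have hi₀ : Integrable (Function.uncurry f₀) (P.prod ν) :=
    integrable_log_norm_prod ha hb hab hμ hv0 0 (2 * Real.pi)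
  -- the means of `log |f|` at heights `ε / n` and `0`
  have hm₁ : ∀ ω, logMean (fun j => a j.succPNat ω) (fun j => b j.succPNat ω) n (ε / n)
      = (2 * Real.pi)⁻¹ * ∫ x, f₁ ω x ∂ν := by
    intro ω
    rw [logMean, intervalIntegral.integral_of_le (by positivity), hν, integral_Icc_eq_integral_Ioc]
    simp only [hf₁, hg₁, hg₂, ← complexTrigSum_add_mul_I]
  have htilt0 : ∀ x ω, coeffForm a b n (tilt (fun _ => 0) n x) ω = 0 := by
    intro x ω; simp [coeffForm, tilt]
  have hm₀ : ∀ ω, logMean (fun j => a j.succPNat ω) (fun j => b j.succPNat ω) n 0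
      = (2 * Real.pi)⁻¹ * ∫ x, f₀ ω x ∂ν := by
    intro ω
    rw [logMean, intervalIntegral.integral_of_le (by positivity), hν, integral_Icc_eq_integral_Ioc]
    simp only [hf₀, htilt0, Complex.ofReal_zero, zero_mul, add_zero, coeffForm_eq_complexTrigSum]
  set D : Ω → ℝ := fun ω => 2 / (ε / n) * ((2 * Real.pi)⁻¹ * (∫ x, f₁ ω x ∂ν)
    - (2 * Real.pi)⁻¹ * (∫ x, f₀ ω x ∂ν)) with hD
  have hle : ∀ᵐ ω ∂P, 0 ≤ D ω ∧
      (numZeros (trigPoly a b n ω) 0 (2 * Real.pi) : ℝ≥0∞) ≤ ENNReal.ofReal (D ω) := by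
    filter_upwards [ae_coeffForm_ne_zero ha hb hab hμ (hv0 0)] with ω hω
    have := numZeros_mul_le_logMean
      (g := fun x => coeffForm a b n (tilt (fun _ => 1) n x) ω)
      (fun x => coeffForm_eq_complexTrigSum n ω x) hω (div_pos hε hnr)
    rwa [hm₁, hm₀, ← numZeros_trigPoly hn] at this
  have hJ₁ : Integrable (fun ω => ∫ x, f₁ ω x ∂ν) P := hi₁.integral_prod_left
  have hJ₀ : Integrable (fun ω => ∫ x, f₀ ω x ∂ν) P := hi₀.integral_prod_left
  have hDi : Integrable D P := ((hJ₁.const_mul _).sub (hJ₀.const_mul _)).const_mul _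
  have hDint : ∫ ω, D ω ∂P = n / (ε * Real.pi)
      * ∫ x, ((∫ ω, f₁ ω x ∂P) - ∫ ω, f₀ ω x ∂P) ∂ν := by
    have e1 := integral_integral_swap hi₁
    have e0 := integral_integral_swap hi₀
    have hK₁ : Integrable (fun x => ∫ ω, f₁ ω x ∂P) ν := hi₁.integral_prod_right
    have hK₀ : Integrable (fun x => ∫ ω, f₀ ω x ∂P) ν := hi₀.integral_prod_right
    simp only [hD]
    rw [integral_const_mul, integral_sub (hJ₁.const_mul _) (hJ₀.const_mul _), integral_const_mul,
      integral_const_mul, e1, e0, integral_sub hK₁ hK₀]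
    field_simp
  set G : ℝ → ℝ := fun x => Real.log (Real.sqrt (specVar μ n (tilt g₁ n x))
    + Real.sqrt (specVar μ n (tilt g₂ n x)))
    - Real.log (Real.sqrt (specVar μ n (tilt (fun _ => 1) n x))) with hG
  have hGc : Continuous G := by
    refine Continuous.sub (Continuous.log (by fun_prop) fun x => ?_)
      (Continuous.log (by fun_prop) fun x => (Real.sqrt_pos.2 (hv0 x)).ne')
    have := Real.sqrt_pos.2 (hv x)
    positivity
  have hmean : ∫ x, ((∫ ω, f₁ ω x ∂P) - ∫ ω, f₀ ω x ∂P) ∂ν ≤ ∫ x, G x ∂ν := by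
    refine integral_mono (hi₁.integral_prod_right.sub hi₀.integral_prod_right)
      hGc.integrableOn_Icc fun x => ?_
    have h1 := (isGaussianPair_coeffForm ha hb hab hμ n (tilt g₁ n x)
      (tilt g₂ n x)).integral_log_norm_le (hv x)
    have h0 := (isGaussianPair_coeffForm ha hb hab hμ n (tilt (fun _ => 1) n x)
      (tilt (fun _ => 0) n x)).integral_log_norm (hv0 x)
    have hz : ∀ y, specSum n (tilt (fun _ => 0) n x) y = 0 := by
      intro y; simp [specSum, tilt]
    have hz1 : specVar μ n (tilt (fun _ => 0) n x) = 0 := by simp [specVar, hz]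
    have hz2 : specCov μ n (tilt (fun _ => 1) n x) (tilt (fun _ => 0) n x) = 0 := by
      simp [specCov, hz]
    rw [hz1, hz2, zero_div, zero_pow two_ne_zero, sub_zero, Real.sqrt_zero, add_zero, add_zero,
      Real.sqrt_sq (Real.sqrt_nonneg _)] at h0
    simp only [hG, hf₁, hf₀]
    rw [h0]
    linarith
  have hper : ∫ x, G x ∂ν = ∫ x in Set.Icc (-Real.pi) Real.pi, G x := by
    have hGp : Function.Periodic G (2 * Real.pi) := by
      intro x
      simp only [hG, tilt_add_two_pi]
    have := hGp.intervalIntegral_add_eq 0 (-Real.pi)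
    rw [zero_add, show -Real.pi + 2 * Real.pi = Real.pi by ring,
      intervalIntegral.integral_of_le (by positivity),
      intervalIntegral.integral_of_le (by linarith)] at this
    rw [hν, integral_Icc_eq_integral_Ioc, integral_Icc_eq_integral_Ioc, this]
  calc ∫⁻ ω, (numZeros (trigPoly a b n ω) 0 (2 * Real.pi) : ℝ≥0∞) ∂P
      ≤ ∫⁻ ω, ENNReal.ofReal (D ω) ∂P := lintegral_mono_ae (hle.mono fun _ h => h.2)
    _ = ENNReal.ofReal (∫ ω, D ω ∂P) :=
        (ofReal_integral_eq_lintegral_ofReal hDi (hle.mono fun _ h => h.1)).symm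
    _ ≤ _ := by
        refine ENNReal.ofReal_le_ofReal ?_
        rw [hDint, ← hper]
        exact mul_le_mul_of_nonneg_left hmean (by positivity)

/-- A polynomial that changes sign between `x` and `x + δ` vanishes in between: averaging over `x`
bounds the expected number of zeros from below by the probability of a sign change. -/
theorem le_lintegral_numZeros (ha : IsStationaryGaussian P ρ a) (hb : IsStationaryGaussian P ρ b)
    (hab : IndepFun (fun ω k => a k ω) (fun ω k => b k ω) P) (hμ : IsSpectralMeasure ρ μ)
    (hdec : IsLebesgueDecomposition μ μs ψ) (hψ : ∀ᵐ x, 0 < ψ x) {n : ℕ} (hn : 0 < n)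
    {ε : ℝ} (hε : 0 < ε) :
    ∫⁻ x in Set.Icc 0 (2 * Real.pi), ENNReal.ofReal (Real.sqrt (2 * (1 -
        specCov μ n (tilt (fun _ => 1) n x) (tilt (fun t => Complex.exp (ε * t * Complex.I)) n x)
          / (Real.sqrt (specVar μ n (tilt (fun _ => 1) n x)) * Real.sqrt
            (specVar μ n (tilt (fun t => Complex.exp (ε * t * Complex.I)) n x))))) / Real.pi)
      ≤ ENNReal.ofReal (ε / n)
        * ∫⁻ ω, (numZeros (trigPoly a b n ω) 0 (2 * Real.pi) : ℝ≥0∞) ∂P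
        + ENNReal.ofReal (ε / n) := by
  have := hμ.isProbabilityMeasure
  have hnr : (0 : ℝ) < n := by exact_mod_cast hn
  set δ := ε / n with hδ
  have hδ0 : 0 < δ := div_pos hε hnr
  set g₁ : ℝ → ℂ := fun _ => 1 with hg₁
  set g₂ : ℝ → ℂ := fun t => Complex.exp (ε * t * Complex.I) with hg₂
  set X : Ω → ℝ → ℝ := fun ω x => coeffForm a b n (tilt g₁ n x) ω with hX
  have hXδ : ∀ ω x, X ω (x + δ) = coeffForm a b n (tilt g₂ n x) ω := by
    intro ω x
    simp only [hX, hg₁, hg₂, hδ, tilt_add_div]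
  set φ : ℝ → ℝ≥0∞ := (Set.Iio 0).indicator 1 with hφ
  have hφm : Measurable φ := measurable_one.indicator measurableSet_Iio
  have hXc : ∀ ω, Continuous (X ω) := fun ω => continuous_coeffForm_tilt g₁ n ω
  set q : ℝ → ℝ≥0∞ := fun x => ENNReal.ofReal (Real.sqrt (2 * (1 -
        specCov μ n (tilt g₁ n x) (tilt g₂ n x)
          / (Real.sqrt (specVar μ n (tilt g₁ n x)) * Real.sqrt
            (specVar μ n (tilt g₂ n x))))) / Real.pi) with hq
  have hqle : ∀ x, q x ≤ ∫⁻ ω, φ (X ω x * X ω (x + δ)) ∂P := by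
    intro x
    have hG := isGaussianPair_coeffForm ha hb hab hμ n (tilt g₁ n x) (tilt g₂ n x)
    have h1 := hG.le_measure_mul_neg
      (hdec.specVar_pos hψ (tilt_ne_zero (fun _ _ => one_ne_zero) hn x))
      (hdec.specVar_pos hψ (tilt_ne_zero (fun _ _ => Complex.exp_ne_zero _) hn x))
    refine h1.trans_eq ?_
    have hm : AEMeasurable (fun ω => X ω x * X ω (x + δ)) P := by
      simp only [hXδ]
      exact hG.aemeasurable_left.mul hG.aemeasurable_right
    have h2 : (fun ω => φ (X ω x * X ω (x + δ)))
        = ((fun ω => X ω x * X ω (x + δ)) ⁻¹' Set.Iio 0).indicator 1 := by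
      funext ω
      simp [hφ, Set.indicator]
    rw [h2, lintegral_indicator_one₀ (hm.nullMeasurable measurableSet_Iio)]
    congr 1
    ext ω
    rw [Set.mem_preimage, hXδ]
    rfl
  have hq1 : ∀ x, q x ≤ 1 := by
    intro x
    refine (hqle x).trans ?_
    calc ∫⁻ ω, φ (X ω x * X ω (x + δ)) ∂P ≤ ∫⁻ _, 1 ∂P :=
          lintegral_mono fun ω => Set.indicator_le_self' (by simp) _
      _ = 1 := by simp
  set ν := volume.restrict (Set.Icc 0 (2 * Real.pi - δ)) with hν
  have hmeas : AEMeasurable (Function.uncurry fun ω x => φ (X ω x * X ω (x + δ))) (P.prod ν) := by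
    have ha' : ∀ k, AEMeasurable (a k) P := fun k => ha.gaussian.aemeasurable k
    have hb' : ∀ k, AEMeasurable (b k) P := fun k => hb.gaussian.aemeasurable k
    have h1 := aemeasurable_coeffForm_prod ha' hb' g₁ n ν
    have h2 := aemeasurable_coeffForm_prod ha' hb' g₂ n ν
    simp only [hXδ]
    exact hφm.comp_aemeasurable (h1.mul h2)
  have hmain : ∫⁻ x, q x ∂ν ≤ ENNReal.ofReal δ
      * ∫⁻ ω, (numZeros (trigPoly a b n ω) 0 (2 * Real.pi) : ℝ≥0∞) ∂P := by
    calc ∫⁻ x, q x ∂ν ≤ ∫⁻ x, ∫⁻ ω, φ (X ω x * X ω (x + δ)) ∂P ∂ν := lintegral_mono hqle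
      _ = ∫⁻ ω, ∫⁻ x, φ (X ω x * X ω (x + δ)) ∂ν ∂P := (lintegral_lintegral_swap hmeas).symm
      _ ≤ ∫⁻ ω, ENNReal.ofReal δ
          * (numZeros (trigPoly a b n ω) 0 (2 * Real.pi) : ℝ≥0∞) ∂P := by
          refine lintegral_mono fun ω => ?_
          have hc : Continuous (fun x => X ω x * X ω (x + δ)) := by
            have := hXc ω
            fun_prop
          have h2 : (fun x => φ (X ω x * X ω (x + δ)))
              = ((fun x => X ω x * X ω (x + δ)) ⁻¹' Set.Iio 0).indicator 1 := by
            funext x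
            simp [hφ, Set.indicator]
          have hS : MeasurableSet ((fun x => X ω x * X ω (x + δ)) ⁻¹' Set.Iio 0) :=
            hc.measurable measurableSet_Iio
          rw [h2, lintegral_indicator_one hS, hν, Measure.restrict_apply hS, numZeros_trigPoly hn]
          refine le_trans (measure_mono ?_) (volume_sign_change_le (hXc ω) hδ0 _)
          exact fun x hx => ⟨hx.2, hx.1⟩
      _ = _ := lintegral_const_mul' _ _ ENNReal.ofReal_ne_top
  calc ∫⁻ x in Set.Icc 0 (2 * Real.pi), q x
      ≤ ∫⁻ x in Set.Icc 0 (2 * Real.pi - δ) ∪ Set.Icc (2 * Real.pi - δ) (2 * Real.pi), q x := by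
        refine lintegral_mono_set fun x hx => ?_
        rcases le_total x (2 * Real.pi - δ) with h | h
        · exact Or.inl ⟨hx.1, h⟩
        · exact Or.inr ⟨h, hx.2⟩
    _ ≤ ∫⁻ x, q x ∂ν + ∫⁻ x in Set.Icc (2 * Real.pi - δ) (2 * Real.pi), q x :=
        lintegral_union_le _ _ _
    _ ≤ _ := by
        refine add_le_add hmain ?_
        calc ∫⁻ x in Set.Icc (2 * Real.pi - δ) (2 * Real.pi), q x
            ≤ ∫⁻ x in Set.Icc (2 * Real.pi - δ) (2 * Real.pi), 1 := lintegral_mono fun x => hq1 x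
          _ = ENNReal.ofReal δ := by simp

end Expectation

/-! ### Passage to the limit -/

section Elementary

lemma exists_lipschitzOnWith_of_contDiff {g : ℝ → ℂ} (hg : ContDiff ℝ 1 g) :
    ∃ L, LipschitzOnWith L g (Set.Icc 0 1) :=
  (hg.locallyLipschitz.locallyLipschitzOn (s := Set.Icc 0 1)).exists_lipschitzOnWith_of_compact
    isCompact_Icc

lemma sinh_le_mul_cosh {y : ℝ} (hy : 0 ≤ y) : Real.sinh y ≤ y * Real.cosh y := by
  rcases hy.eq_or_lt with rfl | hy
  · simp
  obtain ⟨c, hc, h⟩ := exists_hasDerivAt_eq_slope Real.sinh Real.cosh hy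
    Real.continuous_sinh.continuousOn fun x _ => Real.hasDerivAt_sinh x
  rw [Real.sinh_zero, sub_zero, sub_zero, eq_div_iff hy.ne'] at h
  rw [← h, mul_comm]
  refine mul_le_mul_of_nonneg_left ?_ hy.le
  rw [Real.cosh_le_cosh, abs_of_pos hc.1, abs_of_pos hy]
  exact hc.2.le

lemma norm_cosh_ofReal_mul_sq (ε t : ℝ) : ‖Complex.cosh (ε * t)‖ ^ 2 = Real.cosh (ε * t) ^ 2 := by
  rw [← Complex.ofReal_mul, ← Complex.ofReal_cosh, Complex.norm_real, Real.norm_eq_abs, sq_abs]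

lemma norm_I_mul_sinh_ofReal_mul_sq (ε t : ℝ) :
    ‖Complex.I * Complex.sinh (ε * t)‖ ^ 2 = Real.sinh (ε * t) ^ 2 := by
  rw [norm_mul, Complex.norm_I, one_mul, ← Complex.ofReal_mul, ← Complex.ofReal_sinh,
    Complex.norm_real, Real.norm_eq_abs, sq_abs]

lemma one_le_integral_cosh_sq (ε : ℝ) : 1 ≤ ∫ t in (0 : ℝ)..1, ‖Complex.cosh (ε * t)‖ ^ 2 := by
  simp only [norm_cosh_ofReal_mul_sq]
  calc (1 : ℝ) = ∫ t in (0 : ℝ)..1, (1 : ℝ) := by simp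
    _ ≤ _ := by
      refine intervalIntegral.integral_mono_on zero_le_one (by simp)
        (Continuous.intervalIntegrable (by fun_prop) _ _) fun t _ => ?_
      exact one_le_pow₀ (Real.one_le_cosh _)

/-- From `sinh y ≤ y cosh y`: the two square roots are at most `cosh ε` and `cosh ε · ε / √3`. -/
lemma log_sqrt_integral_add_le {ε : ℝ} (hε : 0 < ε) :
    Real.log (Real.sqrt (∫ t in (0 : ℝ)..1, ‖Complex.cosh (ε * t)‖ ^ 2)
      + Real.sqrt (∫ t in (0 : ℝ)..1, ‖Complex.I * Complex.sinh (ε * t)‖ ^ 2))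
      ≤ ε ^ 2 / 2 + ε / Real.sqrt 3 := by
  have hA1 := one_le_integral_cosh_sq ε
  have hmono : ∀ t ∈ Set.Icc (0 : ℝ) 1, Real.cosh (ε * t) ≤ Real.cosh ε := by
    intro t ht
    rw [Real.cosh_le_cosh, abs_of_pos hε, abs_of_nonneg (mul_nonneg hε.le ht.1)]
    nlinarith [ht.2]
  have hc0 := Real.cosh_pos ε
  have h3 : (0 : ℝ) < Real.sqrt 3 := by positivity
  have hA : ∫ t in (0 : ℝ)..1, ‖Complex.cosh (ε * t)‖ ^ 2 ≤ Real.cosh ε ^ 2 := by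
    simp only [norm_cosh_ofReal_mul_sq]
    calc ∫ t in (0 : ℝ)..1, Real.cosh (ε * t) ^ 2
        ≤ ∫ t in (0 : ℝ)..1, Real.cosh ε ^ 2 := by
          refine intervalIntegral.integral_mono_on zero_le_one
            (Continuous.intervalIntegrable (by fun_prop) _ _) (by simp) fun t ht => ?_
          exact pow_le_pow_left₀ (Real.cosh_pos _).le (hmono t ht) 2
      _ = _ := by simp
  have hB : ∫ t in (0 : ℝ)..1, ‖Complex.I * Complex.sinh (ε * t)‖ ^ 2
      ≤ (Real.cosh ε * (ε / Real.sqrt 3)) ^ 2 := by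
    simp only [norm_I_mul_sinh_ofReal_mul_sq]
    calc ∫ t in (0 : ℝ)..1, Real.sinh (ε * t) ^ 2
        ≤ ∫ t in (0 : ℝ)..1, (ε * Real.cosh ε) ^ 2 * t ^ 2 := by
          refine intervalIntegral.integral_mono_on zero_le_one
            (Continuous.intervalIntegrable (by fun_prop) _ _)
            (Continuous.intervalIntegrable (by fun_prop) _ _) fun t ht => ?_
          have h0 : 0 ≤ ε * t := mul_nonneg hε.le ht.1
          rw [← mul_pow]
          refine pow_le_pow_left₀ (Real.sinh_nonneg_iff.2 h0) ?_ 2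
          refine (sinh_le_mul_cosh h0).trans ?_
          calc ε * t * Real.cosh (ε * t) ≤ ε * t * Real.cosh ε :=
                mul_le_mul_of_nonneg_left (hmono t ht) h0
            _ = _ := by ring
      _ = (Real.cosh ε * (ε / Real.sqrt 3)) ^ 2 := by
          rw [intervalIntegral.integral_const_mul, integral_pow, mul_pow, mul_pow, div_pow,
            Real.sq_sqrt (by norm_num)]
          norm_num
          ring
  have hsA := Real.sqrt_le_sqrt hA
  have hsB := Real.sqrt_le_sqrt hB
  rw [Real.sqrt_sq hc0.le] at hsA
  rw [Real.sqrt_sq (by positivity)] at hsB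
  have hpos : 0 < Real.sqrt (∫ t in (0 : ℝ)..1, ‖Complex.cosh (ε * t)‖ ^ 2) :=
    Real.sqrt_pos.2 (by linarith)
  calc _ ≤ Real.log (Real.cosh ε * (1 + ε / Real.sqrt 3)) :=
        Real.log_le_log (by positivity) (by linarith)
    _ = Real.log (Real.cosh ε) + Real.log (1 + ε / Real.sqrt 3) :=
        Real.log_mul hc0.ne' (by positivity)
    _ ≤ _ := by
        refine add_le_add ?_ ?_
        · rw [Real.log_le_iff_le_exp hc0]
          exact Real.cosh_le_exp_half_sq ε
        · have := Real.log_le_sub_one_of_pos (x := 1 + ε / Real.sqrt 3) (by positivity)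
          linarith

lemma mul_sqrt_le_sqrt_one_sub_integral_cos {ε : ℝ} (hε : 0 < ε) (hε1 : ε ≤ 1) :
    ε * Real.sqrt (1 / 3 - ε ^ 2)
      ≤ Real.sqrt (2 * (1 - ∫ t in (0 : ℝ)..1, Real.cos (ε * t))) := by
  have hcos : ∫ t in (0 : ℝ)..1, Real.cos (ε * t) ≤ 1 - ε ^ 2 / 6 + 5 / 96 * ε ^ 4 := by
    calc ∫ t in (0 : ℝ)..1, Real.cos (ε * t)
        ≤ ∫ t in (0 : ℝ)..1, ((1 + 5 / 96 * ε ^ 4) - ε ^ 2 / 2 * t ^ 2) := by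
          refine intervalIntegral.integral_mono_on zero_le_one
            (Continuous.intervalIntegrable (by fun_prop) _ _)
            (Continuous.intervalIntegrable (by fun_prop) _ _) fun t ht => ?_
          have h0 : 0 ≤ ε * t := mul_nonneg hε.le ht.1
          have h1 : ε * t ≤ ε := mul_le_of_le_one_right hε.le ht.2
          have h2 := (abs_le.1 (Real.cos_bound (x := ε * t) (by rw [abs_of_nonneg h0]; linarith))).2
          rw [abs_of_nonneg h0] at h2
          have h3 := pow_le_pow_left₀ h0 h1 4
          nlinarith
      _ = 1 - ε ^ 2 / 6 + 5 / 96 * ε ^ 4 := by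
          rw [intervalIntegral.integral_sub (by simp)
            (Continuous.intervalIntegrable (by fun_prop) _ _),
            intervalIntegral.integral_const_mul, integral_pow]
          norm_num
          ring
  rw [← Real.sqrt_sq hε.le, ← Real.sqrt_mul (sq_nonneg _)]
  rw [Real.sqrt_sq hε.le]
  refine Real.sqrt_le_sqrt ?_
  nlinarith [sq_nonneg (ε ^ 2)]

lemma integral_norm_one_add_exp_sq (ε : ℝ) :
    ∫ t in (0 : ℝ)..1, ‖1 + Complex.exp (ε * t * Complex.I)‖ ^ 2
      = 2 + 2 * ∫ t in (0 : ℝ)..1, Real.cos (ε * t) := by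
  have h : ∀ t : ℝ, ‖1 + Complex.exp (ε * t * Complex.I)‖ ^ 2 = 2 + 2 * Real.cos (ε * t) := by
    intro t
    rw [← Complex.ofReal_mul, Complex.sq_norm, Complex.normSq_apply, Complex.add_re, Complex.add_im,
      Complex.exp_ofReal_mul_I_re, Complex.exp_ofReal_mul_I_im, Complex.one_re, Complex.one_im]
    nlinarith [Real.sin_sq_add_cos_sq (ε * t)]
  simp only [h]
  rw [intervalIntegral.integral_add (by simp) (Continuous.intervalIntegrable (by fun_prop) _ _),
    intervalIntegral.integral_const_mul]
  simp

end Elementary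

section Limit

variable {Ω : Type*} [MeasurableSpace Ω] {P : Measure Ω} [IsProbabilityMeasure P] {ρ : ℤ → ℝ}
  {a b : ℕ+ → Ω → ℝ} {μ μs : Measure ℝ} {ψ : ℝ → ℝ}

/-- The upper half of the limit, with an error that vanishes with the height parameter `ε`. -/
theorem eventually_lintegral_numZeros_le (ha : IsStationaryGaussian P ρ a)
    (hb : IsStationaryGaussian P ρ b)
    (hab : IndepFun (fun ω k => a k ω) (fun ω k => b k ω) P) (hμ : IsSpectralMeasure ρ μ)
    (hdec : IsLebesgueDecomposition μ μs ψ) (hψ : ∀ᵐ x, 0 < ψ x)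
    (hlog : IntegrableOn (fun x => Real.log (ψ x)) (Set.Icc (-Real.pi) Real.pi))
    {ε : ℝ} (hε : 0 < ε) :
    ∀ᶠ n : ℕ in atTop, (∫⁻ ω, (numZeros (trigPoly a b n ω) 0 (2 * Real.pi) : ℝ≥0∞) ∂P) / n
      ≤ ENNReal.ofReal (2 / Real.sqrt 3 + 2 * ε) := by
  have hπ := Real.pi_pos
  obtain ⟨L₁, hL₁⟩ := exists_lipschitzOnWith_of_contDiff
    (g := fun t => Complex.cosh (ε * t))
    ((Complex.contDiff_cosh.restrict_scalars ℝ).comp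
      (contDiff_const.mul Complex.ofRealCLM.contDiff))
  obtain ⟨L₂, hL₂⟩ := exists_lipschitzOnWith_of_contDiff
    (g := fun t => Complex.I * Complex.sinh (ε * t))
    (contDiff_const.mul ((Complex.contDiff_sinh.restrict_scalars ℝ).comp
      (contDiff_const.mul Complex.ofRealCLM.contDiff)))
  have hev := hdec.eventually_integral_log_sub_le hμ hψ hlog hL₁ hL₂
    (fun t _ => cosh_ofReal_ne_zero ε t) (zero_lt_one.trans_le (one_le_integral_cosh_sq ε))
    (e := ε ^ 2 * Real.pi) (by positivity)
  filter_upwards [hev, eventually_gt_atTop 0] with n hn hn0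
  have hnr : (0 : ℝ) < n := by exact_mod_cast hn0
  have hle := lintegral_numZeros_le ha hb hab hμ hdec hψ hn0 hε
  refine ENNReal.div_le_of_le_mul (hle.trans ?_)
  rw [← ENNReal.ofReal_natCast n, ← ENNReal.ofReal_mul (by positivity)]
  refine ENNReal.ofReal_le_ofReal ?_
  have hl := log_sqrt_integral_add_le hε
  calc _ ≤ n / (ε * Real.pi) * (2 * Real.pi * (ε ^ 2 / 2 + ε / Real.sqrt 3) + ε ^ 2 * Real.pi) := by
        refine mul_le_mul_of_nonneg_left (hn.trans ?_) (by positivity)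
        have := mul_le_mul_of_nonneg_left hl (by positivity : 0 ≤ 2 * Real.pi)
        linarith
    _ = _ := by
        field_simp
        ring

lemma IsLebesgueDecomposition.ae_tendsto_specVar_of_contDiff (h : IsLebesgueDecomposition μ μs ψ)
    [IsFiniteMeasure μ] {g : ℝ → ℂ} (hg : ContDiff ℝ 1 g) :
    ∀ᵐ x, Tendsto (fun n : ℕ => specVar μ n (tilt g n x) / n) atTop
        (𝓝 (2 * Real.pi * ψ x * ∫ t in (0 : ℝ)..1, ‖g t‖ ^ 2)) := by
  obtain ⟨L, hL⟩ := exists_lipschitzOnWith_of_contDiff hg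
  refine ae_of_ae_Ioo_of_periodic (-Real.pi) (fun x => ?_) ?_
  · simp only [tilt_add_two_pi, h.periodic x]
  · filter_upwards [h.ae_tendsto_specVar] with x hx hxI
    exact hx (by rwa [show -Real.pi + 2 * Real.pi = Real.pi by ring] at hxI) g L hL

/-- Polarization: limits of covariances follow from limits of variances. -/
lemma specVar_tilt_add [IsFiniteMeasure μ] (g₁ g₂ : ℝ → ℂ) (n : ℕ) (x : ℝ) :
    specVar μ n (tilt (fun t => g₁ t + g₂ t) n x) = specVar μ n (tilt g₁ n x)
      + 2 * specCov μ n (tilt g₁ n x) (tilt g₂ n x) + specVar μ n (tilt g₂ n x) := by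
  have := specVar_add_smul μ n (tilt g₁ n x) (tilt g₂ n x) 1 1
  simp only [one_pow, mul_one] at this
  rw [← this]
  congr 1
  funext j
  simp only [tilt, Complex.ofReal_one]
  ring

/-- The lower half of the limit: the correlation of `f(x)` and `f(x + ε/n)` converges for almost
every `x` to `∫₀¹ cos(εt) dt`, whatever the density, and Fatou's lemma suffices for a lower
bound. -/
theorem eventually_lt_lintegral_numZeros (ha : IsStationaryGaussian P ρ a)
    (hb : IsStationaryGaussian P ρ b)
    (hab : IndepFun (fun ω k => a k ω) (fun ω k => b k ω) P) (hμ : IsSpectralMeasure ρ μ)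
    (hdec : IsLebesgueDecomposition μ μs ψ) (hψ : ∀ᵐ x, 0 < ψ x)
    {ε : ℝ} (hε : 0 < ε) (hε1 : ε ≤ 1) {y : ℝ} (hy0 : 0 ≤ y)
    (hy : y < 2 * Real.sqrt (1 / 3 - ε ^ 2)) :
    ∀ᶠ n : ℕ in atTop, ENNReal.ofReal y
      < (∫⁻ ω, (numZeros (trigPoly a b n ω) 0 (2 * Real.pi) : ℝ≥0∞) ∂P) / n := by
  have := hμ.isProbabilityMeasure
  have hπ := Real.pi_pos
  set g₁ : ℝ → ℂ := fun _ => 1 with hg₁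
  set g₂ : ℝ → ℂ := fun t => Complex.exp (ε * t * Complex.I) with hg₂
  have hc₁ : ContDiff ℝ 1 g₁ := contDiff_const
  have hexp : ContDiff ℝ 1 Complex.exp := Complex.contDiff_exp
  have hc₂ : ContDiff ℝ 1 g₂ := hexp.comp
    ((contDiff_const.mul Complex.ofRealCLM.contDiff).mul contDiff_const)
  set c := ∫ t in (0 : ℝ)..1, Real.cos (ε * t) with hc
  have hI₁ : ∫ t in (0 : ℝ)..1, ‖g₁ t‖ ^ 2 = 1 := by simp [hg₁]
  have hI₂ : ∫ t in (0 : ℝ)..1, ‖g₂ t‖ ^ 2 = 1 := by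
    have : ∀ t : ℝ, ‖g₂ t‖ = 1 := by
      intro t
      simp only [hg₂]
      rw [← Complex.ofReal_mul, Complex.norm_exp_ofReal_mul_I]
    simp [this]
  have hI₃ : ∫ t in (0 : ℝ)..1, ‖g₁ t + g₂ t‖ ^ 2 = 2 + 2 * c := integral_norm_one_add_exp_sq ε
  set r : ℕ → ℝ → ℝ := fun n x => specCov μ n (tilt g₁ n x) (tilt g₂ n x)
    / (Real.sqrt (specVar μ n (tilt g₁ n x)) * Real.sqrt (specVar μ n (tilt g₂ n x))) with hr
  set q : ℕ → ℝ → ℝ≥0∞ := fun n x =>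
    ENNReal.ofReal (Real.sqrt (2 * (1 - r n x)) / Real.pi) with hq
  have hcov : ∀ n x, specCov μ n (tilt g₁ n x) (tilt g₂ n x)
      = (specVar μ n (tilt (fun t => g₁ t + g₂ t) n x) - specVar μ n (tilt g₁ n x)
        - specVar μ n (tilt g₂ n x)) / 2 := by
    intro n x
    rw [specVar_tilt_add]
    ring
  have hqm : ∀ n, Measurable (q n) := by
    intro n
    have m1 := (continuous_specVar_tilt hμ g₁ n).measurable
    have m2 := (continuous_specVar_tilt hμ g₂ n).measurable
    have m3 := (continuous_specVar_tilt hμ (fun t => g₁ t + g₂ t) n).measurable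
    simp only [hq, hr, hcov]
    fun_prop
  have hlim : ∀ᵐ x, Tendsto (fun n => q n x) atTop
      (𝓝 (ENNReal.ofReal (Real.sqrt (2 * (1 - c)) / Real.pi))) := by
    filter_upwards [hψ, hdec.ae_tendsto_specVar_of_contDiff hc₁,
      hdec.ae_tendsto_specVar_of_contDiff hc₂,
      hdec.ae_tendsto_specVar_of_contDiff (hc₁.add hc₂)] with x hx h1 h2 h3
    rw [hI₁, mul_one] at h1
    rw [hI₂, mul_one] at h2
    rw [hI₃] at h3
    have hs : 0 < 2 * Real.pi * ψ x := by positivity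
    have h4 : Tendsto (fun n => r n x) atTop (𝓝 c) := by
      have h5 := (((h3.sub h1).sub h2).div_const 2).div (h1.sqrt.mul h2.sqrt)
        (mul_pos (Real.sqrt_pos.2 hs) (Real.sqrt_pos.2 hs)).ne'
      rw [Real.mul_self_sqrt hs.le] at h5
      have h6 : (2 * Real.pi * ψ x * (2 + 2 * c) - 2 * Real.pi * ψ x - 2 * Real.pi * ψ x) / 2
          / (2 * Real.pi * ψ x) = c := by
        field_simp
        ring
      rw [h6] at h5
      refine h5.congr' ?_
      filter_upwards [eventually_gt_atTop 0] with n hn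
      have hnr : (0 : ℝ) < n := by exact_mod_cast hn
      simp only [hr, hcov, Pi.div_apply]
      rw [Real.sqrt_div' _ hnr.le, Real.sqrt_div' _ hnr.le, div_mul_div_comm,
        Real.mul_self_sqrt hnr.le, ← sub_div, ← sub_div, div_right_comm,
        div_div_div_cancel_right₀ hnr.ne', div_right_comm]
    exact ENNReal.tendsto_ofReal
      (((tendsto_const_nhds.mul (tendsto_const_nhds.sub h4)).sqrt).div_const _)
  have hfatou : ENNReal.ofReal (2 * Real.sqrt (2 * (1 - c)))
      ≤ liminf (fun n => ∫⁻ x in Set.Icc 0 (2 * Real.pi), q n x) atTop := by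
    refine le_trans (le_of_eq ?_)
      (lintegral_liminf_le (μ := volume.restrict (Set.Icc 0 (2 * Real.pi))) hqm)
    rw [lintegral_congr_ae ((ae_restrict_of_ae hlim).mono fun x hx => hx.liminf_eq),
      lintegral_const, Measure.restrict_apply_univ, Real.volume_Icc,
      ← ENNReal.ofReal_mul (by positivity)]
    congr 1
    field_simp
    ring
  have hgap : ε * y < 2 * Real.sqrt (2 * (1 - c)) := by
    have h1 := mul_sqrt_le_sqrt_one_sub_integral_cos hε hε1
    have h2 := mul_lt_mul_of_pos_left hy hε
    linarith
  obtain ⟨z, hyz, hz⟩ := exists_between hgap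
  have hz0 : 0 < z := lt_of_le_of_lt (by positivity) hyz
  have hev := eventually_lt_of_lt_liminf
    (((ENNReal.ofReal_lt_ofReal_iff (hz0.trans hz)).2 hz).trans_le hfatou)
  have hsmall : ∀ᶠ n : ℕ in atTop, ε / n < z - ε * y :=
    (tendsto_const_div_atTop_nhds_zero_nat ε).eventually_lt_const (by linarith)
  filter_upwards [hev, hsmall, eventually_gt_atTop 0] with n hn hns hn0
  have hnr : (0 : ℝ) < n := by exact_mod_cast hn0
  have hle := hn.trans_le (le_lintegral_numZeros ha hb hab hμ hdec hψ hn0 hε)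
  by_contra! hcon
  refine absurd hle (not_lt.2 ?_)
  have hN := (ENNReal.div_le_iff (by exact_mod_cast hn0.ne') (ENNReal.natCast_ne_top n)).1 hcon
  calc _ ≤ ENNReal.ofReal (ε / n) * (ENNReal.ofReal y * n) + ENNReal.ofReal (ε / n) := by gcongr
    _ = ENNReal.ofReal (ε * y + ε / n) := by
        rw [← ENNReal.ofReal_natCast n, ← ENNReal.ofReal_mul hy0, ← ENNReal.ofReal_mul
          (by positivity), ← ENNReal.ofReal_add (by positivity) (by positivity)]
        congr 1
        field_simp
    _ ≤ ENNReal.ofReal z := ENNReal.ofReal_le_ofReal (by linarith)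

end Limit

theorem theorem3 {Ω : Type*} [MeasurableSpace Ω] (P : Measure Ω) [IsProbabilityMeasure P]
    (ρ : ℤ → ℝ) (a b : ℕ+ → Ω → ℝ)
    (ha : IsStationaryGaussian P ρ a) (hb : IsStationaryGaussian P ρ b)
    (hab : IndepFun (fun ω k => a k ω) (fun ω k => b k ω) P)
    (μ μs : Measure ℝ) (ψ : ℝ → ℝ)
    (hμ : IsSpectralMeasure ρ μ) (hdec : IsLebesgueDecomposition μ μs ψ)
    (η : ℝ) (hη : η ∈ Set.Ioo (0 : ℝ) 1) (hlog : LogMemLp ψ (1 + η)) :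
    (∀ n : ℕ, AEMeasurable
      (fun ω => (numZeros (trigPoly a b n ω) 0 (2 * Real.pi) : ℝ≥0∞)) P) ∧
    Tendsto
      (fun n : ℕ => ∫⁻ ω, (numZeros (trigPoly a b n ω) 0 (2 * Real.pi) : ℝ≥0∞) / (n : ℝ≥0∞) ∂P)
      atTop (𝓝 (ENNReal.ofReal (2 / Real.sqrt 3))) := by
  refine ⟨fun n => aemeasurable_numZeros_trigPoly (fun k => ha.gaussian.aemeasurable k)
    (fun k => hb.gaussian.aemeasurable k) n _ _, ?_⟩
  have hψ := hlog.ae_pos hdec.periodic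
  have hint := hlog.integrableOn hη.1 hdec.periodic
  have hdiv : ∀ᶠ n : ℕ in atTop,
      (∫⁻ ω, (numZeros (trigPoly a b n ω) 0 (2 * Real.pi) : ℝ≥0∞) ∂P) / n
        = ∫⁻ ω, (numZeros (trigPoly a b n ω) 0 (2 * Real.pi) : ℝ≥0∞) / (n : ℝ≥0∞) ∂P := by
    filter_upwards [eventually_gt_atTop 0] with n hn
    simp only [div_eq_mul_inv]
    rw [lintegral_mul_const' _ _ (ENNReal.inv_ne_top.2 (by exact_mod_cast hn.ne'))]
  refine Tendsto.congr' hdiv (tendsto_order.2 ⟨fun l hl => ?_, fun u hu => ?_⟩)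
  · have hl' := (ENNReal.lt_ofReal_iff_toReal_lt hl.ne_top).1 hl
    have hlim : Tendsto (fun ε : ℝ => 2 * Real.sqrt (1 / 3 - ε ^ 2)) (𝓝[>] 0)
        (𝓝 (2 / Real.sqrt 3)) := by
      have : Continuous (fun ε : ℝ => 2 * Real.sqrt (1 / 3 - ε ^ 2)) := by fun_prop
      have h0 := this.tendsto 0
      have h1 : 2 * Real.sqrt (1 / 3 - (0 : ℝ) ^ 2) = 2 / Real.sqrt 3 := by
        rw [zero_pow two_ne_zero, sub_zero, Real.sqrt_div zero_le_one, Real.sqrt_one,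
          mul_one_div]
      rw [h1] at h0
      exact h0.mono_left nhdsWithin_le_nhds
    obtain ⟨ε, h1, h2, h3⟩ := ((hlim.eventually_const_lt hl').and
      (Ioc_mem_nhdsGT (zero_lt_one (α := ℝ)))).exists
    filter_upwards [eventually_lt_lintegral_numZeros ha hb hab hμ hdec hψ h2 h3
      ENNReal.toReal_nonneg h1] with n hn
    rwa [ENNReal.ofReal_toReal hl.ne_top] at hn
  · have hlim : Tendsto (fun ε : ℝ => ENNReal.ofReal (2 / Real.sqrt 3 + 2 * ε)) (𝓝[>] 0)
        (𝓝 (ENNReal.ofReal (2 / Real.sqrt 3))) := by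
      have : Continuous (fun ε : ℝ => ENNReal.ofReal (2 / Real.sqrt 3 + 2 * ε)) :=
        ENNReal.continuous_ofReal.comp (by fun_prop)
      have h0 := this.tendsto 0
      rw [mul_zero, add_zero] at h0
      exact h0.mono_left nhdsWithin_le_nhds
    obtain ⟨ε, h1, h2⟩ := ((hlim.eventually_lt_const hu).and self_mem_nhdsWithin).exists
    filter_upwards [eventually_lintegral_numZeros_le ha hb hab hμ hdec hψ hint h2] with n hn
    exact hn.trans_lt h1
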